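/- Let $\mathcal L=(V,E)$ be the infinite ladder graph: $V=\mathbb Z\times\{0,1\}$, with an edge between any two vertices at Euclidean distance one; write $x(v)$ for the first coordinate of $v\in V$ and $\mathbf 0=(0,0)$. Let $\Omega=\{0,1\}^E$ with the product topology and product $\sigma$-field, fix $p\in(0,1)$, and let $\mu_p$ be the law of i.i.d. bond percolation on $\Omega$ in which each edge is open ($\omega(e)=1$) with probability $p$. For $N_1,N_2\in\mathbb N_0$ let $\Omega_{N_1,N_2}$ be the event that some vertex with $x$-coordinate $-N_1$ is joined by an open path to some vertex with $x$-coordinate $N_2$, and let $\Omega^*=\bigcap_{N_1,N_2\ge 0}\Omega_{N_1,N_2}$. For $\lambda>0$ and $\omega\in\Omega$ let $P_{\omega,\lambda}$ be the law on $V^{\mathbb N_0}$ of the Markov chain $(Y_n)_{n\ge 0}$ with $Y_0=\mathbf 0$ and transition probabilities $$p_{\omega,\lambda}(v,w)=\frac{e^{\lambda(x(w)-x(v))}}{e^{\lambda}+1+e^{-\lambda}}\,\mathbf 1_{\{\omega(\langle v,w\rangle)=1\}}\ \text{ for } v\sim w,\qquad p_{\omega,\lambda}(v,v)=1-\sum_{w\sim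 v}p_{\omega,\lambda}(v,w),$$ and put $X_n=x(Y_n)$. Let $$\lambda_c=\tfrac12\log\!\Big(2\big/\big(1+2p-2p^2-\sqrt{1+4p^2-8p^3+4p^4}\,\big)\Big).$$ Then the conditional laws $\mu_p(\,\cdot\mid\Omega_{N_1,N_2})$ converge weakly, as $N_1,N_2\to\infty$, to a probability measure $P_p^*$ on $\Omega$ with $P_p^*(\Omega^*)=1$, and the event $\Omega_{\mathbf 0}$ that $\omega\in\Omega^*$ and the open cluster of $\mathbf 0$ is infinite has $P_p^*(\Omega_{\mathbf 0})>0$. Put $P_p=P_p^*(\,\cdot\mid\Omega_{\mathbf 0})$ and let $\mathbb P_\lambda$ be the joint law of $(\omega,(Y_n)_{n\ge0})$ when $\omega$ has law $P_p$ and, given $\omega$, the walk has law $P_{\omega,\lambda}$. For every $\lambda>0$ there is a deterministic speed $\bar v(\lambda)\in\mathbb R$ with $X_n/n\to\bar v(\lambda)$ $\mathbb P_\lambda$-almost surely, and $\lambda_c>0$ is its critical value: $\bar v(\lambda)>0$ for $0<\lambda<\lambda_c$ and $\bar v(\lambda)=0$ for $\lambda\ge\lambda_c$. Moreover: 1. The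 speed $\bar v$ is continuous in $\lambda$ on $(0,\infty)$. 2. For every $\lambda^*\in(0,\lambda_c)$ and every real $r$ with $1<r<\min(\lambda_c/\lambda^*,2)$, $$\lim_{\lambda\to\lambda^*}\frac{\bar v(\lambda)-\bar v(\lambda^*)}{|\lambda-\lambda^*|^{\,r-1}}=0 .$$ -/

import Mathlib

open MeasureTheory ProbabilityTheory Filter Topology
open scoped ENNReal

noncomputable section

namespace LadderWalk

/-! ### The ladder graph and percolation configurations -/

/-- The vertices of the infinite ladder, `ℤ × {0, 1}`. -/
abbrev V : Type := ℤ × Fin 2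

/-- The infinite ladder graph: two vertices are adjacent iff their Euclidean distance is one. -/
def ladder : SimpleGraph V where
  Adj v w := (v.1 - w.1) ^ 2 + (((v.2 : ℕ) : ℤ) - ((w.2 : ℕ) : ℤ)) ^ 2 = 1
  symm := ⟨fun v w h => by rw [← h]; ring⟩
  loopless := ⟨fun v h => by simp at h⟩

/-- Percolation configurations: each edge of the ladder is open (`true`) or closed (`false`).
The type carries the product topology and the product `σ`-algebra. -/
abbrev Config : Type := ladder.edgeSet → Bool

/-- The spanning subgraph of the ladder formed by the open edges of `ω`. -/
def openGraph (ω : Config) : SimpleGraph V where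
  Adj v w := ∃ h : s(v, w) ∈ ladder.edgeSet, ω ⟨s(v, w), h⟩ = true
  symm := ⟨fun v w ⟨h, hω⟩ => by
    have e : s(w, v) = s(v, w) := Sym2.eq_swap
    exact ⟨e ▸ h, by simpa only [e] using hω⟩⟩
  loopless := ⟨fun v ⟨h, _⟩ => ladder.loopless.irrefl v h⟩

/-- The open cluster of the vertex `v` in `ω`. -/
def cluster (ω : Config) (v : V) : Set V := {w | (openGraph ω).Reachable v w}

/-- The event that an open path joins a vertex with `x`-coordinate `-N₁` to one with
`x`-coordinate `N₂`. -/
def crossing (N₁ N₂ : ℕ) : Set Config :=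
  {ω | ∃ v w : V, v.1 = -(N₁ : ℤ) ∧ w.1 = (N₂ : ℤ) ∧ (openGraph ω).Reachable v w}

/-- The event that there is an open connection from `-∞` to `+∞`. -/
def biInfinite : Set Config := ⋂ (N₁ : ℕ) (N₂ : ℕ), crossing N₁ N₂

/-- The event that there is an open connection from `-∞` to `+∞` and the origin lies in an
infinite open cluster. -/
def originInfinite : Set Config := {ω | ω ∈ biInfinite ∧ (cluster ω (0, 0)).Infinite}

/-! ### The percolation laws -/

/-- I.i.d. bond percolation on the ladder with edge probability `p`. -/
def bondLaw (p : unitInterval) : Measure Config :=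
  Measure.infinitePi fun _ => bernoulliMeasure true false p

/-- I.i.d. bond percolation conditioned on the crossing from `-N₁` to `N₂`. -/
def crossingLaw (p : unitInterval) (N₁ N₂ : ℕ) : Measure Config :=
  ProbabilityTheory.cond (bondLaw p) (crossing N₁ N₂)

/-- `P` is the weak limit of the conditioned laws `crossingLaw p N₁ N₂` as `N₁, N₂ → ∞`. -/
def IsConditionedLaw (p : unitInterval) (P : Measure Config) : Prop :=
  ∀ f : BoundedContinuousFunction Config ℝ,
    Tendsto (fun N : ℕ × ℕ => ∫ ω, f ω ∂(crossingLaw p N.1 N.2)) atTop (𝓝 (∫ ω, f ω ∂P))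

/-! ### The biased random walk in a fixed configuration -/

/-- The neighbours of a vertex of the ladder (see `mem_nbrs`). -/
def nbrs (v : V) : Finset V := {(v.1 + 1, v.2), (v.1 - 1, v.2), (v.1, v.2 + 1)}

lemma mem_nbrs (v w : V) : w ∈ nbrs v ↔ ladder.Adj v w := by
  obtain ⟨a, i⟩ := v
  obtain ⟨b, j⟩ := w
  have h1 : (a - b) ^ 2 = 1 ↔ b = a + 1 ∨ b = a - 1 := by
    constructor
    · intro h
      rcases (mul_self_eq_one_iff.mp ((sq _).symm.trans h)) with h | h <;> omega
    · rintro (h | h) <;> subst h <;> ring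
  have h0 : (a - b) ^ 2 = 0 ↔ b = a := by
    rw [sq_eq_zero_iff]; omega
  fin_cases i <;> fin_cases j <;> simp [nbrs, ladder, h1, h0]

open Classical in
/-- The probability of jumping from `v` to an adjacent vertex `w` along an open edge;
it is zero if there is no open edge between `v` and `w`. -/
def hop (lam : ℝ) (ω : Config) (v w : V) : ℝ :=
  if (openGraph ω).Adj v w then
    Real.exp (lam * ((w.1 : ℝ) - (v.1 : ℝ))) / (Real.exp lam + 1 + Real.exp (-lam))
  else 0

/-- The transition probabilities of the biased walk: with the remaining probability the walk
stays put. -/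
def transProb (lam : ℝ) (ω : Config) (v w : V) : ℝ :=
  if w = v then 1 - ∑ u ∈ nbrs v, hop lam ω v u else hop lam ω v w

lemma hop_nonneg (lam : ℝ) (ω : Config) (v w : V) : 0 ≤ hop lam ω v w := by
  unfold hop
  split_ifs <;> positivity

lemma sum_hop_le (lam : ℝ) (ω : Config) (v : V) : ∑ u ∈ nbrs v, hop lam ω v u ≤ 1 := by
  have hpos : 0 < Real.exp lam + 1 + Real.exp (-lam) := by positivity
  have hle : ∀ u, hop lam ω v u ≤
      Real.exp (lam * ((u.1 : ℝ) - (v.1 : ℝ))) / (Real.exp lam + 1 + Real.exp (-lam)) := by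
    intro u
    unfold hop
    split_ifs
    · exact le_rfl
    · positivity
  refine (Finset.sum_le_sum fun u _ => hle u).trans ?_
  rw [← Finset.sum_div, div_le_one hpos, nbrs, Finset.sum_insert, Finset.sum_insert,
    Finset.sum_singleton]
  · simp
    linarith
  · simp
  · simp
    omega

lemma transProb_nonneg (lam : ℝ) (ω : Config) (v w : V) : 0 ≤ transProb lam ω v w := by
  unfold transProb
  split_ifs
  · linarith [sum_hop_le lam ω v]
  · exact hop_nonneg lam ω v w

lemma not_mem_nbrs_self (v : V) : v ∉ nbrs v := fun h =>
  ladder.loopless.irrefl v ((mem_nbrs v v).1 h)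

lemma sum_transProb (lam : ℝ) (ω : Config) (v : V) :
    ∑ w ∈ insert v (nbrs v), ENNReal.ofReal (transProb lam ω v w) = 1 := by
  rw [← ENNReal.ofReal_sum_of_nonneg fun w _ => transProb_nonneg lam ω v w,
    Finset.sum_insert (not_mem_nbrs_self v)]
  have : ∑ w ∈ nbrs v, transProb lam ω v w = ∑ w ∈ nbrs v, hop lam ω v w := by
    refine Finset.sum_congr rfl fun w hw => ?_
    have : w ≠ v := fun h => not_mem_nbrs_self v (h ▸ hw)
    simp [transProb, this]
  rw [this]
  simp [transProb]

lemma transProb_eq_zero (lam : ℝ) (ω : Config) (v w : V) (hw : w ∉ insert v (nbrs v)) :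
    ENNReal.ofReal (transProb lam ω v w) = 0 := by
  rw [Finset.mem_insert, not_or] at hw
  have h : ¬ (openGraph ω).Adj v w := fun ⟨h, _⟩ => hw.2 ((mem_nbrs v w).2 h)
  simp [transProb, hw.1, hop, h]

/-- One step of the walk from `v`, as a probability mass function on the vertices. -/
def stepPMF (lam : ℝ) (ω : Config) (v : V) : PMF V :=
  PMF.ofFinset (fun w => ENNReal.ofReal (transProb lam ω v w)) (insert v (nbrs v))
    (sum_transProb lam ω v) (transProb_eq_zero lam ω v)

/-- The Markov transition kernel of the walk in the configuration `ω`. -/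
def stepKernel (lam : ℝ) (ω : Config) : Kernel V V :=
  Kernel.ofFunOfCountable fun v => (stepPMF lam ω v).toMeasure

instance (lam : ℝ) (ω : Config) : IsMarkovKernel (stepKernel lam ω) :=
  ⟨fun v => inferInstanceAs (IsProbabilityMeasure (stepPMF lam ω v).toMeasure)⟩

/-- The transition kernel at time `n`, which looks only at the last position of the history. -/
def historyKernel (lam : ℝ) (ω : Config) (n : ℕ) : Kernel (Finset.Iic n → V) V :=
  (stepKernel lam ω).comap (fun h => h ⟨n, Finset.mem_Iic.2 le_rfl⟩) (measurable_pi_apply _)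

instance (lam : ℝ) (ω : Config) (n : ℕ) : IsMarkovKernel (historyKernel lam ω n) :=
  inferInstanceAs (IsMarkovKernel (Kernel.comap _ _ _))

/-- The law on trajectories of the Markov chain with the transition probabilities `transProb`
started at `v`, in the fixed configuration `ω`. -/
def quenchedLaw (lam : ℝ) (v : V) (ω : Config) : Measure (ℕ → V) :=
  Kernel.trajMeasure (X := fun _ => V) (Measure.dirac v) (historyKernel lam ω)

instance (lam : ℝ) (v : V) (ω : Config) : IsProbabilityMeasure (quenchedLaw lam v ω) :=
  inferInstanceAs (IsProbabilityMeasure (Kernel.trajMeasure _ _))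

lemma setOf_path (n : ℕ) (a : ℕ → V) : {y : ℕ → V | ∀ i ≤ n, y i = a i} =
    (Preorder.frestrictLe (π := fun _ => V) n) ⁻¹'
      {(Preorder.frestrictLe (π := fun _ => V) n a)} := by
  ext y
  simp [funext_iff]

/-- The finite-dimensional distributions of the quenched law. -/
lemma quenchedLaw_path (lam : ℝ) (v : V) (ω : Config) (n : ℕ) (a : ℕ → V) :
    quenchedLaw lam v ω {y | ∀ i ≤ n, y i = a i} =
      (if a 0 = v then 1 else 0) *
        ∏ i ∈ Finset.range n, ENNReal.ofReal (transProb lam ω (a i) (a (i + 1))) := by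
  induction n with
  | zero =>
    rw [setOf_path, ← Measure.map_apply (by fun_prop) (by measurability), quenchedLaw,
      Kernel.trajMeasure, Measure.map_comp _ _ (by fun_prop), Kernel.traj_map_frestrictLe,
      Kernel.partialTraj_self, Measure.id_comp, Measure.map_apply (MeasurableEquiv.measurable _) (by measurability),
      Measure.dirac_apply' _ ((MeasurableEquiv.measurable _) (by measurability))]
    have hmem : v ∈ (MeasurableEquiv.piUnique fun i : Finset.Iic 0 => V).symm ⁻¹'
        {Preorder.frestrictLe (π := fun _ => V) 0 a} ↔ a 0 = v := by
      rw [Set.mem_preimage, Set.mem_singleton_iff, MeasurableEquiv.symm_apply_eq]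
      exact eq_comm
    rw [Finset.range_zero, Finset.prod_empty, mul_one]
    by_cases h : a 0 = v
    · rw [if_pos h]
      exact Set.indicator_of_mem (hmem.2 h) _
    · rw [if_neg h]
      exact Set.indicator_of_notMem (fun h' => h (hmem.1 h')) _
  | succ n ih =>
    have hset' : {y : ℕ → V | ∀ i ≤ n + 1, y i = a i} =
        (fun y : ℕ → V => (Preorder.frestrictLe (π := fun _ => V) n y, y (n + 1))) ⁻¹'
          ({Preorder.frestrictLe (π := fun _ => V) n a} ×ˢ {a (n + 1)}) := by
      ext y
      simp only [Set.mem_ofPred_eq, Set.mem_preimage, Set.mem_prod, Set.mem_singleton_iff,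
        funext_iff, Preorder.frestrictLe_apply, Subtype.forall, Finset.mem_Iic]
      constructor
      · exact fun h => ⟨fun i hi => h i (by omega), h _ le_rfl⟩
      · rintro ⟨h, h'⟩ i hi
        rcases Nat.lt_or_ge n i with hn | hn
        · obtain rfl : i = n + 1 := by omega
          exact h'
        · exact h i hn
    have key := Kernel.map_frestrictLe_trajMeasure_compProd_eq_map_trajMeasure
      (X := fun _ => V) (μ₀ := Measure.dirac v) (κ := historyKernel lam ω) (a := n)
    rw [setOf_path, ← Measure.map_apply (by fun_prop) (by measurability)] at ih
    rw [hset', ← Measure.map_apply (by fun_prop) (by measurability)]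
    unfold quenchedLaw at ih ⊢
    rw [← key, Measure.compProd_apply_prod (by measurability) (by measurability),
      lintegral_singleton, ih, Finset.prod_range_succ]
    have hstep : historyKernel lam ω n (Preorder.frestrictLe (π := fun _ => V) n a) {a (n + 1)} =
        ENNReal.ofReal (transProb lam ω (a n) (a (n + 1))) := by
      change (stepPMF lam ω (a n)).toMeasure {a (n + 1)} = _
      rw [PMF.toMeasure_apply_singleton _ _ (by measurability)]
      rfl
    rw [hstep]
    ring

lemma measurable_hop (lam : ℝ) (v w : V) : Measurable fun ω => hop lam ω v w := by
  unfold hop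
  refine Measurable.ite ?_ measurable_const measurable_const
  by_cases h : s(v, w) ∈ ladder.edgeSet
  · have : {ω : Config | (openGraph ω).Adj v w} = {ω | ω ⟨s(v, w), h⟩ = true} := by
      ext ω
      exact ⟨fun ⟨_, h'⟩ => h', fun h' => ⟨h, h'⟩⟩
    rw [this]
    exact measurableSet_eq_fun (measurable_pi_apply _) measurable_const
  · have : {ω : Config | (openGraph ω).Adj v w} = ∅ := by
      ext ω
      simp only [openGraph, Set.mem_ofPred_eq, Set.mem_empty_iff_false, iff_false]
      exact fun ⟨h', _⟩ => h h'
    rw [this]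
    exact MeasurableSet.empty

lemma measurable_transProb (lam : ℝ) (v w : V) : Measurable fun ω => transProb lam ω v w := by
  unfold transProb
  split_ifs
  · exact measurable_const.sub (Finset.measurable_fun_sum _ fun u _ => measurable_hop lam v u)
  · exact measurable_hop lam v w

lemma measurable_quenchedLaw (lam : ℝ) (v : V) : Measurable (quenchedLaw lam v) := by
  refine Measurable.measure_of_isPiSystem_of_isProbabilityMeasure
    (S := measurableCylinders fun _ : ℕ => V) generateFrom_measurableCylinders.symm
    isPiSystem_measurableCylinders fun t ht => ?_
  obtain ⟨N, S, mS, rfl⟩ : ∃ N S, MeasurableSet S ∧ t = cylinder (Finset.Iic N) S := by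
    simpa [measurableCylinders_nat] using ht
  have hm : Measurable (Preorder.frestrictLe (π := fun _ : ℕ => V) N) := by fun_prop
  have h : ∀ ω, quenchedLaw lam v ω (cylinder (Finset.Iic N) S) =
      ∑' x : S, quenchedLaw lam v ω (Preorder.frestrictLe (π := fun _ : ℕ => V) N ⁻¹' {x.1}) := by
    intro ω
    change quenchedLaw lam v ω (Preorder.frestrictLe (π := fun _ : ℕ => V) N ⁻¹' S) = _
    rw [← Measure.map_apply hm mS, ← Measure.tsum_indicator_apply_singleton _ S mS, tsum_subtype S
      fun x => quenchedLaw lam v ω (Preorder.frestrictLe (π := fun _ : ℕ => V) N ⁻¹' {x})]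
    refine tsum_congr fun x => ?_
    simp only [Set.indicator]
    split_ifs
    · rw [Measure.map_apply hm (by measurability)]
    · rfl
  simp_rw [h]
  refine Measurable.tsum fun x => ?_
  obtain ⟨a, ha⟩ : ∃ a : ℕ → V, Preorder.frestrictLe (π := fun _ : ℕ => V) N a = x.1 :=
    ⟨fun i => if hi : i ∈ Finset.Iic N then x.1 ⟨i, hi⟩ else (0, 0), by
      ext1 i
      simp [Finset.mem_Iic.1 i.2]⟩
  simp_rw [← ha, ← setOf_path, quenchedLaw_path]
  exact measurable_const.mul
    (Finset.measurable_fun_prod _ fun i _ => (measurable_transProb lam _ _).ennreal_ofReal)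

/-- The quenched laws started at `v`, as a Markov kernel from configurations to trajectories. -/
def walkKernel (lam : ℝ) (v : V) : Kernel Config (ℕ → V) where
  toFun := quenchedLaw lam v
  measurable' := measurable_quenchedLaw lam v

instance (lam : ℝ) (v : V) : IsMarkovKernel (walkKernel lam v) :=
  ⟨fun ω => inferInstanceAs (IsProbabilityMeasure (quenchedLaw lam v ω))⟩

/-! ### The annealed walk, its speed and the critical bias -/

/-- The joint law of the configuration, drawn from `Q`, and of the walk started at the origin:
the mass of `F × G` is `∫_F quenchedLaw lam 0 ω G dQ(ω)`. -/
def annealedLaw (Q : Measure Config) (lam : ℝ) : Measure (Config × (ℕ → V)) :=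
  Q ⊗ₘ walkKernel lam (0, 0)

/-- The walk with bias `lam` in an environment with law `Q` has the deterministic asymptotic
linear speed `s`: almost surely `X_n / n → s`, where `X_n` is the `x`-coordinate at time `n`. -/
def HasSpeed (Q : Measure Config) (lam s : ℝ) : Prop :=
  ∀ᵐ z ∂(annealedLaw Q lam), Tendsto (fun n : ℕ => ((z.2 n).1 : ℝ) / (n : ℝ)) atTop (𝓝 s)

/-- The critical bias as an explicit function of the percolation parameter. -/
def criticalBias (p : ℝ) : ℝ :=
  1 / 2 * Real.log
    (2 / (1 + 2 * p - 2 * p ^ 2 - Real.sqrt (1 + 4 * p ^ 2 - 8 * p ^ 3 + 4 * p ^ 4)))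

end LadderWalk

end

/-! The speed is the reciprocal of the mean number of visits that the walk pays to a column. That
mean is an integral of a Green function over the environment, and both the phase transition and the
regularity are read off from this formula.

Environment. Let the state of a column be the set of its rows reached from the left. Its transfer
matrix has eigenvalues `rho` > `rho₂`, and crossing probabilities are powers of `rho` up to
constants (`exists_survPair_bounds`). After rescaling, the probabilities of local events together
with a crossing converge (`exists_tendsto_crossingLaw`), and compactness of the space of probability
measures gives the weak limit. Two crossings can be joined by three open edges, so the limit law
mixes up to a constant factor (`limit_mixing`) and is comparable on local events with bond
percolation plus a crossing (`exists_limit_bounds`). A plain column costs p²(1 - p), whereas a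
crossed column costs `rho`; since rho · rho₂ = p³(1 - p), the ratio is exp(-2λ_c) (`rho_eq`). Hence
dead ends of length n have probability of order exp(-2λ_c n), from above by
`exists_limit_plainRun_le` and from below by `exists_le_limit_trapEvent`. The distance to the
nearest cut has an exponential tail (`exists_limit_noCut_le`).

Speed. Give every vertex an independent stack of directions, one for each visit. Watched to the
right of a cut, the walk is the walk in the network there, started at the cut and driven by the same
stacks (`trace_aux`). So, beyond some cut to the right of the origin, the numbers of visits to the
columns form a stationary sequence `colVisits ∘ jointShift i`, in which the starting point plays no
role. The shift is ergodic (`ergodic_jointShift`), and the pointwise ergodic theorem together with a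
count of the elapsed time gives the speed `(meanVisits P lam).toReal⁻¹` (`ae_tendsto_speed`).
Integrating out the stacks turns `meanVisits` into the mean of `colGreen` (`meanVisits_eq`).

Phase transition. The walk is reversible with conductances exp(λ(x + x')). From column 0 one reaches
+∞ by backing out at most to the nearest column that is not plain, so the resistance is at most a
constant times exp(2λ · plainLen). Conversely a dead end carries no current, so at its tip the
potential equals that at its mouth, which is at least of order exp(2λn) for length n
(`le_colGreen_of_trapEvent`). The mean is therefore finite for λ < λ_c and infinite for λ ≥ λ_c, and
the lower bound, a geometric series, forces the speed to 0 at λ_c.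

Regularity. By the resolvent identity the change of the Green function between two biases is a mixed
energy of the two potentials, weighted by the change of the conductances. It is bounded by the
change of the bias times a multiple of (cutDist + 1)² exp(2λ · plainLen) plus a constant
(`abs_green_sub_le`), which is integrable below λ_c. So the speed is locally Lipschitz there
(`isBigO_speed`), and its increments divided by a power r - 1 < 1 of the distance tend to 0. -/

noncomputable section

namespace LadderWalk

/-! ### The pointwise ergodic theorem for ergodic maps -/

section Birkhoff

variable {α : Type*} {T : α → α} {g : α → ℝ}

/-- The maximum of the first Birkhoff sums and zero. -/
def maxBirkhoff (T : α → α) (g : α → ℝ) : ℕ → α → ℝ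
  | 0 => fun _ => 0
  | n + 1 => fun x => max 0 (g x + maxBirkhoff T g n (T x))

lemma maxBirkhoff_nonneg (n : ℕ) (x : α) : 0 ≤ maxBirkhoff T g n x := by
  cases n with
  | zero => exact le_rfl
  | succ n => exact le_max_left _ _

lemma maxBirkhoff_le_succ (n : ℕ) (x : α) :
    maxBirkhoff T g n x ≤ maxBirkhoff T g (n + 1) x := by
  induction n generalizing x with
  | zero => exact le_max_left _ _
  | succ n ih => exact max_le_max le_rfl (add_le_add le_rfl (ih (T x)))

lemma birkhoffSum_le_maxBirkhoff (n : ℕ) (x : α) :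
    birkhoffSum T g n x ≤ maxBirkhoff T g n x := by
  induction n generalizing x with
  | zero => simp [maxBirkhoff]
  | succ n ih =>
    rw [birkhoffSum_succ']
    exact (add_le_add le_rfl (ih (T x))).trans (le_max_right _ _)

variable [MeasurableSpace α] {μ : Measure α}

lemma measurable_maxBirkhoff (hT : Measurable T) (hg : Measurable g) (n : ℕ) :
    Measurable (maxBirkhoff T g n) := by
  induction n with
  | zero => exact measurable_const
  | succ n ih => exact measurable_const.max (hg.add (ih.comp hT))

lemma integrable_maxBirkhoff [IsProbabilityMeasure μ] (hT : MeasurePreserving T μ μ)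
    (hg : Integrable g μ) (n : ℕ) : Integrable (maxBirkhoff T g n) μ := by
  induction n with
  | zero => exact integrable_const _
  | succ n ih =>
    exact (integrable_const (0 : ℝ)).sup (hg.add (hT.integrable_comp_of_integrable ih))

/-- The maximal ergodic inequality. -/
lemma setIntegral_maxBirkhoff_nonneg [IsProbabilityMeasure μ] (hT : MeasurePreserving T μ μ)
    (hg : Integrable g μ) (hgm : Measurable g) (n : ℕ) :
    0 ≤ ∫ x in {x | 0 < maxBirkhoff T g n x}, g x ∂μ := by
  have hM := measurable_maxBirkhoff hT.measurable hgm n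
  have hI := integrable_maxBirkhoff hT hg n
  have hI' : Integrable (fun x => maxBirkhoff T g n (T x)) μ := hT.integrable_comp_of_integrable hI
  have hs : MeasurableSet {x | 0 < maxBirkhoff T g n x} := measurableSet_lt measurable_const hM
  -- Where the maximum is positive it is attained by a nonempty sum, so it equals g plus the
  -- previous maximum at T x, which is at most g plus the current maximum at T x.
  have h1 : ∫ x in {x | 0 < maxBirkhoff T g n x},
      (maxBirkhoff T g n x - maxBirkhoff T g n (T x)) ∂μ ≤
      ∫ x in {x | 0 < maxBirkhoff T g n x}, g x ∂μ := by
    refine setIntegral_mono_on (hI.sub hI').integrableOn hg.integrableOn hs fun x hx => ?_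
    cases n with
    | zero => simp [maxBirkhoff] at hx
    | succ n =>
      have h2 : maxBirkhoff T g (n + 1) x = g x + maxBirkhoff T g n (T x) := by
        have hx' : 0 < max 0 (g x + maxBirkhoff T g n (T x)) := hx
        exact max_eq_right ((lt_max_iff.1 hx').resolve_left (lt_irrefl _)).le
      have h3 := maxBirkhoff_le_succ (T := T) (g := g) n (T x)
      linarith
  -- Off the set the maximum is 0 while its value at T x is nonnegative, so this part of the
  -- integral is nonpositive. The full integral vanishes by invariance.
  have h2 : ∫ x, (maxBirkhoff T g n x - maxBirkhoff T g n (T x)) ∂μ ≤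
      ∫ x in {x | 0 < maxBirkhoff T g n x},
      (maxBirkhoff T g n x - maxBirkhoff T g n (T x)) ∂μ := by
    rw [← integral_indicator hs]
    refine integral_mono (hI.sub hI') ((hI.sub hI').indicator hs) fun x => ?_
    by_cases hx : 0 < maxBirkhoff T g n x
    · simp [Set.indicator, hx]
    · have : maxBirkhoff T g n x = 0 := le_antisymm (not_lt.1 hx) (maxBirkhoff_nonneg n x)
      simp [Set.indicator, this, maxBirkhoff_nonneg]
  have h3 : ∫ x, (maxBirkhoff T g n x - maxBirkhoff T g n (T x)) ∂μ = 0 := by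
    rw [integral_sub hI hI', sub_eq_zero]
    have := integral_map (μ := μ) hT.measurable.aemeasurable (f := maxBirkhoff T g n)
      (by rw [hT.map_eq]; exact hI.aestronglyMeasurable)
    rw [hT.map_eq] at this
    exact this
  linarith

/-- The Birkhoff sums of a function with negative mean are almost surely bounded above. -/
lemma ae_bddAbove_birkhoffSum [IsProbabilityMeasure μ] (hT : Ergodic T μ)
    (hg : Integrable g μ) (hgm : Measurable g) (hneg : ∫ x, g x ∂μ < 0) :
    ∀ᵐ x ∂μ, ∃ K : ℕ, ∀ n, birkhoffSum T g n x ≤ K := by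
  set E : Set α := {x | ∀ K : ℕ, ∃ n, (K : ℝ) < birkhoffSum T g n x} with hE
  have hSm : ∀ n, Measurable (birkhoffSum T g n) := fun n =>
    Finset.measurable_fun_sum _ fun k _ => hgm.comp (hT.measurable.iterate k)
  have hEm : MeasurableSet E := by
    simp only [hE, Set.ofPred_forall, Set.ofPred_exists]
    exact MeasurableSet.iInter fun K => MeasurableSet.iUnion fun n =>
      measurableSet_lt measurable_const (hSm n)
  -- Passing from x to T x changes the sums only by the single term g x, so unboundedness is an
  -- invariant property.
  have hinv : T ⁻¹' E = E := by
    ext x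
    simp only [hE, Set.mem_preimage, Set.mem_ofPred_eq]
    constructor
    · intro h K
      obtain ⟨m, hm⟩ := exists_nat_gt ((K : ℝ) - g x)
      obtain ⟨n, hn⟩ := h m
      exact ⟨n + 1, by rw [birkhoffSum_succ']; linarith⟩
    · intro h K
      obtain ⟨m, hm⟩ := exists_nat_gt ((K : ℝ) + g x)
      obtain ⟨n, hn⟩ := h m
      cases n with
      | zero =>
        simp only [birkhoffSum_zero] at hn
        exact absurd hn (not_lt.2 (Nat.cast_nonneg m))
      | succ n =>
        rw [birkhoffSum_succ'] at hn
        exact ⟨n, by linarith⟩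
  rcases hT.toPreErgodic.ae_mem_or_ae_notMem hEm hinv with h | h
  · exfalso
    -- If the sums are unbounded almost everywhere, the sets of positive maximum exhaust the space.
    -- The maximal inequality then makes the mean of g nonnegative, a contradiction.
    have hlim : Tendsto (fun n => ∫ x in {x | 0 < maxBirkhoff T g n x}, g x ∂μ) atTop
        (𝓝 (∫ x, g x ∂μ)) := by
      have hs : ∀ n, MeasurableSet {x | 0 < maxBirkhoff T g n x} := fun n =>
        measurableSet_lt measurable_const (measurable_maxBirkhoff hT.measurable hgm n)
      simp_rw [← integral_indicator (hs _)]
      refine tendsto_integral_of_dominated_convergence (fun x => |g x|)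
        (fun n => (hg.indicator (hs n)).aestronglyMeasurable) hg.abs ?_ ?_
      · exact fun n => Eventually.of_forall fun x => norm_indicator_le_norm_self _ _
      · filter_upwards [h] with x hx
        obtain ⟨n, hn⟩ := hx 0
        refine tendsto_const_nhds.congr' ?_
        filter_upwards [eventually_ge_atTop n] with m hm
        have h1 : 0 < maxBirkhoff T g m x := by
          have := monotone_nat_of_le_succ (fun k => maxBirkhoff_le_succ (T := T) (g := g) k x) hm
          have h2 := birkhoffSum_le_maxBirkhoff (T := T) (g := g) n x
          simp only [Nat.cast_zero] at hn
          linarith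
        simp [Set.indicator, h1]
    have := ge_of_tendsto' hlim fun n =>
      setIntegral_maxBirkhoff_nonneg hT.toMeasurePreserving hg hgm n
    linarith
  · filter_upwards [h] with x hx
    simpa [hE] using hx

/-- Subtract a number c' strictly between the mean and c. The sums of g - c' are bounded by some K,
and K / n eventually drops below c - c'. -/
lemma ae_eventually_birkhoffSum_le [IsProbabilityMeasure μ] (hT : Ergodic T μ)
    (hg : Integrable g μ) (hgm : Measurable g) {c : ℝ} (hc : ∫ x, g x ∂μ < c) :
    ∀ᵐ x ∂μ, ∀ᶠ n : ℕ in atTop, birkhoffSum T g n x / n ≤ c := by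
  obtain ⟨c', h1, h2⟩ := exists_between hc
  have key := ae_bddAbove_birkhoffSum (g := fun x => g x - c') hT (hg.sub (integrable_const _))
    (hgm.sub_const _) (by rw [integral_sub hg (integrable_const _)]; simpa using h1)
  filter_upwards [key] with x ⟨K, hK⟩
  obtain ⟨m, hm⟩ := exists_nat_gt ((K : ℝ) / (c - c'))
  filter_upwards [eventually_gt_atTop m, eventually_gt_atTop 0] with n hn hn0
  have h0 : (0 : ℝ) < n := by exact_mod_cast hn0
  rw [div_le_iff₀ h0]
  have h3 : birkhoffSum T (fun x => g x - c') n x = birkhoffSum T g n x - n * c' := by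
    simp [birkhoffSum, Finset.sum_sub_distrib]
  have h4 := hK n
  rw [h3] at h4
  rw [div_lt_iff₀ (by linarith)] at hm
  have h5 : (m : ℝ) < n := by exact_mod_cast hn
  nlinarith

/-- The pointwise ergodic theorem for an ergodic map. -/
theorem ae_tendsto_birkhoffSum_div [IsProbabilityMeasure μ] (hT : Ergodic T μ)
    (hg : Integrable g μ) (hgm : Measurable g) :
    ∀ᵐ x ∂μ, Tendsto (fun n : ℕ => birkhoffSum T g n x / n) atTop (𝓝 (∫ x, g x ∂μ)) := by
  have h1 : ∀ᵐ x ∂μ, ∀ k : ℕ, ∀ᶠ n : ℕ in atTop,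
      birkhoffSum T g n x / n ≤ ∫ x, g x ∂μ + 1 / ((k : ℝ) + 1) :=
    ae_all_iff.2 fun k => ae_eventually_birkhoffSum_le hT hg hgm
      (lt_add_of_pos_right _ (by positivity))
  have h2 : ∀ᵐ x ∂μ, ∀ k : ℕ, ∀ᶠ n : ℕ in atTop,
      birkhoffSum T (fun x => -g x) n x / n ≤ ∫ x, -g x ∂μ + 1 / ((k : ℝ) + 1) :=
    ae_all_iff.2 fun k => ae_eventually_birkhoffSum_le hT hg.neg hgm.neg
      (lt_add_of_pos_right _ (by positivity))
  filter_upwards [h1, h2] with x hx1 hx2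
  rw [Metric.tendsto_nhds]
  intro ε hε
  obtain ⟨k, hk⟩ := exists_nat_one_div_lt hε
  filter_upwards [hx1 k, hx2 k] with n hn1 hn2
  have : birkhoffSum T (fun x => -g x) n x = - birkhoffSum T g n x := by
    simp [birkhoffSum]
  rw [this, integral_neg, neg_div] at hn2
  rw [Real.dist_eq, abs_lt]
  constructor <;> linarith

end Birkhoff

/-! ### Events that depend on disjoint sets of coordinates -/

section Dependence

variable {ι : Type*} {X : ι → Type*}

/-- Membership in `A` is determined by the coordinates in `S`. -/
def SetDependsOn (A : Set (∀ i, X i)) (S : Set ι) : Prop :=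
  ∀ x y : ∀ i, X i, (∀ i ∈ S, x i = y i) → (x ∈ A ↔ y ∈ A)

lemma SetDependsOn.mono {A : Set (∀ i, X i)} {S T : Set ι} (h : SetDependsOn A S) (hST : S ⊆ T) :
    SetDependsOn A T := fun x y hxy => h x y fun i hi => hxy i (hST hi)

lemma SetDependsOn.inter {A B : Set (∀ i, X i)} {S T : Set ι} (hA : SetDependsOn A S)
    (hB : SetDependsOn B T) : SetDependsOn (A ∩ B) (S ∪ T) := fun x y hxy =>
  and_congr (hA x y fun i hi => hxy i (Or.inl hi)) (hB x y fun i hi => hxy i (Or.inr hi))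

lemma SetDependsOn.compl {A : Set (∀ i, X i)} {S : Set ι} (hA : SetDependsOn A S) :
    SetDependsOn Aᶜ S := fun x y hxy => not_congr (hA x y hxy)

variable [∀ i, MeasurableSpace (X i)]

open Classical in
lemma SetDependsOn.measurableSet_iSup [∀ i, Nonempty (X i)] {A : Set (∀ i, X i)} {S : Set ι}
    (hA : SetDependsOn A S) (hm : MeasurableSet A) :
    MeasurableSet[⨆ i ∈ S, MeasurableSpace.comap (fun x : ∀ i, X i => x i) inferInstance] A := by
  let z : ∀ i, X i := fun i => Classical.arbitrary _
  -- Freezing the coordinates outside S does not change membership in A, and the freezing map is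
  -- measurable with respect to the coordinates in S alone.
  let φ : (∀ i, X i) → ∀ i, X i := fun x i => if i ∈ S then x i else z i
  have hφ : @Measurable _ _ (⨆ i ∈ S, MeasurableSpace.comap (fun x : ∀ i, X i => x i)
      inferInstance) _ φ := by
    refine @measurable_pi_lambda _ _ _ (_) _ _ fun i => ?_
    by_cases hi : i ∈ S
    · simp only [φ, hi, if_true]
      exact Measurable.mono (comap_measurable _) (le_iSup₂_of_le i hi le_rfl) le_rfl
    · simp only [φ, hi, if_false]
      exact @measurable_const _ _ _ (_) _
  have : A = φ ⁻¹' A := by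
    ext x
    exact hA x (φ x) fun i hi => by simp [φ, hi]
  rw [this]
  exact hφ hm

/-- Events depending on disjoint sets of coordinates are independent under a product measure. -/
lemma infinitePi_inter_of_disjoint [∀ i, Nonempty (X i)] (μ : ∀ i, Measure (X i))
    [∀ i, IsProbabilityMeasure (μ i)]
    {A B : Set (∀ i, X i)} {S T : Set ι} (hA : SetDependsOn A S) (hB : SetDependsOn B T)
    (hAm : MeasurableSet A) (hBm : MeasurableSet B) (hST : Disjoint S T) :
    Measure.infinitePi μ (A ∩ B) = Measure.infinitePi μ A * Measure.infinitePi μ B := by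
  have h := iIndepFun_infinitePi (P := μ) (X := fun i (x : X i) => x) (fun i => measurable_id)
  have h2 := indep_iSup_of_disjoint (fun i => (measurable_pi_apply i).comap_le) h.iIndep hST
  exact (Indep_iff _ _ _).1 h2 _ _ (hA.measurableSet_iSup hAm) (hB.measurableSet_iSup hBm)

/-- A set depending on finitely many coordinates of a product of finite discrete spaces is
measurable and clopen. -/
lemma SetDependsOn.measurableSet_of_finite [∀ i, Nonempty (X i)] [∀ i, Countable (X i)]
    [∀ i, MeasurableSingletonClass (X i)] {A : Set (∀ i, X i)} {S : Set ι} (hS : S.Finite)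
    (hA : SetDependsOn A S) : MeasurableSet A := by
  classical
  let z : ∀ i, X i := fun i => Classical.arbitrary _
  have : Finite S := hS
  have : A = (fun x (i : S) => x i) ⁻¹' {y | (fun i => if h : i ∈ S then y ⟨i, h⟩ else z i) ∈ A} := by
    ext x
    exact hA x _ fun i hi => by simp [hi]
  rw [this]
  exact (Set.to_countable _).measurableSet.preimage
    (measurable_pi_lambda _ fun i => measurable_pi_apply _)

end Dependence

/-! ### The edges of the ladder -/

/-- The horizontal edge in row `j` between the columns `i - 1` and `i`. -/
def hEdge (i : ℤ) (j : Fin 2) : ladder.edgeSet :=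
  ⟨s((i - 1, j), (i, j)), by
    rw [SimpleGraph.mem_edgeSet]
    simp [ladder]⟩

/-- The vertical edge in column `i`. -/
def rEdge (i : ℤ) : ladder.edgeSet :=
  ⟨s((i, 0), (i, 1)), by
    rw [SimpleGraph.mem_edgeSet]
    simp [ladder]⟩

lemma ladder_adj_cases {v w : V} (h : ladder.Adj v w) :
    w = (v.1 + 1, v.2) ∨ w = (v.1 - 1, v.2) ∨ w = (v.1, v.2 + 1) := by
  simpa [nbrs] using (mem_nbrs v w).2 h

lemma edge_cases (e : ladder.edgeSet) : (∃ i j, e = hEdge i j) ∨ ∃ i, e = rEdge i := by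
  obtain ⟨e, he⟩ := e
  induction e using Sym2.ind with
  | _ v w =>
    obtain ⟨a, j⟩ := v
    rcases ladder_adj_cases ((SimpleGraph.mem_edgeSet _).1 he) with rfl | rfl | rfl
    · exact Or.inl ⟨a + 1, j, Subtype.ext (by simp [hEdge])⟩
    · exact Or.inl ⟨a, j, Subtype.ext (by simp [hEdge, Sym2.eq_swap])⟩
    · refine Or.inr ⟨a, Subtype.ext ?_⟩
      fin_cases j <;> simp [rEdge, Sym2.eq_swap]

/-- The sum of the `x`-coordinates of the end points of an edge. -/
def pos (e : ladder.edgeSet) : ℤ :=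
  Sym2.lift ⟨fun v w : V => v.1 + w.1, fun _ _ => add_comm _ _⟩ e.1

-- Horizontal edges have odd positions and vertical edges even ones, so an interval of positions can
-- separate a vertical edge from the horizontal edges on either side of it. Independence is later
-- read off from disjoint intervals.
@[simp] lemma pos_hEdge (i : ℤ) (j : Fin 2) : pos (hEdge i j) = 2 * i - 1 := by
  simp [pos, hEdge]; ring

@[simp] lemma pos_rEdge (i : ℤ) : pos (rEdge i) = 2 * i := by
  simp [pos, rEdge]; ring

/-- The edges whose position lies in `[A, B)`. -/
def span (A B : ℤ) : Set ladder.edgeSet := {e | A ≤ pos e ∧ pos e < B}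

lemma span_disjoint {A B A' B' : ℤ} (h : B ≤ A') : Disjoint (span A B) (span A' B') := by
  rw [Set.disjoint_left]
  rintro e ⟨_, h1⟩ ⟨h2, _⟩
  omega

lemma span_mono {A B A' B' : ℤ} (h1 : A' ≤ A) (h2 : B ≤ B') : span A B ⊆ span A' B' :=
  fun _ h => ⟨h1.trans h.1, h.2.trans_le h2⟩

lemma span_finite (A B : ℤ) : (span A B).Finite := by
  have : span A B ⊆
      ((fun x : ℤ × Fin 2 => hEdge x.1 x.2) '' Set.Icc (-|A|) |B| ×ˢ Set.univ) ∪
      rEdge '' (Set.Icc (-|A|) |B|) := by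
    intro e he
    rcases edge_cases e with ⟨i, j, rfl⟩ | ⟨i, rfl⟩
    · refine Or.inl ⟨(i, j), ⟨?_, trivial⟩, rfl⟩
      have := he.1
      have := he.2
      rw [pos_hEdge] at *
      constructor
      · rcases abs_cases A with h | h <;> omega
      · rcases abs_cases B with h | h <;> omega
    · refine Or.inr ⟨i, ?_, rfl⟩
      have := he.1
      have := he.2
      rw [pos_rEdge] at *
      constructor
      · rcases abs_cases A with h | h <;> omega
      · rcases abs_cases B with h | h <;> omega
  refine Set.Finite.subset (Set.Finite.union (Set.Finite.image _ ?_) (Set.Finite.image _ ?_)) this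
  · exact (Set.finite_Icc _ _).prod Set.finite_univ
  · exact Set.finite_Icc _ _

lemma exists_subset_span {S : Set ladder.edgeSet} (hS : S.Finite) :
    ∃ m : ℕ, S ⊆ span (-2 * (m : ℤ)) (2 * m) := by
  induction S, hS using Set.Finite.induction_on with
  | empty => exact ⟨0, Set.empty_subset _⟩
  | @insert e S _ _ ih =>
    obtain ⟨m, hm⟩ := ih
    refine ⟨m + (pos e).natAbs + 1, Set.insert_subset ?_ (hm.trans (span_mono ?_ ?_))⟩
    · constructor <;> push_cast <;> rcases abs_cases (pos e) with h | h <;> omega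
    · push_cast
      have := abs_nonneg (pos e)
      omega
    · push_cast
      have := abs_nonneg (pos e)
      omega

/-! ### Adjacency in the open graph -/

lemma openGraph_adj_of_edge {ω : Config} {v w : V} {e : ladder.edgeSet} (he : e.1 = s(v, w))
    (h : ω e = true) : (openGraph ω).Adj v w := by
  obtain ⟨e, he'⟩ := e
  subst he
  exact ⟨he', h⟩

lemma openGraph_adj_right {ω : Config} {i : ℤ} {j : Fin 2} :
    (openGraph ω).Adj (i - 1, j) (i, j) ↔ ω (hEdge i j) = true :=
  ⟨fun ⟨_, h⟩ => h, fun h => openGraph_adj_of_edge rfl h⟩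

lemma openGraph_adj_rung {ω : Config} {i : ℤ} :
    (openGraph ω).Adj (i, 0) (i, 1) ↔ ω (rEdge i) = true :=
  ⟨fun ⟨_, h⟩ => h, fun h => openGraph_adj_of_edge rfl h⟩

lemma openGraph_adj_rung' {ω : Config} {i : ℤ} {j j' : Fin 2} (h : ω (rEdge i) = true)
    (hj : j ≠ j') : (openGraph ω).Adj (i, j) (i, j') := by
  fin_cases j <;> fin_cases j'
  · exact absurd rfl hj
  · exact openGraph_adj_rung.2 h
  · exact (openGraph_adj_rung.2 h).symm
  · exact absurd rfl hj

lemma openGraph_adj_cases {ω : Config} {v w : V} (h : (openGraph ω).Adj v w) :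
    (w = (v.1 + 1, v.2) ∧ ω (hEdge (v.1 + 1) v.2) = true) ∨
    (w = (v.1 - 1, v.2) ∧ ω (hEdge v.1 v.2) = true) ∨
    (w = (v.1, v.2 + 1) ∧ ω (rEdge v.1) = true) := by
  obtain ⟨h', hω⟩ := id h
  rcases ladder_adj_cases ((SimpleGraph.mem_edgeSet _).1 h') with rfl | rfl | rfl
  · refine Or.inl ⟨rfl, ?_⟩
    rw [← openGraph_adj_right]
    simpa using h
  · refine Or.inr (Or.inl ⟨rfl, ?_⟩)
    rw [← openGraph_adj_right]
    exact h.symm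
  · refine Or.inr (Or.inr ⟨rfl, ?_⟩)
    obtain ⟨a, j⟩ := v
    rw [← openGraph_adj_rung]
    fin_cases j
    · exact h
    · exact h.symm

/-- The open edges in the columns `≥ i`. -/
def rightGraph (ω : Config) (i : ℤ) : SimpleGraph V where
  Adj v w := (openGraph ω).Adj v w ∧ i ≤ v.1 ∧ i ≤ w.1
  symm := ⟨fun _ _ h => ⟨h.1.symm, h.2.2, h.2.1⟩⟩
  loopless := ⟨fun v h => (openGraph ω).loopless.irrefl v h.1⟩

lemma rightGraph_le (ω : Config) (i : ℤ) : rightGraph ω i ≤ openGraph ω := fun _ _ h => h.1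

lemma rightGraph_adj_right {ω : Config} {i a : ℤ} {j : Fin 2} (h : ω (hEdge (a + 1) j) = true)
    (hi : i ≤ a) : (rightGraph ω i).Adj (a, j) (a + 1, j) :=
  ⟨by simpa using openGraph_adj_right.2 h, hi, by simpa using hi.trans (by omega)⟩

/-- An open path that ends in the columns `≥ a` either stays there or enters through an open
horizontal edge and stays there. -/
lemma rightGraph_enter {ω : Config} {a : ℤ} {x w : V} (h : (openGraph ω).Reachable x w)
    (hw : a ≤ w.1) : (a ≤ x.1 ∧ (rightGraph ω a).Reachable x w) ∨
      ∃ j, ω (hEdge a j) = true ∧ (rightGraph ω a).Reachable (a, j) w := by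
  obtain ⟨p⟩ := h
  induction p with
  | nil => exact Or.inl ⟨hw, SimpleGraph.Reachable.refl _⟩
  | @cons x x' w hadj p ih =>
    rcases ih hw with ⟨h1, h2⟩ | h
    · by_cases hx : a ≤ x.1
      · have h3 : (rightGraph ω a).Adj x x' := ⟨hadj, hx, h1⟩
        exact Or.inl ⟨hx, h3.reachable.trans h2⟩
      · right
        rcases openGraph_adj_cases hadj with ⟨rfl, h⟩ | ⟨rfl, h⟩ | ⟨rfl, h⟩
        · have hxa : x.1 + 1 = a := by simp at h1; omega
          exact ⟨x.2, hxa ▸ h, hxa ▸ h2⟩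
        · simp at h1; omega
        · simp at h1; omega
    · exact Or.inr h

/-- If the vertical edge in column `i` is closed, then the vertices of this column are dead ends
of the graph to the right of it. -/
lemma rightGraph_retract {ω : Config} {i : ℤ} {j : Fin 2} {w : V} (hr : ω (rEdge i) = false)
    (hw : i + 1 ≤ w.1) (h : (rightGraph ω i).Reachable (i, j) w) :
    ω (hEdge (i + 1) j) = true ∧ (rightGraph ω (i + 1)).Reachable (i + 1, j) w := by
  constructor
  · obtain ⟨p⟩ := h
    cases p with
    | nil => simp at hw
    | @cons _ x' _ hadj p =>
      rcases openGraph_adj_cases hadj.1 with ⟨rfl, h⟩ | ⟨rfl, h⟩ | ⟨rfl, h⟩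
      · exact h
      · have := hadj.2.2
        simp at this
      · simp [hr] at h
  -- Fold column i onto column i + 1. As the vertical edge of column i is closed, every edge of the
  -- path either survives or collapses to a point.
  · let f : V → V := fun v => if v.1 = i then (i + 1, v.2) else v
    have key : ∀ x y : V, (rightGraph ω i).Reachable x y →
        (rightGraph ω (i + 1)).Reachable (f x) (f y) := by
      rintro x y ⟨p⟩
      induction p with
      | nil => exact SimpleGraph.Reachable.refl _
      | @cons x x' y hadj p ih =>
        refine SimpleGraph.Reachable.trans ?_ ih
        obtain ⟨h1, h2, h3⟩ := hadj
        by_cases hx : x.1 = i <;> by_cases hx' : x'.1 = i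
        · rcases openGraph_adj_cases h1 with ⟨rfl, h⟩ | ⟨rfl, h⟩ | ⟨rfl, h⟩
          · simp at hx'; omega
          · simp at hx'; omega
          · rw [hx, hr] at h; simp at h
        · rcases openGraph_adj_cases h1 with ⟨rfl, h⟩ | ⟨rfl, h⟩ | ⟨rfl, h⟩
          · simp [f, hx]
          · simp at h3; omega
          · simp at hx'; omega
        · rcases openGraph_adj_cases h1 with ⟨rfl, h⟩ | ⟨rfl, h⟩ | ⟨rfl, h⟩
          · simp at hx'; omega
          · have : x = (i + 1, x.2) := Prod.ext (by simp at hx'; omega) rfl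
            rw [this]
            simp [f]
          · simp at hx'; omega
        · simp only [f, hx, hx', if_false]
          exact SimpleGraph.Adj.reachable ⟨h1, by omega, by omega⟩
    have := key _ _ h
    have hw' : w.1 ≠ i := by omega
    simpa [f, hw'] using this

/-! ### The rows reached from the left -/

/-- The rows reached in the next column, given the vertical edge `r` of the current column, the
horizontal edges `h` to the next column and the rows `s` reached in the current column. -/
def next (r : Bool) (h s : Fin 2 → Bool) : Fin 2 → Bool :=
  fun j => h j && (s j || (r && (s 0 || s 1)))

/-- The state in which both rows are reached. -/
abbrev full : Fin 2 → Bool := fun _ => true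

/-- The rows reached in column `a + n` from the rows `s` in column `a`, by open paths from the left
that do not use the vertical edge of column `a + n`. -/
def reach (ω : Config) (a : ℤ) (s : Fin 2 → Bool) : ℕ → Fin 2 → Bool
  | 0 => s
  | n + 1 => next (ω (rEdge (a + n))) (fun j => ω (hEdge (a + n + 1) j)) (reach ω a s n)

lemma reach_add (ω : Config) (a : ℤ) (s : Fin 2 → Bool) (n k : ℕ) :
    reach ω a s (n + k) = reach ω (a + n) (reach ω a s n) k := by
  induction k with
  | zero => rfl
  | succ k ih =>
    rw [← add_assoc, reach, ih, reach]
    push_cast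
    simp only [add_assoc]

lemma next_mono {r : Bool} {h s s' : Fin 2 → Bool} (hs : ∀ j, s j = true → s' j = true) (j : Fin 2)
    (hj : next r h s j = true) : next r h s' j = true := by
  have h0 := hs 0
  have h1 := hs 1
  have h2 := hs j
  simp only [next, Bool.and_eq_true, Bool.or_eq_true] at *
  tauto

lemma reach_mono {ω : Config} {a : ℤ} {s s' : Fin 2 → Bool} (hs : ∀ j, s j = true → s' j = true)
    (n : ℕ) (j : Fin 2) (hj : reach ω a s n j = true) : reach ω a s' n j = true := by
  induction n generalizing j with
  | zero => exact hs j hj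
  | succ n ih => exact next_mono ih j hj

lemma reach_zero_of_ne {ω : Config} {a : ℤ} {s : Fin 2 → Bool} (hs : ∀ j, s j = false)
    (n : ℕ) (j : Fin 2) : reach ω a s n j = false := by
  induction n generalizing j with
  | zero => exact hs j
  | succ n ih => simp [reach, next, ih]

lemma fin_two_cases (j : Fin 2) : j = 0 ∨ j = 1 := by omega

/-- The rows recorded by `reach` are joined to the starting column. -/
lemma exists_reachable_of_reach {ω : Config} {a : ℤ} {s : Fin 2 → Bool} {n : ℕ} {j : Fin 2}
    (h : reach ω a s n j = true) :
    ∃ j₀, s j₀ = true ∧ (rightGraph ω a).Reachable (a, j₀) (a + n, j) := by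
  induction n generalizing j with
  | zero => exact ⟨j, h, by simp⟩
  | succ n ih =>
    simp only [reach, next, Bool.and_eq_true, Bool.or_eq_true] at h
    obtain ⟨hh, h⟩ := h
    have hstep : (rightGraph ω a).Reachable (a + n, j) (a + (n + 1 : ℕ), j) := by
      have := rightGraph_adj_right (i := a) hh (by omega)
      push_cast
      rw [← add_assoc]
      exact this.reachable
    have : ∃ j', reach ω a s n j' = true ∧
        (rightGraph ω a).Reachable (a + n, j') (a + n, j) := by
      rcases h with h | ⟨hr, h⟩
      · exact ⟨j, h, SimpleGraph.Reachable.refl _⟩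
      · have hadj : ∀ j', (rightGraph ω a).Reachable (a + n, j') (a + n, j) := by
          intro j'
          by_cases hj : j' = j
          · rw [hj]
          · exact SimpleGraph.Adj.reachable ⟨openGraph_adj_rung' hr hj, by simp, by simp⟩
        rcases h with h | h
        · exact ⟨0, h, hadj 0⟩
        · exact ⟨1, h, hadj 1⟩
    obtain ⟨j', hj', hreach⟩ := this
    obtain ⟨j₀, h0, h1⟩ := ih hj'
    exact ⟨j₀, h0, (h1.trans hreach).trans hstep⟩

/-- A path to the right is recorded by `reach`. -/
lemma exists_reach_of_reachable {ω : Config} {a : ℤ} {n : ℕ} {j₀ : Fin 2} {w : V}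
    (hw : w.1 = a + n) (h : (rightGraph ω a).Reachable (a, j₀) w) :
    ∃ j, reach ω a full n j = true := by
  -- The second alternative is needed because `reach` does not yet use the vertical edge of the
  -- column where it stops, whereas the path may.
  have key : ∀ k ≤ n, ∃ j, (reach ω a full k j = true ∨
      (ω (rEdge (a + k)) = true ∧ ∃ j', reach ω a full k j' = true)) ∧
      (rightGraph ω (a + k)).Reachable (a + k, j) w := by
    intro k
    induction k with
    | zero => exact fun _ => ⟨j₀, Or.inl rfl, by simpa using h⟩
    | succ k ih =>
      intro hk
      obtain ⟨j, h1, h2⟩ := ih (by omega)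
      have hwk : a + k + 1 ≤ w.1 := by omega
      push_cast
      rw [← add_assoc]
      by_cases hr : ω (rEdge (a + k)) = true
      · rcases rightGraph_enter (h2.mono (rightGraph_le _ _)) hwk with ⟨h3, _⟩ | ⟨j', h3, h4⟩
        · simp at h3
        · refine ⟨j', Or.inl ?_, h4⟩
          have : ∃ j', reach ω a full k j' = true := by
            rcases h1 with h1 | h1
            · exact ⟨j, h1⟩
            · exact h1.2
          obtain ⟨j'', hj''⟩ := this
          simp only [reach, next, h3, hr, Bool.true_and, Bool.or_eq_true]
          right
          rcases fin_two_cases j'' with rfl | rfl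
          · exact Or.inl hj''
          · exact Or.inr hj''
      · have hr' : ω (rEdge (a + k)) = false := by simpa using hr
        obtain ⟨h3, h4⟩ := rightGraph_retract hr' hwk h2
        refine ⟨j, Or.inl ?_, h4⟩
        rcases h1 with h1 | h1
        · simp [reach, next, h3, h1]
        · exact absurd h1.1 hr
  obtain ⟨j, h1, _⟩ := key n le_rfl
  rcases h1 with h1 | ⟨_, h1⟩
  · exact ⟨j, h1⟩
  · exact h1

/-- The event that the columns `a` and `a + n` are joined by an open path between them. -/
def cross (a : ℤ) (n : ℕ) : Set Config := {ω | ∃ j, reach ω a full n j = true}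

lemma crossing_eq_cross (N₁ N₂ : ℕ) : crossing N₁ N₂ = cross (-(N₁ : ℤ)) (N₁ + N₂) := by
  ext ω
  constructor
  · rintro ⟨v, w, hv, hw, h⟩
    have hw' : w.1 = -(N₁ : ℤ) + (N₁ + N₂ : ℕ) := by push_cast; omega
    rcases rightGraph_enter (a := -(N₁ : ℤ)) h (by omega) with ⟨_, h2⟩ | ⟨j, _, h2⟩
    · have : v = (-(N₁ : ℤ), v.2) := Prod.ext hv rfl
      rw [this] at h2
      exact exists_reach_of_reachable hw' h2
    · exact exists_reach_of_reachable hw' h2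
  · rintro ⟨j, h⟩
    obtain ⟨j₀, _, h⟩ := exists_reachable_of_reach h
    exact ⟨_, _, rfl, by push_cast; ring, h.mono (rightGraph_le _ _)⟩

/-! ### Locality -/

lemma reach_congr {ω ω' : Config} {a : ℤ} {s : Fin 2 → Bool} {n : ℕ}
    (h : ∀ e ∈ span (2 * a) (2 * (a + n)), ω e = ω' e) : reach ω a s n = reach ω' a s n := by
  induction n with
  | zero => rfl
  | succ n ih =>
    rw [reach, reach, ih fun e he => h e (span_mono le_rfl (by push_cast; omega) he),
      h (rEdge (a + n)) ⟨by simp, by simp⟩]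
    congr 1
    funext j
    exact h _ ⟨by simp, by simp⟩

/-- When both rows are reached from the outset, the vertical edge of the first column has no effect,
so the interval starts at 2a + 1. This leaves exactly the positions used by `glue` free between two
consecutive crossings. -/
lemma reach_full_congr {ω ω' : Config} {a : ℤ} {n : ℕ}
    (h : ∀ e ∈ span (2 * a + 1) (2 * (a + n)), ω e = ω' e) :
    reach ω a full n = reach ω' a full n := by
  induction n with
  | zero => rfl
  | succ n ih =>
    have ih' := ih fun e he => h e (span_mono le_rfl (by push_cast; omega) he)
    have hh : (fun j => ω (hEdge (a + n + 1) j)) = fun j => ω' (hEdge (a + n + 1) j) := by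
      funext j
      exact h _ ⟨by simp; omega, by simp⟩
    rw [reach, reach, ih', hh]
    rcases Nat.eq_zero_or_pos n with rfl | hn
    · funext j
      simp [next, reach]
    · rw [h (rEdge (a + n)) ⟨by simp ; omega, by simp⟩]

lemma cross_dependsOn (a : ℤ) (n : ℕ) :
    SetDependsOn (cross a n) (span (2 * a + 1) (2 * (a + n))) := fun ω ω' h => by
  simp only [cross, Set.mem_ofPred_eq, reach_full_congr h]

/-- A state with no row reached stays so, which gives the left crossing. The state `full` dominates
whatever state arrives at the right block, which gives the right one. -/
lemma cross_add_subset (a : ℤ) (n k : ℕ) :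
    cross a (n + 1 + k) ⊆ cross a n ∩ cross (a + n + 1) k := by
  rintro ω ⟨j, h⟩
  rw [reach_add] at h
  constructor
  · by_contra hne
    have h0 : ∀ j, reach ω a full n j = false := fun j => by
      by_contra hj
      exact hne ⟨j, by simpa using hj⟩
    rw [← reach_add, add_assoc, reach_add, reach_zero_of_ne h0] at h
    exact Bool.false_ne_true h
  · refine ⟨j, ?_⟩
    push_cast at h
    rw [← add_assoc] at h
    exact reach_mono (fun j _ => rfl) _ _ h

/-- The edges that join a path ending in column `i` to a path starting in column `i + 1`. -/
def glue (i : ℤ) : Set Config :=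
  {ω | ω (rEdge i) = true ∧ ω (hEdge (i + 1) 0) = true ∧ ω (rEdge (i + 1)) = true}

lemma glue_dependsOn (i : ℤ) : SetDependsOn (glue i) (span (2 * i) (2 * i + 3)) := fun ω ω' h => by
  simp only [glue, Set.mem_ofPred_eq]
  rw [h (rEdge i) ⟨by simp, by simp⟩, h (hEdge (i + 1) 0) ⟨by simp, by simp; omega⟩,
    h (rEdge (i + 1)) ⟨by simp, by simp; omega⟩]

/-- The first vertical edge brings any row that is reached to row 0, the horizontal edge passes on,
and the second vertical edge makes the start in the next column indistinguishable from `full`. -/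
lemma inter_glue_subset (a : ℤ) (n k : ℕ) :
    cross a n ∩ glue (a + n) ∩ cross (a + n + 1) k ⊆ cross a (n + 1 + k) := by
  rintro ω ⟨⟨⟨j, hj⟩, hg1, hg2, hg3⟩, j', hj'⟩
  have h1 : reach ω a full (n + 1) 0 = true := by
    simp only [reach, next, hg1, hg2, Bool.true_and, Bool.or_eq_true]
    rcases fin_two_cases j with rfl | rfl
    · exact Or.inl hj
    · exact Or.inr (Or.inr hj)
  -- For k = 0 the vertical edge of the last column is not used by `reach`, but no further step is
  -- needed either.
  cases k with
  | zero => exact ⟨0, h1⟩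
  | succ k =>
    refine ⟨j', ?_⟩
    rw [reach_add]
    have e : ∀ s : Fin 2 → Bool, s 0 = true → reach ω (a + n + 1) s (k + 1) =
        reach ω (a + n + 1) full (k + 1) := by
      intro s hs
      rw [add_comm k 1, reach_add, reach_add ω _ full]
      congr 1
      funext j
      simp only [reach, next, Nat.cast_zero, add_zero, hg3, hs]
      simp
    have e2 : a + ((n + 1 : ℕ) : ℤ) = a + n + 1 := by push_cast; ring
    rw [e2, e _ h1]
    exact hj'

/-! ### The column shift -/

/-- Translation of the edges by `k` columns. -/
def shiftEdge (k : ℤ) (e : ladder.edgeSet) : ladder.edgeSet :=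
  ⟨Sym2.map (fun v : V => (v.1 + k, v.2)) e.1, by
    obtain ⟨e, he⟩ := e
    induction e using Sym2.ind with
    | _ v w =>
      rw [SimpleGraph.mem_edgeSet] at he
      simpa [ladder] using he⟩

@[simp] lemma shiftEdge_hEdge (k i : ℤ) (j : Fin 2) : shiftEdge k (hEdge i j) = hEdge (i + k) j :=
  Subtype.ext (by simp [shiftEdge, hEdge]; ring)

@[simp] lemma shiftEdge_rEdge (k i : ℤ) : shiftEdge k (rEdge i) = rEdge (i + k) :=
  Subtype.ext (by simp [shiftEdge, rEdge])

@[simp] lemma pos_shiftEdge (k : ℤ) (e : ladder.edgeSet) : pos (shiftEdge k e) = pos e + 2 * k := by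
  rcases edge_cases e with ⟨i, j, rfl⟩ | ⟨i, rfl⟩
  · simp; ring
  · simp; ring

lemma shiftEdge_shiftEdge (k l : ℤ) (e : ladder.edgeSet) :
    shiftEdge k (shiftEdge l e) = shiftEdge (k + l) e := by
  rcases edge_cases e with ⟨i, j, rfl⟩ | ⟨i, rfl⟩
  · simp; ring_nf
  · simp; ring_nf

lemma shiftEdge_zero (e : ladder.edgeSet) : shiftEdge 0 e = e := by
  rcases edge_cases e with ⟨i, j, rfl⟩ | ⟨i, rfl⟩ <;> simp

/-- The configuration seen from column `k`. -/
def shiftConfig (k : ℤ) (ω : Config) : Config := fun e => ω (shiftEdge k e)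

lemma shiftConfig_shiftConfig (k l : ℤ) (ω : Config) :
    shiftConfig k (shiftConfig l ω) = shiftConfig (k + l) ω := by
  funext e
  simp [shiftConfig, shiftEdge_shiftEdge, add_comm]

lemma shiftConfig_zero (ω : Config) : shiftConfig 0 ω = ω := by
  funext e
  simp [shiftConfig, shiftEdge_zero]

lemma measurable_shiftConfig (k : ℤ) : Measurable (shiftConfig k) :=
  measurable_pi_lambda _ fun _ => measurable_pi_apply _

lemma reach_shiftConfig (k : ℤ) (ω : Config) (a : ℤ) (s : Fin 2 → Bool) (n : ℕ) :
    reach (shiftConfig k ω) a s n = reach ω (a + k) s n := by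
  induction n with
  | zero => rfl
  | succ n ih =>
    rw [reach, reach, ih]
    simp only [shiftConfig, shiftEdge_hEdge, shiftEdge_rEdge]
    congr 3
    · ring
    · funext j
      ring_nf

/-! ### Bond percolation -/

instance (p : unitInterval) : IsProbabilityMeasure (bondLaw p) := by
  unfold bondLaw; infer_instance

/-- The probability that an edge is in the given state. -/
def wt (p : ℝ) (b : Bool) : ℝ := if b then p else 1 - p

lemma measureReal_eq_sum_inter {Ω δ : Type*} [MeasurableSpace Ω] [Fintype δ] (μ : Measure Ω)
    [IsFiniteMeasure μ] {A : Set Ω} (hA : MeasurableSet A) (D : Ω → δ)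
    (hD : ∀ d, MeasurableSet {ω | D ω = d}) :
    μ.real A = ∑ d, μ.real (A ∩ {ω | D ω = d}) := by
  rw [← measureReal_biUnion_finset]
  · congr 1
    ext ω
    simp
  · intro d _ d' _ hdd'
    rw [Function.onFun, Set.disjoint_left]
    rintro ω ⟨_, h1⟩ ⟨_, h2⟩
    exact hdd' (h1.symm.trans h2)
  · exact fun d _ => hA.inter (hD d)

lemma bondLaw_real_edge (p : unitInterval) (e : ladder.edgeSet) (b : Bool) :
    (bondLaw p).real {ω | ω e = b} = wt p b := by
  have h := (measurePreserving_eval_infinitePi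
    (fun _ : ladder.edgeSet => bernoulliMeasure true false p) e)
  have : (bondLaw p).real {ω | ω e = b} = (bernoulliMeasure true false p).real {b} := by
    rw [measureReal_def, measureReal_def, ← h.measure_preimage (MeasurableSet.singleton b).nullMeasurableSet]
    rfl
  rw [this, bernoulliMeasure_real_apply p (MeasurableSet.singleton b)]
  cases b <;> simp [wt, unitInterval.coe_symm_eq]

lemma bondLaw_real_inter (p : unitInterval) {A B : Set Config} {S T : Set ladder.edgeSet}
    (hA : SetDependsOn A S) (hB : SetDependsOn B T) (hAm : MeasurableSet A) (hBm : MeasurableSet B)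
    (hST : Disjoint S T) :
    (bondLaw p).real (A ∩ B) = (bondLaw p).real A * (bondLaw p).real B := by
  simp only [measureReal_def, bondLaw]
  rw [infinitePi_inter_of_disjoint _ hA hB hAm hBm hST, ENNReal.toReal_mul]

lemma edge_dependsOn (e : ladder.edgeSet) (b : Bool) :
    SetDependsOn {ω : Config | ω e = b} {e} := fun ω ω' h => by
  simp [h e rfl]

lemma SetDependsOn.measurableSet_config {A : Set Config} {a b : ℤ} (h : SetDependsOn A (span a b)) :
    MeasurableSet A := h.measurableSet_of_finite (span_finite a b)

lemma bondLaw_real_inter_edge (p : unitInterval) {A : Set Config} {S : Set ladder.edgeSet}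
    (hA : SetDependsOn A S) (hAm : MeasurableSet A) {e : ladder.edgeSet} (he : e ∉ S) (b : Bool) :
    (bondLaw p).real (A ∩ {ω | ω e = b}) = (bondLaw p).real A * wt p b := by
  rw [bondLaw_real_inter p hA (edge_dependsOn e b) hAm
    ((edge_dependsOn e b).measurableSet_of_finite (Set.finite_singleton e))
    (Set.disjoint_singleton_right.2 he), bondLaw_real_edge]

/-- The states of the vertical edge in column `i` and of the horizontal edges that follow it. -/
def triple (ω : Config) (i : ℤ) : Bool × Bool × Bool :=
  (ω (rEdge i), ω (hEdge (i + 1) 0), ω (hEdge (i + 1) 1))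

lemma hEdge_injective {i i' : ℤ} {j j' : Fin 2} (h : hEdge i j = hEdge i' j') : j = j' := by
  have := congrArg Subtype.val h
  simp only [hEdge, Sym2.eq_iff, Prod.mk.injEq] at this
  tauto

lemma triple_dependsOn (i : ℤ) (t : Bool × Bool × Bool) :
    SetDependsOn {ω | triple ω i = t} (span (2 * i) (2 * i + 2)) := fun ω ω' h => by
  simp only [Set.mem_ofPred_eq, triple]
  rw [h (rEdge i) ⟨by simp, by simp⟩, h (hEdge (i + 1) 0) ⟨by simp, by simp; omega⟩,
    h (hEdge (i + 1) 1) ⟨by simp, by simp; omega⟩]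

lemma bondLaw_real_triple (p : unitInterval) (i : ℤ) (t : Bool × Bool × Bool) :
    (bondLaw p).real {ω | triple ω i = t} = wt p t.1 * wt p t.2.1 * wt p t.2.2 := by
  obtain ⟨r, x, y⟩ := t
  have hset : {ω | triple ω i = (r, x, y)} =
      ({ω : Config | ω (rEdge i) = r} ∩ {ω | ω (hEdge (i + 1) 0) = x}) ∩
        {ω | ω (hEdge (i + 1) 1) = y} := by
    ext ω
    simp [triple, and_assoc]
  have hm : ∀ (e : ladder.edgeSet) b, MeasurableSet {ω : Config | ω e = b} := fun e b =>
    (edge_dependsOn e b).measurableSet_of_finite (Set.finite_singleton e)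
  have h1 : hEdge (i + 1) 0 ∉ ({rEdge i} : Set ladder.edgeSet) := fun h => by
    have := congrArg pos (Set.mem_singleton_iff.1 h)
    simp at this
    omega
  have h2 : hEdge (i + 1) 1 ∉ ({rEdge i} ∪ {hEdge (i + 1) 0} : Set ladder.edgeSet) := by
    rintro (h | h)
    · have := congrArg pos (Set.mem_singleton_iff.1 h)
      simp at this
      omega
    · exact absurd (hEdge_injective (Set.mem_singleton_iff.1 h)) (by decide)
  rw [hset, bondLaw_real_inter_edge p ((edge_dependsOn _ _).inter (edge_dependsOn _ _))
    ((hm _ _).inter (hm _ _)) h2, bondLaw_real_inter_edge p (edge_dependsOn _ _) (hm _ _) h1,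
    bondLaw_real_edge]

lemma reach_dependsOn (a : ℤ) (s t : Fin 2 → Bool) (n : ℕ) :
    SetDependsOn {ω | reach ω a s n = t} (span (2 * a) (2 * (a + n))) := fun ω ω' h => by
  simp only [Set.mem_ofPred_eq, reach_congr h]

/-- The event that the rows `s` of column `a` are joined to column `a + n`. -/
def survive (a : ℤ) (s : Fin 2 → Bool) (n : ℕ) : Set Config := {ω | ∃ j, reach ω a s n j = true}

lemma survive_dependsOn (a : ℤ) (s : Fin 2 → Bool) (n : ℕ) :
    SetDependsOn (survive a s n) (span (2 * a) (2 * (a + n))) := fun ω ω' h => by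
  simp only [survive, Set.mem_ofPred_eq, reach_congr h]

lemma reach_succ_triple (ω : Config) (a : ℤ) (s : Fin 2 → Bool) (n : ℕ) (t : Bool × Bool × Bool)
    (h : triple ω (a + n) = t) : reach ω a s (n + 1) = next t.1 ![t.2.1, t.2.2] (reach ω a s n) := by
  subst h
  rw [reach]
  congr 1
  funext j
  fin_cases j <;> simp [triple]

/-- The pair (probability that both rows are reached, probability that a given single row is)
after `n` columns. -/
def lawPair (p : ℝ) : ℕ → ℝ × ℝ
  | 0 => (1, 0)
  | n + 1 => (p ^ 2 * (lawPair p n).1 + 2 * p ^ 3 * (lawPair p n).2,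
      p * (1 - p) * (lawPair p n).1 + p * (1 - p) * (1 + 2 * p) * (lawPair p n).2)

/-- The pair of survival probabilities for `n` columns, from both rows and from a single row. -/
def survPair (p : ℝ) : ℕ → ℝ × ℝ
  | 0 => (1, 1)
  | n + 1 => (p ^ 2 * (survPair p n).1 + 2 * p * (1 - p) * (survPair p n).2,
      p ^ 3 * (survPair p n).1 + p * (1 - p) * (1 + 2 * p) * (survPair p n).2)

/-- Selects the entry of a pair that belongs to a state. -/
def pick (x : ℝ × ℝ) (s : Fin 2 → Bool) : ℝ :=
  if s 0 && s 1 then x.1 else if s 0 || s 1 then x.2 else 0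

lemma sum_state (f : (Fin 2 → Bool) → ℝ) :
    ∑ s, f s = f ![true, true] + f ![true, false] + f ![false, true] + f ![false, false] := by
  rw [← (finTwoArrowEquiv Bool).symm.sum_comp, Fintype.sum_prod_type]
  simp only [Fintype.sum_bool, finTwoArrowEquiv_symm_apply]
  ring

lemma sum_triple (f : Bool × Bool × Bool → ℝ) :
    ∑ t, f t = f (true, true, true) + f (true, true, false) + f (true, false, true) +
      f (true, false, false) + f (false, true, true) + f (false, true, false) +
      f (false, false, true) + f (false, false, false) := by
  simp only [Fintype.sum_prod_type, Fintype.sum_bool]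
  ring

/-- First-step analysis: given the edges of the first column, what remains is an independent
survival event from the next state. Two numbers suffice because the two single-row states are
exchanged by reflection. -/
lemma bondLaw_real_survive (p : unitInterval) (a : ℤ) (s : Fin 2 → Bool) (n : ℕ) :
    (bondLaw p).real (survive a s n) = pick (survPair p n) s := by
  induction n generalizing a s with
  | zero =>
    by_cases h : ∃ j, s j = true
    · have : survive a s 0 = Set.univ := by ext; simpa [survive, reach] using h
      rw [this, probReal_univ]
      obtain ⟨j, hj⟩ := h
      rcases fin_two_cases j with rfl | rfl
      · cases h1 : s 1 <;> simp [pick, survPair, hj, h1]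
      · cases h0 : s 0 <;> simp [pick, survPair, hj, h0]
    · have : survive a s 0 = ∅ := by ext; simpa [survive, reach] using h
      push Not at h
      have h0 : s 0 = false := by simpa using h 0
      have h1 : s 1 = false := by simpa using h 1
      simp [this, pick, h0, h1]
  | succ n ih =>
    rw [measureReal_eq_sum_inter (bondLaw p) (survive_dependsOn a s (n + 1)).measurableSet_config
      (fun ω => triple ω a) fun d => (triple_dependsOn a d).measurableSet_config]
    have hset : ∀ t, survive a s (n + 1) ∩ {ω | triple ω a = t} =
        {ω | triple ω a = t} ∩ survive (a + 1) (next t.1 ![t.2.1, t.2.2] s) n := by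
      intro t
      rw [Set.inter_comm]
      ext ω
      refine and_congr_right fun h => ?_
      have h' : triple ω (a + (0 : ℕ)) = t := by simpa using h
      have h1 : reach ω a s 1 = next t.1 ![t.2.1, t.2.2] s := reach_succ_triple ω a s 0 t h'
      simp only [survive, Set.mem_ofPred_eq, add_comm n 1, reach_add, h1, Nat.cast_one]
    have hterm : ∀ t, (bondLaw p).real (survive a s (n + 1) ∩ {ω | triple ω a = t}) =
        wt p t.1 * wt p t.2.1 * wt p t.2.2 *
          pick (survPair p n) (next t.1 ![t.2.1, t.2.2] s) := by
      intro t
      rw [hset, bondLaw_real_inter p (triple_dependsOn a t) (survive_dependsOn _ _ _)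
        (triple_dependsOn a t).measurableSet_config (survive_dependsOn _ _ _).measurableSet_config
        (span_disjoint (by omega)), bondLaw_real_triple, ih]
    rw [Finset.sum_congr rfl fun t _ => hterm t, sum_triple]
    cases h0 : s 0 <;> cases h1 : s 1 <;> simp [next, pick, wt, survPair, h0, h1] <;> ring

/-- The dual last-step analysis. The empty state is excluded by `hs`, since `pick` assigns it the
value 0 whatever its probability. -/
lemma bondLaw_real_reach (p : unitInterval) (a : ℤ) (n : ℕ) (s : Fin 2 → Bool)
    (hs : ∃ j, s j = true) :
    (bondLaw p).real {ω | reach ω a full n = s} = pick (lawPair p n) s := by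
  induction n generalizing s with
  | zero =>
    by_cases h : full = s
    · subst h
      have : {ω | reach ω a full 0 = full} = Set.univ := by ext; simp [reach]
      simp [this, pick, lawPair]
    · have : {ω | reach ω a full 0 = s} = ∅ := by ext; simpa [reach] using h
      have h2 : ¬ (s 0 = true ∧ s 1 = true) := by
        rintro ⟨h0, h1⟩
        apply h
        funext j
        fin_cases j <;> simp [h0, h1]
      rw [this]
      simp only [measureReal_empty, pick, lawPair]
      cases h0 : s 0 <;> cases h1 : s 1 <;> simp_all
  | succ n ih =>
    rw [measureReal_eq_sum_inter (bondLaw p) (reach_dependsOn a full s (n + 1)).measurableSet_config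
      (fun ω => triple ω (a + n)) fun d => (triple_dependsOn _ d).measurableSet_config]
    have hm := fun t => (triple_dependsOn (a + n) t).measurableSet_config
    have hterm : ∀ t, (bondLaw p).real ({ω | reach ω a full (n + 1) = s} ∩
        {ω | triple ω (a + n) = t}) = ∑ s', wt p t.1 * wt p t.2.1 * wt p t.2.2 *
          (if next t.1 ![t.2.1, t.2.2] s' = s then pick (lawPair p n) s' else 0) := by
      intro t
      rw [measureReal_eq_sum_inter (bondLaw p)
        ((reach_dependsOn a full s (n + 1)).measurableSet_config.inter (hm t))
        (fun ω => reach ω a full n) fun d => (reach_dependsOn _ _ d n).measurableSet_config]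
      refine Finset.sum_congr rfl fun s' _ => ?_
      by_cases hn : next t.1 ![t.2.1, t.2.2] s' = s
      · have hset : ({ω | reach ω a full (n + 1) = s} ∩ {ω | triple ω (a + n) = t}) ∩
            {ω | reach ω a full n = s'} =
            {ω | reach ω a full n = s'} ∩ {ω | triple ω (a + n) = t} := by
          ext ω
          constructor
          · rintro ⟨⟨_, h1⟩, h2⟩
            exact ⟨h2, h1⟩
          · rintro ⟨h2, h1⟩
            refine ⟨⟨?_, h1⟩, h2⟩
            rw [Set.mem_ofPred_eq, reach_succ_triple ω a full n t h1, h2, hn]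
        have hs' : ∃ j, s' j = true := by
          by_contra hcon
          push Not at hcon
          obtain ⟨j, hj⟩ := hs
          rw [← hn] at hj
          simp [next, hcon] at hj
        rw [hset, bondLaw_real_inter p (reach_dependsOn a full s' n) (triple_dependsOn _ t)
          (reach_dependsOn a full s' n).measurableSet_config (hm t) (span_disjoint (by omega)),
          bondLaw_real_triple, ih s' hs', if_pos hn]
        ring
      · have hset : ({ω | reach ω a full (n + 1) = s} ∩ {ω | triple ω (a + n) = t}) ∩
            {ω | reach ω a full n = s'} = ∅ := by
          ext ω
          simp only [Set.mem_inter_iff, Set.mem_ofPred_eq, Set.mem_empty_iff_false, iff_false]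
          rintro ⟨⟨h0, h1⟩, h2⟩
          rw [reach_succ_triple ω a full n t h1, h2] at h0
          exact hn h0
        rw [hset, if_neg hn]
        simp
    rw [Finset.sum_congr rfl fun t _ => hterm t]
    simp only [sum_triple, sum_state, funext_iff, Fin.forall_fin_two]
    obtain ⟨j, hj⟩ := hs
    cases h0 : s 0 <;> cases h1 : s 1
    · rcases fin_two_cases j with rfl | rfl <;> simp_all
    all_goals
      simp [next, pick, wt, lawPair, h0, h1]
      ring

/-! ### The growth rate of the crossing probabilities -/

/-- The larger eigenvalue of the transfer matrix. -/
def rho (p : ℝ) : ℝ :=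
  p * (1 + 2 * p - 2 * p ^ 2 + Real.sqrt (1 + 4 * p ^ 2 - 8 * p ^ 3 + 4 * p ^ 4)) / 2

/-- The smaller eigenvalue of the transfer matrix. -/
def rho₂ (p : ℝ) : ℝ :=
  p * (1 + 2 * p - 2 * p ^ 2 - Real.sqrt (1 + 4 * p ^ 2 - 8 * p ^ 3 + 4 * p ^ 4)) / 2

lemma rho_add (p : ℝ) : rho p + rho₂ p = p * (1 + 2 * p - 2 * p ^ 2) := by
  unfold rho rho₂; ring

lemma disc_eq (p : ℝ) : 1 + 4 * p ^ 2 - 8 * p ^ 3 + 4 * p ^ 4 = 1 + 4 * (p * (1 - p)) ^ 2 := by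
  ring

lemma rho_mul (p : ℝ) : rho p * rho₂ p = p ^ 3 * (1 - p) := by
  have h := Real.sq_sqrt (x := 1 + 4 * p ^ 2 - 8 * p ^ 3 + 4 * p ^ 4) (by rw [disc_eq]; positivity)
  unfold rho rho₂
  linear_combination (-p ^ 2 / 4) * h

section Eigenvalues

variable {p : ℝ} (h0 : 0 < p) (h1 : p < 1)

include h0 in
lemma rho₂_lt_rho : rho₂ p < rho p := by
  have h : 0 < Real.sqrt (1 + 4 * p ^ 2 - 8 * p ^ 3 + 4 * p ^ 4) :=
    Real.sqrt_pos.2 (by rw [disc_eq]; positivity)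
  unfold rho rho₂
  nlinarith [mul_pos h0 h]

include h0 h1

/-- The characteristic polynomial of the transfer matrix takes the value -2p⁴(1 - p) < 0 at p². The
strict bounds make the leading coefficients of the crossing probabilities positive. -/
lemma sq_between : rho₂ p < p ^ 2 ∧ p ^ 2 < rho p := by
  have hlt := rho₂_lt_rho h0
  have hprod : (p ^ 2 - rho p) * (p ^ 2 - rho₂ p) < 0 := by
    have : (p ^ 2 - rho p) * (p ^ 2 - rho₂ p) = -(2 * p ^ 4 * (1 - p)) := by
      linear_combination (-p ^ 2) * rho_add p + rho_mul p
    rw [this]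
    have : 0 < 2 * p ^ 4 * (1 - p) := by have := sub_pos.2 h1; positivity
    linarith
  constructor
  · by_contra hcon
    have h2 : p ^ 2 - rho₂ p ≤ 0 := by linarith
    have h3 : p ^ 2 - rho p ≤ 0 := by linarith
    nlinarith [mul_nonneg_of_nonpos_of_nonpos h3 h2]
  · by_contra hcon
    have h2 : 0 ≤ p ^ 2 - rho p := by linarith
    have h3 : 0 ≤ p ^ 2 - rho₂ p := by linarith
    nlinarith [mul_nonneg h2 h3]

lemma rho_pos : 0 < rho p := lt_trans (by positivity) (sq_between h0 h1).2

lemma rho₂_pos : 0 < rho₂ p := by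
  have h := rho_mul p
  have h2 : 0 < p ^ 3 * (1 - p) := by have := sub_pos.2 h1; positivity
  rw [← h] at h2
  exact pos_of_mul_pos_right h2 (rho_pos h0 h1).le

lemma exp_criticalBias : Real.exp (2 * criticalBias p) = p / rho₂ p := by
  have h2 := rho₂_pos h0 h1
  have e : 2 / (1 + 2 * p - 2 * p ^ 2 - Real.sqrt (1 + 4 * p ^ 2 - 8 * p ^ 3 + 4 * p ^ 4)) =
      p / rho₂ p := by
    unfold rho₂ at h2 ⊢
    have h3 : 0 < 1 + 2 * p - 2 * p ^ 2 - Real.sqrt (1 + 4 * p ^ 2 - 8 * p ^ 3 + 4 * p ^ 4) := by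
      by_contra hcon
      nlinarith
    field_simp
  unfold criticalBias
  rw [e, ← mul_assoc]
  norm_num
  rw [Real.exp_log (by positivity)]

lemma criticalBias_pos : 0 < criticalBias p := by
  have h := exp_criticalBias h0 h1
  have h2 := rho₂_pos h0 h1
  have h3 : 1 < p / rho₂ p := by
    rw [one_lt_div h2]
    have := (sq_between h0 h1).1
    nlinarith
  rw [← h, Real.one_lt_exp_iff] at h3
  linarith

/-- The origin of the critical bias: the left side is the probability of a plain column and `rho` is
the price of crossing a column, so conditionally on a crossing each further column of a dead end
costs exp(-2λ_c). -/
lemma rho_eq : p ^ 2 * (1 - p) = rho p * Real.exp (-(2 * criticalBias p)) := by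
  have h2 := rho₂_pos h0 h1
  rw [Real.exp_neg, exp_criticalBias h0 h1, inv_div, mul_div_assoc', rho_mul]
  field_simp

end Eigenvalues

lemma recurrence_closed_form {u : ℕ → ℝ} {x y : ℝ} (hxy : x ≠ y)
    (hu : ∀ n, u (n + 2) = (x + y) * u (n + 1) - x * y * u n) (n : ℕ) :
    u n = (u 1 - y * u 0) / (x - y) * x ^ n + (x * u 0 - u 1) / (x - y) * y ^ n := by
  have hne : x - y ≠ 0 := sub_ne_zero.2 hxy
  induction n using Nat.twoStepInduction with
  | zero => field_simp; ring
  | one => field_simp; ring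
  | more n ih1 ih2 => rw [hu, ih2, ih1]; field_simp; ring

lemma recurrence_tendsto {u : ℕ → ℝ} {x y : ℝ} (hy : 0 < y) (hxy : y < x)
    (hu : ∀ n, u (n + 2) = (x + y) * u (n + 1) - x * y * u n) :
    Tendsto (fun n => u n / x ^ n) atTop (𝓝 ((u 1 - y * u 0) / (x - y))) := by
  have hx : 0 < x := hy.trans hxy
  have h : (fun n => u n / x ^ n) = fun n =>
      (u 1 - y * u 0) / (x - y) + (x * u 0 - u 1) / (x - y) * (y / x) ^ n := by
    funext n
    rw [recurrence_closed_form hxy.ne' hu n, div_pow]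
    have : x ^ n ≠ 0 := (pow_pos hx n).ne'
    field_simp
  rw [h]
  have := (tendsto_pow_atTop_nhds_zero_of_lt_one (div_nonneg hy.le hx.le)
    ((div_lt_one hx).2 hxy)).const_mul ((x * u 0 - u 1) / (x - y))
  simpa using tendsto_const_nhds.add this

/-- Cayley–Hamilton for the transfer matrix: its trace and determinant are the sum and the product
of the eigenvalues. -/
lemma lawPair_recurrence (p : ℝ) (n : ℕ) :
    (lawPair p (n + 2)).1 = (rho p + rho₂ p) * (lawPair p (n + 1)).1 -
      rho p * rho₂ p * (lawPair p n).1 ∧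
    (lawPair p (n + 2)).2 = (rho p + rho₂ p) * (lawPair p (n + 1)).2 -
      rho p * rho₂ p * (lawPair p n).2 := by
  rw [rho_add, rho_mul]
  simp only [lawPair]
  constructor <;> ring

lemma survPair_recurrence (p : ℝ) (n : ℕ) :
    (survPair p (n + 2)).1 = (rho p + rho₂ p) * (survPair p (n + 1)).1 -
      rho p * rho₂ p * (survPair p n).1 ∧
    (survPair p (n + 2)).2 = (rho p + rho₂ p) * (survPair p (n + 1)).2 -
      rho p * rho₂ p * (survPair p n).2 := by
  rw [rho_add, rho_mul]
  simp only [survPair]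
  constructor <;> ring

lemma tendsto_pick {x : ℕ → ℝ × ℝ} {r a b : ℝ} (h1 : Tendsto (fun n => (x n).1 / r ^ n) atTop (𝓝 a))
    (h2 : Tendsto (fun n => (x n).2 / r ^ n) atTop (𝓝 b)) (s : Fin 2 → Bool) :
    Tendsto (fun n => pick (x n) s / r ^ n) atTop (𝓝 (pick (a, b) s)) := by
  cases hs0 : s 0 <;> cases hs1 : s 1 <;> simp [pick, hs0, hs1, h1, h2]

lemma exists_lawLim {p : ℝ} (h0 : 0 < p) (h1 : p < 1) : ∃ l : ℝ × ℝ, 0 < l.1 ∧ 0 < l.2 ∧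
    ∀ s, Tendsto (fun n => pick (lawPair p n) s / rho p ^ n) atTop (𝓝 (pick l s)) := by
  have hb := sq_between h0 h1
  have hr := rho₂_pos h0 h1
  have hlt := rho₂_lt_rho h0
  refine ⟨(_, _), ?_, ?_, tendsto_pick
    (recurrence_tendsto (u := fun n => (lawPair p n).1) hr hlt fun n => (lawPair_recurrence p n).1)
    (recurrence_tendsto (u := fun n => (lawPair p n).2) hr hlt fun n => (lawPair_recurrence p n).2)⟩
  · refine div_pos ?_ (by linarith)
    simp [lawPair]
    linarith
  · refine div_pos ?_ (by linarith)
    simp [lawPair]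
    exact mul_pos h0 (by linarith)

lemma exists_survLim {p : ℝ} (h0 : 0 < p) (h1 : p < 1) : ∃ l : ℝ × ℝ, 0 < l.1 ∧ 0 < l.2 ∧
    ∀ s, Tendsto (fun n => pick (survPair p n) s / rho p ^ n) atTop (𝓝 (pick l s)) := by
  have hb := sq_between h0 h1
  have hr := rho₂_pos h0 h1
  have hlt := rho₂_lt_rho h0
  refine ⟨(_, _), ?_, ?_, tendsto_pick
    (recurrence_tendsto (u := fun n => (survPair p n).1) hr hlt fun n => (survPair_recurrence p n).1)
    (recurrence_tendsto (u := fun n => (survPair p n).2) hr hlt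
      fun n => (survPair_recurrence p n).2)⟩
  · refine div_pos ?_ (by linarith)
    simp only [survPair]
    nlinarith
  · refine div_pos ?_ (by linarith)
    simp only [survPair]
    nlinarith [mul_pos h0 (sub_pos.2 h1), mul_pos (mul_pos h0 h0) (sub_pos.2 h1)]

lemma bondLaw_real_cross (p : unitInterval) (a : ℤ) (n : ℕ) :
    (bondLaw p).real (cross a n) = (survPair p n).1 := by
  have := bondLaw_real_survive p a full n
  simpa [pick, survive, cross] using this

lemma survPair_pos {p : ℝ} (h0 : 0 < p) (h1 : p < 1) (n : ℕ) :
    0 < (survPair p n).1 ∧ 0 < (survPair p n).2 := by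
  induction n with
  | zero => simp [survPair]
  | succ n ih =>
    obtain ⟨ha, hb⟩ := ih
    have := sub_pos.2 h1
    simp only [survPair]
    constructor <;> positivity

/-- The crossing probability of `n` columns is of the order `rho ^ n`. -/
lemma exists_survPair_bounds {p : ℝ} (h0 : 0 < p) (h1 : p < 1) : ∃ c C : ℝ, 0 < c ∧ 0 < C ∧
    ∀ n, c * rho p ^ n ≤ (survPair p n).1 ∧ (survPair p n).1 ≤ C * rho p ^ n := by
  obtain ⟨l, hl, _, h⟩ := exists_survLim h0 h1
  have h : Tendsto (fun n => (survPair p n).1 / rho p ^ n) atTop (𝓝 l.1) := by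
    simpa [pick] using h full
  have hr := rho_pos h0 h1
  obtain ⟨C, hC⟩ := h.bddAbove_range
  have h' := h.inv₀ hl.ne'
  obtain ⟨c, hc⟩ := h'.bddAbove_range
  have hpos := fun n => (survPair_pos h0 h1 n).1
  have hC0 : 0 < C := lt_of_lt_of_le (div_pos (hpos 0) (pow_pos hr 0)) (hC ⟨0, rfl⟩)
  have hc0 : 0 < c := lt_of_lt_of_le (inv_pos.2 (div_pos (hpos 0) (pow_pos hr 0))) (hc ⟨0, rfl⟩)
  refine ⟨c⁻¹, C, inv_pos.2 hc0, hC0, fun n => ⟨?_, ?_⟩⟩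
  · have := hc ⟨n, rfl⟩
    simp only [inv_div] at this
    rw [div_le_iff₀ (hpos n)] at this
    rw [inv_mul_le_iff₀ hc0]
    exact this
  · exact (div_le_iff₀ (pow_pos hr n)).1 (hC ⟨n, rfl⟩)

/-! ### The weak limit of the conditioned laws -/

/-- Split at the columns -m and m according to the states there. Left, middle and right blocks are
independent, and only the outer factors depend on the lengths k and l, so the limit can be taken in
finitely many terms. -/
lemma bondLaw_real_inter_cross (p : unitInterval) {m k l : ℕ} {A : Set Config}
    (hA : SetDependsOn A (span (-2 * (m : ℤ)) (2 * m))) :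
    (bondLaw p).real (A ∩ cross (-((m + k : ℕ) : ℤ)) (k + 2 * m + l)) =
      ∑ s, ∑ s', pick (lawPair p k) s *
        (bondLaw p).real (A ∩ {ω | reach ω (-(m : ℤ)) s (2 * m) = s'}) *
        pick (survPair p l) s' := by
  have hAm := hA.measurableSet_config
  have ek : -((m + k : ℕ) : ℤ) + k = -(m : ℤ) := by push_cast; ring
  have em : -(m : ℤ) + (2 * m : ℕ) = m := by push_cast; ring
  rw [measureReal_eq_sum_inter (bondLaw p) (hAm.inter (cross_dependsOn _ _).measurableSet_config)
    (fun ω => reach ω (-((m + k : ℕ) : ℤ)) full k) fun d =>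
      (reach_dependsOn _ _ d k).measurableSet_config]
  refine Finset.sum_congr rfl fun s _ => ?_
  have hcr : ∀ ω, reach ω (-((m + k : ℕ) : ℤ)) full k = s →
      reach ω (-((m + k : ℕ) : ℤ)) full (k + 2 * m + l) =
        reach ω m (reach ω (-(m : ℤ)) s (2 * m)) l := by
    intro ω hω
    have em' : -((m + k : ℕ) : ℤ) + ((k + 2 * m : ℕ) : ℤ) = m := by push_cast; ring
    rw [reach_add, reach_add, em', hω, ek]
  have hAr : ∀ s', SetDependsOn (A ∩ {ω | reach ω (-(m : ℤ)) s (2 * m) = s'})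
      (span (-2 * (m : ℤ)) (2 * m)) := fun s' =>
    (hA.inter (reach_dependsOn (-(m : ℤ)) s s' (2 * m))).mono (by
      rw [em]
      exact Set.union_subset le_rfl (span_mono (by omega) le_rfl))
  rw [measureReal_eq_sum_inter (bondLaw p) ((hAm.inter
    (cross_dependsOn _ _).measurableSet_config).inter (reach_dependsOn _ _ s k).measurableSet_config)
    (fun ω => reach ω (-(m : ℤ)) s (2 * m)) fun d => (reach_dependsOn _ _ d _).measurableSet_config]
  refine Finset.sum_congr rfl fun s' _ => ?_
  have hset : (A ∩ cross (-((m + k : ℕ) : ℤ)) (k + 2 * m + l) ∩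
      {ω | reach ω (-((m + k : ℕ) : ℤ)) full k = s}) ∩ {ω | reach ω (-(m : ℤ)) s (2 * m) = s'} =
      ({ω | reach ω (-((m + k : ℕ) : ℤ)) full k = s} ∩
        (A ∩ {ω | reach ω (-(m : ℤ)) s (2 * m) = s'})) ∩ survive m s' l := by
    ext ω
    constructor
    · rintro ⟨⟨⟨h1, h2⟩, h3⟩, h4⟩
      refine ⟨⟨h3, h1, h4⟩, ?_⟩
      rw [cross, Set.mem_ofPred_eq, hcr ω h3, h4] at h2
      exact h2
    · rintro ⟨⟨h3, h1, h4⟩, h2⟩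
      refine ⟨⟨⟨h1, ?_⟩, h3⟩, h4⟩
      rw [cross, Set.mem_ofPred_eq, hcr ω h3, h4]
      exact h2
  rw [hset, bondLaw_real_inter p (((reach_dependsOn _ _ s k).inter (hAr s')).mono
      (T := span (2 * -((m + k : ℕ) : ℤ)) (2 * m)) (Set.union_subset
        (span_mono le_rfl (by omega)) (span_mono (by push_cast; omega) le_rfl)))
    (survive_dependsOn _ _ _) ((reach_dependsOn _ _ s k).measurableSet_config.inter
      (hAr s').measurableSet_config) (survive_dependsOn _ _ _).measurableSet_config
      (span_disjoint le_rfl), bondLaw_real_survive]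
  by_cases hs : ∃ j, s j = true
  · rw [bondLaw_real_inter p (reach_dependsOn _ _ s k) (hAr s')
      (reach_dependsOn _ _ s k).measurableSet_config (hAr s').measurableSet_config
      (span_disjoint (by omega)), bondLaw_real_reach p _ _ s hs]
  -- With an empty left state the right side is 0 through `pick`. The left side is 0 too: either the
  -- middle event is impossible, or s' is empty and cannot survive.
  · have hs0 : ∀ j, s j = false := fun j => by
      by_contra hj
      exact hs ⟨j, by simpa using hj⟩
    have hpick : pick (lawPair p k) s = 0 := by simp [pick, hs0]
    rw [hpick, zero_mul, zero_mul]
    by_cases hs' : ∃ j, s' j = true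
    · have hempty : {ω : Config | reach ω (-(m : ℤ)) s (2 * m) = s'} = ∅ := by
        ext ω
        simp only [Set.mem_ofPred_eq, Set.mem_empty_iff_false, iff_false]
        rintro rfl
        obtain ⟨j, hj⟩ := hs'
        rw [reach_zero_of_ne hs0] at hj
        exact Bool.false_ne_true hj
      simp [hempty]
    · have hs0' : ∀ j, s' j = false := fun j => by
        by_contra hj
        exact hs' ⟨j, by simpa using hj⟩
      simp [pick, hs0']

lemma crossing_eq_cross_add (m k l : ℕ) :
    crossing (m + k) (m + l) = cross (-((m + k : ℕ) : ℤ)) (k + 2 * m + l) := by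
  rw [crossing_eq_cross]
  congr 1
  ring

lemma measurableSet_crossing (N₁ N₂ : ℕ) : MeasurableSet (crossing N₁ N₂) := by
  rw [crossing_eq_cross]
  exact (cross_dependsOn _ _).measurableSet_config

lemma crossingLaw_real (p : unitInterval) (N₁ N₂ : ℕ) (A : Set Config) :
    (crossingLaw p N₁ N₂).real A =
      (bondLaw p).real (A ∩ crossing N₁ N₂) / (bondLaw p).real (crossing N₁ N₂) := by
  rw [crossingLaw, measureReal_def, cond_apply (measurableSet_crossing _ _), ENNReal.toReal_mul,
    ENNReal.toReal_inv, Set.inter_comm, div_eq_inv_mul]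
  rfl

lemma isClopen_of_dependsOn {S : Set ladder.edgeSet} (hS : S.Finite) {A : Set Config}
    (hA : SetDependsOn A S) : IsClopen A := by
  have hopen : ∀ B : Set Config, SetDependsOn B S → IsOpen B := by
    intro B hB
    rw [isOpen_iff_forall_mem_open]
    intro ω hω
    refine ⟨S.pi fun e => {ω e}, fun ω' h => (hB ω ω' fun e he => (h e he).symm).1 hω,
      isOpen_set_pi hS fun e _ => isOpen_discrete _, fun e _ => rfl⟩
  exact ⟨⟨hopen _ hA.compl⟩, hopen _ hA⟩

section Limit

variable {p : unitInterval} (h0 : 0 < p) (h1 : p < 1)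

include h0 h1

lemma bondLaw_real_crossing_pos (N₁ N₂ : ℕ) : 0 < (bondLaw p).real (crossing N₁ N₂) := by
  rw [crossing_eq_cross, bondLaw_real_cross]
  exact (survPair_pos (Subtype.coe_lt_coe.2 h0) (Subtype.coe_lt_coe.2 h1) _).1

lemma isProbabilityMeasure_crossingLaw (N₁ N₂ : ℕ) :
    IsProbabilityMeasure (crossingLaw p N₁ N₂) := by
  refine cond_isProbabilityMeasure fun h => ?_
  have := bondLaw_real_crossing_pos h0 h1 N₁ N₂
  rw [measureReal_def, h] at this
  simp at this

/-- Numerator and denominator of the conditional probability are both divided by the power of `rho`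
belonging to the two outer blocks; each then converges, the denominator to a positive number. -/
lemma exists_tendsto_crossingLaw {S : Set ladder.edgeSet} (hS : S.Finite) {A : Set Config}
    (hA : SetDependsOn A S) :
    ∃ l, Tendsto (fun N : ℕ × ℕ => (crossingLaw p N.1 N.2).real A) atTop (𝓝 l) := by
  obtain ⟨m, hm⟩ := exists_subset_span hS
  have hp0 : (0 : ℝ) < p := h0
  have hp1 : (p : ℝ) < 1 := h1
  obtain ⟨a, ha1, ha2, ha⟩ := exists_lawLim hp0 hp1
  obtain ⟨b, hb1, hb2, hb⟩ := exists_survLim hp0 hp1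
  have hr := rho_pos hp0 hp1
  -- numerators and denominators converge after rescaling
  have hnum : ∀ B : Set Config, SetDependsOn B (span (-2 * (m : ℤ)) (2 * m)) →
      Tendsto (fun N : ℕ × ℕ => (bondLaw p).real (B ∩ crossing (m + N.1) (m + N.2)) /
        (rho p ^ N.1 * rho p ^ N.2)) atTop (𝓝 (∑ s, ∑ s', pick a s *
        (bondLaw p).real (B ∩ {ω | reach ω (-(m : ℤ)) s (2 * m) = s'}) * pick b s')) := by
    intro B hB
    have e : ∀ N : ℕ × ℕ, (bondLaw p).real (B ∩ crossing (m + N.1) (m + N.2)) /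
        (rho p ^ N.1 * rho p ^ N.2) = ∑ s, ∑ s', (pick (lawPair p N.1) s / rho p ^ N.1) *
        (bondLaw p).real (B ∩ {ω | reach ω (-(m : ℤ)) s (2 * m) = s'}) *
        (pick (survPair p N.2) s' / rho p ^ N.2) := by
      intro N
      rw [crossing_eq_cross_add, bondLaw_real_inter_cross p hB, Finset.sum_div]
      refine Finset.sum_congr rfl fun s _ => ?_
      rw [Finset.sum_div]
      refine Finset.sum_congr rfl fun s' _ => ?_
      have h1 := (pow_pos hr N.1).ne'
      have h2 := (pow_pos hr N.2).ne'
      field_simp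
    simp_rw [e]
    rw [← prod_atTop_atTop_eq]
    refine tendsto_finsetSum _ fun s _ => tendsto_finsetSum _ fun s' _ => ?_
    exact (((ha s).comp tendsto_fst).mul_const _).mul ((hb s').comp tendsto_snd)
  have hden := hnum Set.univ fun _ _ _ => Iff.rfl
  -- All terms are nonnegative, and the term from `full` to `full` is already positive.
  have hdpos : 0 < ∑ s, ∑ s', pick a s *
      (bondLaw p).real (Set.univ ∩ {ω | reach ω (-(m : ℤ)) s (2 * m) = s'}) * pick b s' := by
    have hnn : ∀ x : ℝ × ℝ, 0 < x.1 → 0 < x.2 → ∀ s, 0 ≤ pick x s := by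
      intro x hx1 hx2 s
      unfold pick
      split_ifs <;> linarith
    have hpa := hnn a ha1 ha2
    have hpb := hnn b hb1 hb2
    have hle : pick a full *
        (bondLaw p).real (Set.univ ∩ {ω | reach ω (-(m : ℤ)) full (2 * m) = full}) *
          pick b full ≤ ∑ s, ∑ s', pick a s *
      (bondLaw p).real (Set.univ ∩ {ω | reach ω (-(m : ℤ)) s (2 * m) = s'}) * pick b s' := by
      refine (Finset.single_le_sum (f := fun s' => pick a full * (bondLaw p).real
        (Set.univ ∩ {ω | reach ω (-(m : ℤ)) full (2 * m) = s'}) * pick b s')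
        (fun s' _ => ?_) (Finset.mem_univ full)).trans
        (Finset.single_le_sum (f := fun s => ∑ s', pick a s *
      (bondLaw p).real (Set.univ ∩ {ω | reach ω (-(m : ℤ)) s (2 * m) = s'}) * pick b s')
        (fun s _ => Finset.sum_nonneg fun s' _ => ?_) (Finset.mem_univ full))
      · exact mul_nonneg (mul_nonneg (hpa _) measureReal_nonneg) (hpb _)
      · exact mul_nonneg (mul_nonneg (hpa _) measureReal_nonneg) (hpb _)
    refine lt_of_lt_of_le ?_ hle
    rw [Set.univ_inter, bondLaw_real_reach p _ _ full ⟨0, rfl⟩]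
    have hlaw : ∀ n, 0 < (lawPair p n).1 ∧ 0 ≤ (lawPair p n).2 := by
      intro n
      induction n with
      | zero => simp [lawPair]
      | succ n ih =>
        obtain ⟨i1, i2⟩ := ih
        have := sub_pos.2 hp1
        simp only [lawPair]
        constructor <;> positivity
    have := (hlaw (2 * m)).1
    simp only [pick]
    simp only [Bool.and_self, if_true]
    positivity
  have hA' := hnum A (hA.mono hm)
  have hlim := hA'.div hden hdpos.ne'
  have hshift : Tendsto (fun N : ℕ × ℕ => (N.1 - m, N.2 - m)) atTop atTop := by
    rw [← prod_atTop_atTop_eq]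
    exact (tendsto_sub_atTop_nat m).prodMap (tendsto_sub_atTop_nat m)
  refine ⟨_, (hlim.comp hshift).congr' ?_⟩
  filter_upwards [eventually_ge_atTop (m, m)] with N hN
  obtain ⟨hN1, hN2⟩ := hN
  simp only [Function.comp, Pi.div_apply]
  rw [crossingLaw_real, Nat.add_sub_cancel' hN1, Nat.add_sub_cancel' hN2, Set.univ_inter,
    div_div_div_cancel_right₀]
  positivity

/-- Existence of the weak limit of the conditioned laws, with the convergence of the
probabilities of local events. -/
theorem exists_conditionedLaw : ∃ P : Measure Config, IsProbabilityMeasure P ∧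
    IsConditionedLaw p P ∧ ∀ (A : Set Config) (S : Set ladder.edgeSet), S.Finite →
      SetDependsOn A S →
      Tendsto (fun N : ℕ × ℕ => (crossingLaw p N.1 N.2).real A) atTop (𝓝 (P.real A)) := by
  let F : ℕ × ℕ → ProbabilityMeasure Config := fun N =>
    ⟨crossingLaw p N.1 N.2, isProbabilityMeasure_crossingLaw h0 h1 N.1 N.2⟩
  have hclopen : ∀ (g : Ultrafilter (ℕ × ℕ)) (Q : ProbabilityMeasure Config),
      Tendsto F g (𝓝 Q) → ∀ (A : Set Config) (S : Set ladder.edgeSet), S.Finite →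
      SetDependsOn A S → Tendsto (fun N : ℕ × ℕ => (crossingLaw p N.1 N.2).real A) g
        (𝓝 ((Q : Measure Config).real A)) := by
    intro g Q hQ A S hS hA
    have := ProbabilityMeasure.tendsto_measure_of_isClopen_of_tendsto hQ
      (isClopen_of_dependsOn hS hA)
    exact (NNReal.tendsto_coe.2 this)
  -- The configuration space is compact, hence so is its space of probability measures, and every
  -- ultrafilter converges.
  have hex : ∀ g : Ultrafilter (ℕ × ℕ), ∃ Q, Tendsto F g (𝓝 Q) := fun g =>
    ⟨_, (g.map F).le_nhds_lim⟩
  -- Cylinders are clopen, so their probabilities pass to weak limits. By the convergence on local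
  -- events all subsequential limits agree on this π-system.
  have huniq : ∀ (g g' : Ultrafilter (ℕ × ℕ)) (Q Q' : ProbabilityMeasure Config),
      (g : Filter (ℕ × ℕ)) ≤ atTop → (g' : Filter (ℕ × ℕ)) ≤ atTop → Tendsto F g (𝓝 Q) →
      Tendsto F g' (𝓝 Q') → Q = Q' := by
    intro g g' Q Q' hg hg' hQ hQ'
    have : IsProbabilityMeasure Q.1 := Q.2
    have : IsProbabilityMeasure Q'.1 := Q'.2
    refine Subtype.ext (ext_of_generate_finite (measurableCylinders fun _ : ladder.edgeSet => Bool)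
      generateFrom_measurableCylinders.symm isPiSystem_measurableCylinders ?_ (by simp))
    intro A hA
    obtain ⟨S, T, hT, rfl⟩ := (mem_measurableCylinders _).1 hA
    have hdep : SetDependsOn (cylinder (α := fun _ : ladder.edgeSet => Bool) S T)
        (S : Set ladder.edgeSet) := by
      intro ω ω' h
      have : S.restrict ω = S.restrict ω' := funext fun e => h e e.2
      simp only [mem_cylinder, this]
    obtain ⟨l, hl⟩ := exists_tendsto_crossingLaw h0 h1 S.finite_toSet hdep
    have e1 := tendsto_nhds_unique (hclopen g Q hQ _ _ S.finite_toSet hdep) (hl.mono_left hg)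
    have e2 := tendsto_nhds_unique (hclopen g' Q' hQ' _ _ S.finite_toSet hdep) (hl.mono_left hg')
    have := e1.trans e2.symm
    exact (measureReal_eq_measureReal_iff).1 this
  obtain ⟨Q, hQ⟩ := hex (Ultrafilter.of atTop)
  have htend : Tendsto F atTop (𝓝 Q) := by
    rw [tendsto_iff_ultrafilter]
    intro g hg
    obtain ⟨Q', hQ'⟩ := hex g
    rwa [huniq _ _ _ _ hg (Ultrafilter.of_le _) hQ' hQ] at hQ'
  refine ⟨Q, inferInstance, ?_, ?_⟩
  · intro f
    exact ProbabilityMeasure.tendsto_iff_forall_integral_tendsto.1 htend f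
  · intro A S hS hA
    have := ProbabilityMeasure.tendsto_measure_of_isClopen_of_tendsto htend
      (isClopen_of_dependsOn hS hA)
    exact NNReal.tendsto_coe.2 this

end Limit

/-! ### Gluing crossings -/

lemma bondLaw_real_glue (p : unitInterval) (i : ℤ) : (bondLaw p).real (glue i) = (p : ℝ) ^ 3 := by
  have hm : ∀ (e : ladder.edgeSet) b, MeasurableSet {ω : Config | ω e = b} := fun e b =>
    (edge_dependsOn e b).measurableSet_of_finite (Set.finite_singleton e)
  have hset : glue i = ({ω : Config | ω (rEdge i) = true} ∩ {ω | ω (hEdge (i + 1) 0) = true}) ∩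
      {ω | ω (rEdge (i + 1)) = true} := by
    ext ω
    simp [glue, and_assoc]
  have h1 : hEdge (i + 1) 0 ∉ ({rEdge i} : Set ladder.edgeSet) := fun h => by
    have := congrArg pos (Set.mem_singleton_iff.1 h)
    simp at this
    omega
  have h2 : rEdge (i + 1) ∉ ({rEdge i} ∪ {hEdge (i + 1) 0} : Set ladder.edgeSet) := by
    rintro (h | h)
    · have := congrArg pos (Set.mem_singleton_iff.1 h)
      simp at this
    · have := congrArg pos (Set.mem_singleton_iff.1 h)
      simp at this
      omega
  rw [hset, bondLaw_real_inter_edge p ((edge_dependsOn _ _).inter (edge_dependsOn _ _))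
    ((hm _ _).inter (hm _ _)) h2, bondLaw_real_inter_edge p (edge_dependsOn _ _) (hm _ _) h1,
    bondLaw_real_edge]
  simp [wt]
  ring

section Glue

variable (p : unitInterval) {A B : Set Config} {α β a : ℤ} {n : ℕ}

lemma cross_inter_dependsOn_left (hA : SetDependsOn A (span α (2 * (a + n)))) :
    SetDependsOn (A ∩ cross a n) (span (min α (2 * a)) (2 * (a + n))) :=
  (hA.inter (cross_dependsOn a n)).mono
    (Set.union_subset (span_mono (min_le_left _ _) le_rfl) (span_mono (by omega) le_rfl))

lemma cross_inter_dependsOn_right (k : ℕ) (hB : SetDependsOn B (span (2 * (a + n) + 3) β)) :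
    SetDependsOn (B ∩ cross (a + n + 1) k)
      (span (2 * (a + n) + 3) (max β (2 * (a + n + 1 + k)))) :=
  (hB.inter (cross_dependsOn (a + n + 1) k)).mono
    (Set.union_subset (span_mono le_rfl (le_max_left _ _))
      (span_mono (by omega) (le_max_right _ _)))

/-- Forgetting the edges between the two blocks only enlarges the event, and the blocks are then
independent. -/
lemma bondLaw_real_cross_le (k : ℕ) (hA : SetDependsOn A (span α (2 * (a + n))))
    (hB : SetDependsOn B (span (2 * (a + n) + 3) β)) :
    (bondLaw p).real (A ∩ B ∩ cross a (n + 1 + k)) ≤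
      (bondLaw p).real (A ∩ cross a n) * (bondLaw p).real (B ∩ cross (a + n + 1) k) := by
  rw [← bondLaw_real_inter p (cross_inter_dependsOn_left hA) (cross_inter_dependsOn_right k hB)
    (cross_inter_dependsOn_left hA).measurableSet_config
    (cross_inter_dependsOn_right k hB).measurableSet_config (span_disjoint (by omega))]
  refine measureReal_mono ?_
  rintro ω ⟨⟨h1, h2⟩, h3⟩
  have := cross_add_subset a n k h3
  exact ⟨⟨h1, this.1⟩, h2, this.2⟩

/-- The converse up to a constant: three independent open edges between the blocks, at the price p³,
join the two crossings. -/
lemma le_bondLaw_real_cross (k : ℕ) (hA : SetDependsOn A (span α (2 * (a + n))))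
    (hB : SetDependsOn B (span (2 * (a + n) + 3) β)) :
    (p : ℝ) ^ 3 * ((bondLaw p).real (A ∩ cross a n) *
      (bondLaw p).real (B ∩ cross (a + n + 1) k)) ≤
      (bondLaw p).real (A ∩ B ∩ cross a (n + 1 + k)) := by
  have hl := cross_inter_dependsOn_left hA
  have hg : SetDependsOn (A ∩ cross a n ∩ glue (a + n))
      (span (min α (2 * a)) (2 * (a + n) + 3)) :=
    (hl.inter (glue_dependsOn _)).mono (Set.union_subset (span_mono le_rfl (by omega))
      (span_mono (by omega) le_rfl))
  have e : (bondLaw p).real ((A ∩ cross a n ∩ glue (a + n)) ∩ (B ∩ cross (a + n + 1) k)) =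
      (p : ℝ) ^ 3 * ((bondLaw p).real (A ∩ cross a n) *
      (bondLaw p).real (B ∩ cross (a + n + 1) k)) := by
    rw [bondLaw_real_inter p hg (cross_inter_dependsOn_right k hB) hg.measurableSet_config
      (cross_inter_dependsOn_right k hB).measurableSet_config (span_disjoint le_rfl),
      bondLaw_real_inter p hl (glue_dependsOn _) hl.measurableSet_config
      (glue_dependsOn _).measurableSet_config (span_disjoint le_rfl), bondLaw_real_glue]
    ring
  rw [← e]
  refine measureReal_mono ?_
  rintro ω ⟨⟨⟨h1, h2⟩, h3⟩, h4, h5⟩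
  exact ⟨⟨h1, h4⟩, inter_glue_subset a n k ⟨⟨h2, h3⟩, h5⟩⟩

end Glue

/-! ### The limit law -/

/-- `P` is the limit of the conditioned laws on local events. -/
def IsLocalLimit (p : unitInterval) (P : Measure Config) : Prop :=
  ∀ (A : Set Config) (S : Set ladder.edgeSet), S.Finite → SetDependsOn A S →
    Tendsto (fun N : ℕ × ℕ => (crossingLaw p N.1 N.2).real A) atTop (𝓝 (P.real A))

lemma measurePreserving_shift_bondLaw (p : unitInterval) (k : ℤ) :
    MeasurePreserving (shiftConfig k) (bondLaw p) (bondLaw p) :=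
  ⟨measurable_shiftConfig k, Measure.map_infinitePi_infinitePi_of_inj
    (P := fun _ : ladder.edgeSet => bernoulliMeasure true false p) (f := shiftEdge k)
    fun e e' h => by
      have := congrArg (shiftEdge (-k)) h
      simpa [shiftEdge_shiftEdge, shiftEdge_zero] using this⟩

/-- A shift by one column turns the conditioning on (N₁, N₂) into that on (N₁ + 1, N₂ - 1), and the
limit is the same along both sequences. -/
lemma measurePreserving_shift_limit {p : unitInterval} {P : Measure Config}
    [IsProbabilityMeasure P] (hP : IsLocalLimit p P) : MeasurePreserving (shiftConfig 1) P P := by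
  refine ⟨measurable_shiftConfig 1, ?_⟩
  have : IsProbabilityMeasure (P.map (shiftConfig 1)) :=
    Measure.isProbabilityMeasure_map (measurable_shiftConfig 1).aemeasurable
  refine ext_of_generate_finite (measurableCylinders fun _ : ladder.edgeSet => Bool)
      generateFrom_measurableCylinders.symm isPiSystem_measurableCylinders ?_ (by simp)
  intro A hA
  obtain ⟨S, T, hT, rfl⟩ := (mem_measurableCylinders _).1 hA
  set A := cylinder (α := fun _ : ladder.edgeSet => Bool) S T with hAdef
  have hdep : SetDependsOn A (S : Set ladder.edgeSet) := by
    intro ω ω' h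
    have : S.restrict ω = S.restrict ω' := funext fun e => h e e.2
    simp only [hAdef, mem_cylinder, this]
  have hAm : MeasurableSet A := hdep.measurableSet_of_finite S.finite_toSet
  have hdep' : SetDependsOn (shiftConfig 1 ⁻¹' A) (shiftEdge 1 '' S) := by
    intro ω ω' h
    exact hdep _ _ fun e he => h _ ⟨e, he, rfl⟩
  rw [Measure.map_apply (measurable_shiftConfig 1) hAm]
  have hA1 := hP _ _ S.finite_toSet hdep
  have hA2 := hP _ _ (S.finite_toSet.image _) hdep'
  have hshift : Tendsto (fun N : ℕ × ℕ => (N.1 + 1, N.2 - 1)) atTop atTop := by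
    rw [← prod_atTop_atTop_eq]
    exact (tendsto_add_atTop_nat 1).prodMap (tendsto_sub_atTop_nat 1)
  have hA3 := hA1.comp hshift
  refine (measureReal_eq_measureReal_iff).1 (tendsto_nhds_unique hA2 (hA3.congr' ?_))
  filter_upwards [eventually_ge_atTop (0, 1)] with N hN
  have hN2 : 1 ≤ N.2 := hN.2
  have e : crossing N.1 N.2 = shiftConfig 1 ⁻¹' crossing (N.1 + 1) (N.2 - 1) := by
    rw [crossing_eq_cross, crossing_eq_cross]
    ext ω
    simp only [cross, Set.mem_preimage, Set.mem_ofPred_eq, reach_shiftConfig]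
    have e1 : -((N.1 + 1 : ℕ) : ℤ) + 1 = -(N.1 : ℤ) := by push_cast; ring
    have e2 : N.1 + 1 + (N.2 - 1) = N.1 + N.2 := by omega
    rw [e1, e2]
  simp only [Function.comp]
  have hmp := measurePreserving_shift_bondLaw p 1
  rw [crossingLaw_real, crossingLaw_real, e, ← Set.preimage_inter]
  simp only [measureReal_def]
  rw [hmp.measure_preimage (hAm.inter (measurableSet_crossing _ _)).nullMeasurableSet,
    hmp.measure_preimage (measurableSet_crossing _ _).nullMeasurableSet]

section LimitLaw

variable {p : unitInterval} (h0 : 0 < p) (h1 : p < 1) {P : Measure Config} (hP : IsLocalLimit p P)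

include h0 h1 hP

/-- A longer crossing contains the shorter one, so the conditioned laws give this local event
probability exactly 1 from some point on. -/
lemma limit_crossing (N₁ N₂ : ℕ) : P (crossing N₁ N₂) = 1 := by
  have hdep := cross_dependsOn (-(N₁ : ℤ)) (N₁ + N₂)
  rw [← crossing_eq_cross] at hdep
  have ht := hP _ _ (span_finite _ _) hdep
  have hev : ∀ᶠ N : ℕ × ℕ in atTop, (crossingLaw p N.1 N.2).real (crossing N₁ N₂) = 1 := by
    filter_upwards [eventually_ge_atTop (N₁ + 1, N₂ + 1)] with N hN
    obtain ⟨hN1, hN2⟩ := hN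
    simp only at hN1 hN2
    rw [crossingLaw_real]
    have : crossing N₁ N₂ ∩ crossing N.1 N.2 = crossing N.1 N.2 := by
      refine Set.inter_eq_right.2 ?_
      rw [crossing_eq_cross, crossing_eq_cross]
      obtain ⟨k, hk⟩ := Nat.exists_eq_add_of_le hN1
      obtain ⟨l, hl⟩ := Nat.exists_eq_add_of_le hN2
      have e : N.1 + N.2 = k + 1 + ((N₁ + N₂) + 1 + l) := by omega
      rw [e]
      intro ω hω
      have h2 := (cross_add_subset _ _ _ hω).2
      have e2 : -(N.1 : ℤ) + k + 1 = -(N₁ : ℤ) := by omega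
      rw [e2] at h2
      exact (cross_add_subset _ _ _ h2).1
    rw [this, div_self (bondLaw_real_crossing_pos h0 h1 _ _).ne']
  have := tendsto_nhds_unique ht (tendsto_const_nhds.congr' (hev.mono fun _ h => h.symm))
  rw [measureReal_def, ENNReal.toReal_eq_one_iff] at this
  exact this

/-- Events to the left and events to the right are positively correlated up to a constant. -/
lemma limit_mixing {A B : Set Config} {α β i : ℤ} (hA : SetDependsOn A (span α (2 * i)))
    (hB : SetDependsOn B (span (2 * i + 3) β)) :
    (p : ℝ) ^ 6 * (P.real A * P.real B) ≤ P.real (A ∩ B) := by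
  have hp0 : (0 : ℝ) < p := h0
  have tA := hP _ _ (span_finite _ _) hA
  have tB := hP _ _ (span_finite _ _) hB
  have tAB := hP _ _ ((span_finite _ _).union (span_finite _ _)) (hA.inter hB)
  refine le_of_tendsto_of_tendsto ((tA.mul tB).const_mul _) tAB ?_
  filter_upwards [eventually_ge_atTop ((-i).toNat, (i + 1).toNat)] with N hN
  obtain ⟨hN1, hN2⟩ := hN
  simp only [Int.toNat_le] at hN1 hN2
  obtain ⟨n, hn⟩ := Int.eq_ofNat_of_zero_le (a := i + N.1) (by omega)
  obtain ⟨k, hk⟩ := Int.eq_ofNat_of_zero_le (a := (N.2 : ℤ) - i - 1) (by omega)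
  have ei : i = -(N.1 : ℤ) + n := by omega
  have ec : crossing N.1 N.2 = cross (-(N.1 : ℤ)) (n + 1 + k) := by
    rw [crossing_eq_cross]
    congr 1
    omega
  subst ei
  rw [crossingLaw_real, crossingLaw_real, crossingLaw_real]
  have hz := bondLaw_real_crossing_pos h0 h1 N.1 N.2
  rw [ec] at hz ⊢
  -- The upper bounds split the crossing next to A alone and next to B alone. The lower bounds glue
  -- it next to A ∩ B and, in the normalisation, next to the whole space. Each gluing contributes a
  -- factor p³.
  have u1 := bondLaw_real_cross_le p k hA (B := Set.univ) (β := 0) fun _ _ _ => Iff.rfl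
  have u2 := bondLaw_real_cross_le p k (A := Set.univ) (α := 0) (fun _ _ _ => Iff.rfl) hB
  have l1 := le_bondLaw_real_cross p k hA hB
  have l2 := le_bondLaw_real_cross p (a := -(N.1 : ℤ)) (n := n) k (A := Set.univ) (B := Set.univ)
    (α := 0) (β := 0) (fun _ _ _ => Iff.rfl) (fun _ _ _ => Iff.rfl)
  simp only [Set.inter_univ, Set.univ_inter] at u1 u2 l1 l2
  set z := (bondLaw p).real (cross (-(N.1 : ℤ)) (n + 1 + k))
  set zl := (bondLaw p).real (cross (-(N.1 : ℤ)) n)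
  set zr := (bondLaw p).real (cross (-(N.1 : ℤ) + n + 1) k)
  set cA := (bondLaw p).real (A ∩ cross (-(N.1 : ℤ)) n)
  set cB := (bondLaw p).real (B ∩ cross (-(N.1 : ℤ) + n + 1) k)
  have nzl : 0 ≤ zl := measureReal_nonneg
  have nzr : 0 ≤ zr := measureReal_nonneg
  have ncA : 0 ≤ cA := measureReal_nonneg
  have ncB : 0 ≤ cB := measureReal_nonneg
  rw [div_mul_div_comm, mul_div_assoc', div_le_div_iff₀ (by positivity) hz]
  have s1 : (bondLaw p).real (A ∩ cross (-(N.1 : ℤ)) (n + 1 + k)) *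
      (bondLaw p).real (B ∩ cross (-(N.1 : ℤ)) (n + 1 + k)) ≤ (cA * zr) * (zl * cB) :=
    mul_le_mul u1 u2 measureReal_nonneg (by positivity)
  have s2 : ((p : ℝ) ^ 3 * (cA * cB)) * ((p : ℝ) ^ 3 * (zl * zr)) ≤
      (bondLaw p).real (A ∩ B ∩ cross (-(N.1 : ℤ)) (n + 1 + k)) * z :=
    mul_le_mul l1 l2 (by positivity) measureReal_nonneg
  have s3 : (p : ℝ) ^ 6 * ((bondLaw p).real (A ∩ cross (-(N.1 : ℤ)) (n + 1 + k)) *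
      (bondLaw p).real (B ∩ cross (-(N.1 : ℤ)) (n + 1 + k))) ≤
      (bondLaw p).real (A ∩ B ∩ cross (-(N.1 : ℤ)) (n + 1 + k)) * z := by
    refine le_trans (mul_le_mul_of_nonneg_left s1 (by positivity)) (le_trans (le_of_eq ?_) s2)
    ring
  calc _ ≤ (bondLaw p).real (A ∩ B ∩ cross (-(N.1 : ℤ)) (n + 1 + k)) * z * z :=
        mul_le_mul_of_nonneg_right s3 hz.le
    _ = _ := by ring

/-- The limit law of a local event is comparable to its probability together with a crossing. -/
lemma exists_limit_bounds : ∃ c C : ℝ, 0 < c ∧ 0 < C ∧ ∀ (u : ℤ) (n : ℕ) (B : Set Config),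
    SetDependsOn B (span (2 * u + 1) (2 * (u + n))) →
    c * ((bondLaw p).real (B ∩ cross u n) / rho p ^ n) ≤ P.real B ∧
      P.real B ≤ C * ((bondLaw p).real (B ∩ cross u n) / rho p ^ n) := by
  have hp0 : (0 : ℝ) < p := h0
  have hp1 : (p : ℝ) < 1 := h1
  obtain ⟨c, C, hc, hC, hcC⟩ := exists_survPair_bounds hp0 hp1
  have hr := rho_pos hp0 hp1
  -- Two outer crossings contribute c² or C², the total crossing in the denominator C or c, the two
  -- gluings p⁶, and the two joining columns the factor `rho p ^ 2`.
  refine ⟨(p : ℝ) ^ 6 * c ^ 2 / C / rho p ^ 2, C ^ 2 / c / rho p ^ 2, by positivity, by positivity,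
    fun u n B hB => ?_⟩
  have tB := hP _ _ (span_finite _ _) hB
  have hev : ∀ᶠ N : ℕ × ℕ in atTop, (p : ℝ) ^ 6 * c ^ 2 / C / rho p ^ 2 *
      ((bondLaw p).real (B ∩ cross u n) / rho p ^ n) ≤ (crossingLaw p N.1 N.2).real B ∧
      (crossingLaw p N.1 N.2).real B ≤ C ^ 2 / c / rho p ^ 2 *
        ((bondLaw p).real (B ∩ cross u n) / rho p ^ n) := by
    filter_upwards [eventually_ge_atTop ((1 - u).toNat, (u + n + 1).toNat)] with N hN
    obtain ⟨hN1, hN2⟩ := hN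
    simp only [Int.toNat_le] at hN1 hN2
    obtain ⟨m, hm⟩ := Int.eq_ofNat_of_zero_le (a := u - 1 + N.1) (by omega)
    obtain ⟨k, hk⟩ := Int.eq_ofNat_of_zero_le (a := (N.2 : ℤ) - u - n - 1) (by omega)
    have eu : -(N.1 : ℤ) + m + 1 = u := by omega
    have ec : crossing N.1 N.2 = cross (-(N.1 : ℤ)) (m + 1 + (n + 1 + k)) := by
      rw [crossing_eq_cross]
      congr 1
      omega
    have hB' : SetDependsOn B (span (2 * (-(N.1 : ℤ) + m) + 3) (2 * (u + n))) := by
      have : 2 * (-(N.1 : ℤ) + m) + 3 = 2 * u + 1 := by omega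
      rwa [this]
    have u1 := bondLaw_real_cross_le p (n + 1 + k) (A := Set.univ) (α := 0)
      (fun _ _ _ => Iff.rfl) hB'
    have u2 := bondLaw_real_cross_le p k hB (B := Set.univ) (β := 0) fun _ _ _ => Iff.rfl
    have l1 := le_bondLaw_real_cross p (n + 1 + k) (A := Set.univ) (α := 0)
      (fun _ _ _ => Iff.rfl) hB'
    have l2 := le_bondLaw_real_cross p k hB (B := Set.univ) (β := 0) fun _ _ _ => Iff.rfl
    rw [eu] at u1 l1
    simp only [Set.inter_univ, Set.univ_inter, bondLaw_real_cross] at u1 u2 l1 l2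
    rw [crossingLaw_real, ec, bondLaw_real_cross]
    obtain ⟨z1, z2⟩ := hcC (m + 1 + (n + 1 + k))
    obtain ⟨m1, m2⟩ := hcC m
    obtain ⟨k1, k2⟩ := hcC k
    set b := (bondLaw p).real (B ∩ cross u n)
    have nb : 0 ≤ b := measureReal_nonneg
    have e : rho p ^ (m + 1 + (n + 1 + k)) = rho p ^ m * rho p ^ k * rho p ^ n * rho p ^ 2 := by
      rw [← pow_add, ← pow_add, ← pow_add]; congr 1; ring
    rw [e] at z1 z2
    have hm0 := pow_pos hr m
    have hn0 := pow_pos hr n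
    have hk0 := pow_pos hr k
    set X := rho p ^ m
    set Y := rho p ^ k
    set W := rho p ^ n
    have hz : 0 < (survPair p (m + 1 + (n + 1 + k))).1 := lt_of_lt_of_le (by positivity) z1
    constructor
    · rw [le_div_iff₀ hz]
      have hlow : (p : ℝ) ^ 3 * (c * X * ((p : ℝ) ^ 3 * (b * (c * Y)))) ≤
          (bondLaw p).real (B ∩ cross (-(N.1 : ℤ)) (m + 1 + (n + 1 + k))) := by
        refine le_trans ?_ l1
        have l3 : (p : ℝ) ^ 3 * (b * (c * Y)) ≤ (bondLaw p).real (B ∩ cross u (n + 1 + k)) :=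
          le_trans (by gcongr) l2
        have hsm := (survPair_pos hp0 hp1 m).1
        gcongr
      calc _ ≤ (p : ℝ) ^ 6 * c ^ 2 / C / rho p ^ 2 * (b / W) * (C * (X * Y * W * rho p ^ 2)) := by
            gcongr
        _ = (p : ℝ) ^ 3 * (c * X * ((p : ℝ) ^ 3 * (b * (c * Y)))) := by field_simp
        _ ≤ _ := hlow
    · rw [div_le_iff₀ hz]
      have hup : (bondLaw p).real (B ∩ cross (-(N.1 : ℤ)) (m + 1 + (n + 1 + k))) ≤
          C * X * (b * (C * Y)) := by
        refine u1.trans ?_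
        gcongr
        refine u2.trans ?_
        gcongr
      calc _ ≤ C * X * (b * (C * Y)) := hup
        _ = C ^ 2 / c / rho p ^ 2 * (b / W) * (c * (X * Y * W * rho p ^ 2)) := by field_simp
        _ ≤ _ := by gcongr
  constructor
  · exact ge_of_tendsto tB (hev.mono fun _ h => h.1)
  · exact le_of_tendsto tB (hev.mono fun _ h => h.2)

lemma limit_biInfinite [IsProbabilityMeasure P] : P biInfinite = 1 := by
  rw [biInfinite, ← prob_compl_eq_zero_iff (MeasurableSet.iInter fun N₁ =>
    MeasurableSet.iInter fun N₂ => measurableSet_crossing N₁ N₂)]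
  simp only [Set.compl_iInter, measure_iUnion_null_iff]
  intro N₁ N₂
  rw [prob_compl_eq_zero_iff (measurableSet_crossing N₁ N₂)]
  exact limit_crossing h0 h1 hP N₁ N₂

end LimitLaw

/-! ### Cut edges and traps -/

/-- The edge in row `0` is the only open edge between the columns `i - 1` and `i`. -/
def IsCut (ω : Config) (i : ℤ) : Prop := ω (hEdge i 0) = true ∧ ω (hEdge i 1) = false

/-- Both horizontal edges to column `i` are open and the vertical edge there is closed. -/
def IsPlain (ω : Config) (i : ℤ) : Prop :=
  ω (hEdge i 0) = true ∧ ω (hEdge i 1) = true ∧ ω (rEdge i) = false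

/-- The columns `a + 1, …, a + n` are plain. -/
def plainRun (a : ℤ) (n : ℕ) : Set Config := {ω | ∀ i, a < i → i ≤ a + n → IsPlain ω i}

/-- A cut in column `-n` followed by a dead end of length `n` in row `1`. -/
def trapEvent (n : ℕ) : Set Config :=
  {ω | IsCut ω (-n) ∧ ω (rEdge (-n)) = true} ∩ plainRun (-n) n ∩ {ω | IsCut ω 1}

lemma isCut_dependsOn (i : ℤ) : SetDependsOn {ω | IsCut ω i} (span (2 * i - 1) (2 * i)) :=
  fun ω ω' h => by
    simp only [Set.mem_ofPred_eq, IsCut]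
    rw [h (hEdge i 0) ⟨by simp, by simp⟩, h (hEdge i 1) ⟨by simp, by simp⟩]

lemma isPlain_dependsOn (i : ℤ) : SetDependsOn {ω | IsPlain ω i} (span (2 * i - 1) (2 * i + 1)) :=
  fun ω ω' h => by
    simp only [Set.mem_ofPred_eq, IsPlain]
    rw [h (hEdge i 0) ⟨by simp, by simp⟩, h (hEdge i 1) ⟨by simp, by simp⟩,
      h (rEdge i) ⟨by simp, by simp⟩]

lemma isCut_rung_dependsOn (i : ℤ) :
    SetDependsOn {ω | IsCut ω i ∧ ω (rEdge i) = true} (span (2 * i - 1) (2 * i + 1)) :=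
  fun ω ω' h => by
    simp only [Set.mem_ofPred_eq, IsCut]
    rw [h (hEdge i 0) ⟨by simp, by simp⟩, h (hEdge i 1) ⟨by simp, by simp⟩,
      h (rEdge i) ⟨by simp, by simp⟩]

lemma plainRun_succ (a : ℤ) (n : ℕ) :
    plainRun a (n + 1) = plainRun a n ∩ {ω | IsPlain ω (a + n + 1)} := by
  ext ω
  constructor
  · intro h
    exact ⟨fun i hi hi' => h i hi (by push_cast; omega), h _ (by omega) (by push_cast; omega)⟩
  · rintro ⟨h1, h2⟩ i hi hi'
    rcases lt_or_ge (a + n) i with h | h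
    · have : i = a + n + 1 := by push_cast at hi'; omega
      subst this
      exact h2
    · exact h1 i hi h

lemma plainRun_dependsOn (a : ℤ) (n : ℕ) :
    SetDependsOn (plainRun a n) (span (2 * a + 1) (2 * (a + n) + 1)) := fun ω ω' h => by
  refine forall_congr' fun i => forall_congr' fun hi => forall_congr' fun hi' => ?_
  exact isPlain_dependsOn i ω ω' fun e he => h e (span_mono (by omega) (by omega) he)

/-! ### Probabilities of cuts and traps under bond percolation -/

section Bond

variable (p : unitInterval)

lemma measurableSet_edge (e : ladder.edgeSet) (b : Bool) : MeasurableSet {ω : Config | ω e = b} :=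
  (edge_dependsOn e b).measurableSet_of_finite (Set.finite_singleton e)

lemma hEdge_one_notMem (i : ℤ) : hEdge i 1 ∉ ({hEdge i 0} : Set ladder.edgeSet) := fun h =>
  absurd (hEdge_injective (Set.mem_singleton_iff.1 h)) (by decide)

lemma rEdge_notMem (i : ℤ) : rEdge i ∉ ({hEdge i 0} ∪ {hEdge i 1} : Set ladder.edgeSet) := by
  rintro (h | h) <;>
  · have := congrArg pos (Set.mem_singleton_iff.1 h)
    simp at this
    omega

lemma bondLaw_real_column (i : ℤ) (x y r : Bool) :
    (bondLaw p).real {ω | (ω (hEdge i 0) = x ∧ ω (hEdge i 1) = y) ∧ ω (rEdge i) = r} =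
      wt p x * wt p y * wt p r := by
  have := bondLaw_real_inter_edge p ((edge_dependsOn (hEdge i 0) x).inter
    (edge_dependsOn (hEdge i 1) y)) ((measurableSet_edge _ _).inter (measurableSet_edge _ _))
    (rEdge_notMem i) r
  rw [bondLaw_real_inter_edge p (edge_dependsOn _ _) (measurableSet_edge _ _) (hEdge_one_notMem i),
    bondLaw_real_edge] at this
  exact this

lemma bondLaw_real_isCut (i : ℤ) : (bondLaw p).real {ω | IsCut ω i} = p * (1 - p) := by
  have := bondLaw_real_inter_edge p (edge_dependsOn (hEdge i 0) true) (measurableSet_edge _ _)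
    (hEdge_one_notMem i) false
  rw [bondLaw_real_edge] at this
  exact this

lemma bondLaw_real_isPlain (i : ℤ) : (bondLaw p).real {ω | IsPlain ω i} = p ^ 2 * (1 - p) := by
  have h := bondLaw_real_column p i true true false
  simp only [and_assoc] at h
  rw [show {ω | IsPlain ω i} = {ω : Config | ω (hEdge i 0) = true ∧ ω (hEdge i 1) = true ∧
    ω (rEdge i) = false} from rfl, h]
  simp only [wt, if_true, Bool.false_eq_true, if_false]
  ring

lemma bondLaw_real_plainRun (a : ℤ) (n : ℕ) :
    (bondLaw p).real (plainRun a n) = ((p : ℝ) ^ 2 * (1 - p)) ^ n := by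
  induction n with
  | zero =>
    have : plainRun a 0 = Set.univ := by
      ext ω
      simp only [plainRun, Set.mem_ofPred_eq, Set.mem_univ, iff_true]
      intro i h1 h2
      simp at h2
      omega
    simp [this]
  | succ n ih =>
    rw [plainRun_succ, bondLaw_real_inter p (plainRun_dependsOn a n) (isPlain_dependsOn _)
      (plainRun_dependsOn a n).measurableSet_config (isPlain_dependsOn _).measurableSet_config
      (span_disjoint (by omega)), ih, bondLaw_real_isPlain, ← pow_succ]

lemma trapEvent_dependsOn (n : ℕ) :
    SetDependsOn (trapEvent n) (span (2 * (-n - 1) + 1) (2 * ((-n - 1) + (n + 2 : ℕ)))) :=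
  (((isCut_rung_dependsOn _).inter (plainRun_dependsOn _ _)).inter (isCut_dependsOn 1)).mono
    (Set.union_subset (Set.union_subset (span_mono (by omega) (by push_cast; omega))
      (span_mono (by omega) (by push_cast; omega))) (span_mono (by omega) (by push_cast; omega)))

lemma bondLaw_real_trapEvent (n : ℕ) : (bondLaw p).real (trapEvent n) =
    p * (1 - p) * p * ((p : ℝ) ^ 2 * (1 - p)) ^ n * (p * (1 - p)) := by
  have hd := ((isCut_rung_dependsOn (-(n : ℤ))).inter (plainRun_dependsOn (-(n : ℤ)) n)).mono
    (T := span (2 * (-n) - 1) 1)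
    (Set.union_subset (span_mono le_rfl (by omega)) (span_mono (by omega) (by omega)))
  rw [trapEvent, bondLaw_real_inter p hd (isCut_dependsOn 1) hd.measurableSet_config
    (isCut_dependsOn _).measurableSet_config (span_disjoint (by omega)),
    bondLaw_real_inter p (isCut_rung_dependsOn _) (plainRun_dependsOn _ _)
    (isCut_rung_dependsOn _).measurableSet_config (plainRun_dependsOn _ _).measurableSet_config
    (span_disjoint (by omega)), bondLaw_real_plainRun, bondLaw_real_isCut]
  have h := bondLaw_real_column p (-(n : ℤ)) true false true
  rw [show {ω | IsCut ω (-(n : ℤ)) ∧ ω (rEdge (-(n : ℤ))) = true} = {ω : Config |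
    (ω (hEdge (-(n : ℤ)) 0) = true ∧ ω (hEdge (-(n : ℤ)) 1) = false) ∧
    ω (rEdge (-(n : ℤ))) = true} from rfl, h]
  simp [wt]

end Bond

lemma reach_of_row {ω : Config} {a : ℤ} {n : ℕ} (h : ∀ i, a < i → i ≤ a + n → ω (hEdge i 0) = true) :
    reach ω a full n 0 = true := by
  induction n with
  | zero => rfl
  | succ n ih =>
    have h1 := ih fun i hi hi' => h i hi (by push_cast; omega)
    have h2 := h (a + n + 1) (by omega) (by push_cast; omega)
    simp [reach, next, h1, h2]

/-- Row 0 is open along the whole trap, so the trap already contains the crossing that the limit law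
demands. -/
lemma trapEvent_subset_cross (n : ℕ) : trapEvent n ⊆ cross (-n - 1) (n + 2) := by
  rintro ω ⟨⟨⟨h1, _⟩, h2⟩, h3⟩
  refine ⟨0, reach_of_row fun i hi hi' => ?_⟩
  push_cast at hi'
  rcases lt_trichotomy i (-n) with h | h | h
  · omega
  · rw [h]; exact h1.1
  · rcases le_or_gt i 0 with h' | h'
    · exact (h2 i h (by omega)).1
    · have : i = 1 := by omega
      rw [this]; exact h3.1

/-! ### Tails of traps and cuts under the limit law -/

section LimitLaw

variable {p : unitInterval} (h0 : 0 < p) (h1 : p < 1) {P : Measure Config} (hP : IsLocalLimit p P)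

include h0 h1 hP

/-- Exponential tail of the length of traps. -/
lemma exists_limit_plainRun_le : ∃ C : ℝ, 0 < C ∧ ∀ n : ℕ,
    P.real (plainRun (-n) n) ≤ C * Real.exp (-(2 * criticalBias p)) ^ n := by
  have hp0 : (0 : ℝ) < p := h0
  have hp1 : (p : ℝ) < 1 := h1
  have hr := rho_pos hp0 hp1
  obtain ⟨c, C, hc, hC, h⟩ := exists_limit_bounds h0 h1 hP
  refine ⟨C / rho p, by positivity, fun n => ?_⟩
  have hd : SetDependsOn (plainRun (-n) n) (span (2 * (-n) + 1) (2 * ((-n) + (n + 1 : ℕ)))) :=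
    (plainRun_dependsOn (-(n : ℤ)) n).mono (span_mono le_rfl (by push_cast; omega))
  refine ((h _ _ _ hd).2).trans ?_
  have hle : (bondLaw p).real (plainRun (-n) n ∩ cross (-n) (n + 1)) ≤
      ((p : ℝ) ^ 2 * (1 - p)) ^ n :=
    (measureReal_mono Set.inter_subset_left).trans_eq (bondLaw_real_plainRun p _ n)
  -- The powers of `rho` cancel against the normalisation, and exp(-2λ_c n) is what remains.
  rw [rho_eq hp0 hp1, mul_pow] at hle
  calc C * ((bondLaw p).real (plainRun (-n) n ∩ cross (-n) (n + 1)) / rho p ^ (n + 1))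
      ≤ C * ((rho p ^ n * Real.exp (-(2 * criticalBias p)) ^ n) / rho p ^ (n + 1)) := by gcongr
    _ = _ := by rw [pow_succ]; field_simp

/-- Traps of length `n` have at least exponentially small probability. -/
lemma exists_le_limit_trapEvent : ∃ c : ℝ, 0 < c ∧ ∀ n : ℕ,
    c * Real.exp (-(2 * criticalBias p)) ^ n ≤ P.real (trapEvent n) := by
  have hp0 : (0 : ℝ) < p := h0
  have hp1 : (p : ℝ) < 1 := h1
  have hq : 0 < 1 - (p : ℝ) := by linarith
  have hr := rho_pos hp0 hp1
  obtain ⟨c, C, hc, hC, h⟩ := exists_limit_bounds h0 h1 hP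
  refine ⟨c * (p * (1 - p) * p * (p * (1 - p))) / rho p ^ 2, by positivity, fun n => ?_⟩
  refine le_trans (le_of_eq ?_) (h _ _ _ (trapEvent_dependsOn n)).1
  rw [Set.inter_eq_left.2 (trapEvent_subset_cross n), bondLaw_real_trapEvent, rho_eq hp0 hp1,
    mul_pow, pow_add]
  field_simp

/-- Exponential tail of the distance to a cut. -/
lemma exists_limit_noCut_le [IsProbabilityMeasure P] : ∃ q : ℝ, 0 ≤ q ∧ q < 1 ∧ ∀ (d : ℕ) (i : ℤ),
    P.real {ω | ∀ k : ℕ, k < d → ¬ IsCut ω (i - 2 * k)} ≤ q ^ d := by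
  have hp0 : (0 : ℝ) < p := h0
  have hp1 : (p : ℝ) < 1 := h1
  have hq : 0 < 1 - (p : ℝ) := by linarith
  have hr := rho_pos hp0 hp1
  obtain ⟨c, C, hc, hC, h⟩ := exists_limit_bounds h0 h1 hP
  set κ : ℝ := c * (p * (1 - p) / rho p ^ 1) with hκ
  have hκ0 : 0 < κ := by positivity
  have hcut : ∀ i : ℤ, κ ≤ P.real {ω | IsCut ω i} := by
    intro i
    have hd : SetDependsOn {ω | IsCut ω i} (span (2 * (i - 1) + 1) (2 * ((i - 1) + (1 : ℕ)))) :=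
      (isCut_dependsOn i).mono (span_mono (by omega) (by push_cast; omega))
    refine le_trans (le_of_eq ?_) (h _ _ _ hd).1
    rw [Set.inter_eq_left.2, bondLaw_real_isCut]
    rintro ω ⟨hω, _⟩
    refine ⟨0, reach_of_row fun k hk hk' => ?_⟩
    have : k = i := by push_cast at hk'; omega
    rwa [this]
  have hκ1 : (p : ℝ) ^ 6 * κ ≤ 1 := by
    have h2 : κ ≤ 1 := (hcut 0).trans measureReal_le_one
    have h3 : (p : ℝ) ^ 6 ≤ 1 := pow_le_one₀ hp0.le hp1.le
    nlinarith [pow_pos hp0 6]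
  -- Every column is a cut with probability at least κ, and by mixing still with at least p⁶ κ given
  -- that the tested columns to its left are not cuts.
  refine ⟨1 - (p : ℝ) ^ 6 * κ, by linarith, by linarith [mul_pos (pow_pos hp0 6) hκ0], ?_⟩
  intro d
  induction d with
  | zero => intro i; simp
  | succ d ih =>
    intro i
    set A : Set Config := {ω | ∀ k : ℕ, k < d → ¬ IsCut ω ((i - 2) - 2 * k)} with hA
    have hAd : SetDependsOn A (span (2 * (i - 2 * d - 2)) (2 * (i - 2))) := by
      intro ω ω' hω
      refine forall_congr' fun k => forall_congr' fun hk => not_congr ?_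
      exact isCut_dependsOn _ ω ω' fun e he => hω e (span_mono (by omega) (by omega) he)
    -- Testing every second column leaves exactly the gap that `limit_mixing` requires.
    have hBd : SetDependsOn {ω | IsCut ω i} (span (2 * (i - 2) + 3) (2 * i)) :=
      (isCut_dependsOn i).mono (span_mono (by omega) le_rfl)
    have hmix := limit_mixing h0 h1 hP hAd hBd
    have hsub : {ω | ∀ k : ℕ, k < d + 1 → ¬ IsCut ω (i - 2 * k)} ⊆ A \ (A ∩ {ω | IsCut ω i}) := by
      intro ω hω
      refine ⟨fun k hk => ?_, fun h => hω 0 (by omega) (by simpa using h.2)⟩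
      have := hω (k + 1) (by omega)
      push_cast at this
      rwa [show i - 2 * ((k : ℤ) + 1) = i - 2 - 2 * k by ring] at this
    have hAm := hAd.measurableSet_config
    have hBm := hBd.measurableSet_config
    have hdiff := measureReal_sdiff (μ := P) (s₁ := A) (s₂ := A ∩ {ω | IsCut ω i})
      Set.inter_subset_left (hAm.inter hBm)
    have hA0 : 0 ≤ P.real A := measureReal_nonneg
    calc _ ≤ P.real (A \ (A ∩ {ω | IsCut ω i})) := measureReal_mono hsub
      _ = P.real A - P.real (A ∩ {ω | IsCut ω i}) := hdiff
      _ ≤ P.real A - (p : ℝ) ^ 6 * (P.real A * κ) := by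
          have := hcut i
          have h6 := pow_pos hp0 6
          have : (p : ℝ) ^ 6 * (P.real A * κ) ≤ (p : ℝ) ^ 6 * (P.real A * P.real {ω | IsCut ω i}) := by
            gcongr
          linarith
      _ = (1 - (p : ℝ) ^ 6 * κ) * P.real A := by ring
      _ ≤ (1 - (p : ℝ) ^ 6 * κ) * (1 - (p : ℝ) ^ 6 * κ) ^ d :=
          mul_le_mul_of_nonneg_left (ih (i - 2)) (by linarith)
      _ = _ := by rw [pow_succ]; ring

end LimitLaw

/-! ### The walk as an electrical network -/

/-- The normalising constant of the transition probabilities. -/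
def norm (lam : ℝ) : ℝ := Real.exp lam + 1 + Real.exp (-lam)

lemma norm_pos (lam : ℝ) : 0 < norm lam := by unfold norm; positivity

/-- The reversible measure of the walk. -/
def revMeasure (lam : ℝ) (v : V) : ℝ := norm lam * Real.exp (2 * lam * v.1)

lemma revMeasure_pos (lam : ℝ) (v : V) : 0 < revMeasure lam v :=
  mul_pos (norm_pos lam) (Real.exp_pos _)

open Classical in
/-- The conductance between two vertices. -/
def conduct (lam : ℝ) (ω : Config) (v w : V) : ℝ :=
  if (openGraph ω).Adj v w then Real.exp (lam * ((v.1 : ℝ) + w.1)) else 0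

lemma conduct_nonneg (lam : ℝ) (ω : Config) (v w : V) : 0 ≤ conduct lam ω v w := by
  unfold conduct; split_ifs <;> positivity

lemma conduct_comm (lam : ℝ) (ω : Config) (v w : V) : conduct lam ω v w = conduct lam ω w v := by
  unfold conduct
  rw [SimpleGraph.adj_comm, add_comm]

lemma conduct_of_adj {lam : ℝ} {ω : Config} {v w : V} (h : (openGraph ω).Adj v w) :
    conduct lam ω v w = Real.exp (lam * ((v.1 : ℝ) + w.1)) := by
  simp [conduct, h]

lemma conduct_of_not_adj {lam : ℝ} {ω : Config} {v w : V} (h : ¬ (openGraph ω).Adj v w) :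
    conduct lam ω v w = 0 := by
  simp [conduct, h]

lemma mem_nbrs_of_adj {ω : Config} {v w : V} (h : (openGraph ω).Adj v w) : w ∈ nbrs v :=
  (mem_nbrs v w).2 ((SimpleGraph.mem_edgeSet _).1 h.1)

/-- Detailed balance: the right side is symmetric in the two vertices. -/
lemma revMeasure_mul_hop (lam : ℝ) (ω : Config) (v w : V) :
    revMeasure lam v * hop lam ω v w = conduct lam ω v w := by
  unfold revMeasure hop conduct
  split_ifs
  · have : 0 < Real.exp lam + 1 + Real.exp (-lam) := by positivity
    rw [norm]
    field_simp
    rw [← Real.exp_add]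
    congr 1
    ring
  · simp

/-- The network Laplacian. -/
def lap (lam : ℝ) (ω : Config) (f : V → ℝ) (v : V) : ℝ :=
  ∑ w ∈ nbrs v, conduct lam ω v w * (f v - f w)

/-- The transition operator of the walk. -/
def stepOp (lam : ℝ) (ω : Config) (f : V → ℝ) (v : V) : ℝ :=
  ∑ w ∈ insert v (nbrs v), transProb lam ω v w * f w

lemma stepOp_eq (lam : ℝ) (ω : Config) (f : V → ℝ) (v : V) :
    stepOp lam ω f v = f v - ∑ w ∈ nbrs v, hop lam ω v w * (f v - f w) := by
  unfold stepOp
  rw [Finset.sum_insert (not_mem_nbrs_self v)]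
  have : ∑ w ∈ nbrs v, transProb lam ω v w * f w = ∑ w ∈ nbrs v, hop lam ω v w * f w := by
    refine Finset.sum_congr rfl fun w hw => ?_
    have : w ≠ v := fun h => not_mem_nbrs_self v (h ▸ hw)
    simp [transProb, this]
  rw [this]
  simp only [transProb, if_true, mul_sub, Finset.sum_sub_distrib, ← Finset.sum_mul]
  ring

lemma lap_eq (lam : ℝ) (ω : Config) (f : V → ℝ) (v : V) :
    lap lam ω f v = revMeasure lam v * (f v - stepOp lam ω f v) := by
  rw [stepOp_eq, lap, sub_sub_cancel, Finset.mul_sum]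
  refine Finset.sum_congr rfl fun w _ => ?_
  rw [← revMeasure_mul_hop, mul_assoc]

/-- The `n`-step transition probabilities. -/
def heat (lam : ℝ) (ω : Config) : ℕ → V → V → ℝ
  | 0 => fun v y => if v = y then 1 else 0
  | n + 1 => fun v y => stepOp lam ω (fun w => heat lam ω n w y) v

lemma heat_nonneg (lam : ℝ) (ω : Config) (n : ℕ) (v y : V) : 0 ≤ heat lam ω n v y := by
  induction n generalizing v with
  | zero => simp only [heat]; split_ifs <;> norm_num
  | succ n ih =>
    simp only [heat, stepOp]
    exact Finset.sum_nonneg fun w _ => mul_nonneg (transProb_nonneg _ _ _ _) (ih w)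

/-- The vertices in the columns `-M, …, M`. -/
def box (M : ℕ) : Finset V := Finset.Icc (-(M : ℤ)) M ×ˢ Finset.univ

lemma mem_box {M : ℕ} {v : V} : v ∈ box M ↔ |v.1| ≤ M := by
  simp [box, abs_le]

/-- The function `f` vanishes outside of the columns `-M, …, M`. -/
def SuppBox (M : ℕ) (f : V → ℝ) : Prop := ∀ v, (M : ℤ) < |v.1| → f v = 0

lemma SuppBox.mono {M M' : ℕ} {f : V → ℝ} (h : SuppBox M f) (hM : M ≤ M') : SuppBox M' f :=
  fun v hv => h v (by omega)

lemma abs_sub_le_of_mem_nbrs {v w : V} (h : w ∈ nbrs v) : |w.1 - v.1| ≤ 1 := by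
  simp only [nbrs, Finset.mem_insert, Finset.mem_singleton] at h
  rcases h with rfl | rfl | rfl <;> simp

lemma nbrs_subset_box {M : ℕ} {v : V} (h : v ∈ box M) : nbrs v ⊆ box (M + 1) := by
  intro w hw
  rw [mem_box] at *
  have := abs_sub_le_of_mem_nbrs hw
  rw [abs_le] at *
  push_cast
  omega

lemma suppBox_heat (lam : ℝ) (ω : Config) (n : ℕ) (y : V) :
    SuppBox (y.1.natAbs + n) fun v => heat lam ω n v y := by
  induction n with
  | zero =>
    intro v hv
    have : v ≠ y := by rintro rfl; simp at hv
    simp [heat, this]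
  | succ n ih =>
    intro v hv
    simp only [heat, stepOp]
    refine Finset.sum_eq_zero fun w hw => ?_
    refine mul_eq_zero_of_right _ (ih w ?_)
    rcases Finset.mem_insert.1 hw with rfl | hw
    · push_cast at hv ⊢; omega
    · have := abs_sub_le_of_mem_nbrs hw
      have h2 := abs_sub_abs_le_abs_sub v.1 w.1
      rw [abs_sub_comm] at h2
      push_cast at hv ⊢; omega

lemma sum_nbrs_eq_sum_box {M : ℕ} {v : V} (hv : v ∈ box M) (lam : ℝ) (ω : Config) (F : V → ℝ) :
    ∑ w ∈ nbrs v, conduct lam ω v w * F w = ∑ w ∈ box (M + 1), conduct lam ω v w * F w := by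
  refine Finset.sum_subset (nbrs_subset_box hv) fun w _ hw => ?_
  rw [conduct_of_not_adj fun h => hw (mem_nbrs_of_adj h), zero_mul]

/-- Summation by parts. -/
lemma sum_mul_lap {M : ℕ} {f : V → ℝ} (hf : SuppBox M f) (lam : ℝ) (ω : Config) (h : V → ℝ) :
    ∑ v ∈ box (M + 1), f v * lap lam ω h v =
      (∑ v ∈ box (M + 1), ∑ w ∈ box (M + 1),
        conduct lam ω v w * ((f v - f w) * (h v - h w))) / 2 := by
  have e1 : ∑ v ∈ box (M + 1), f v * lap lam ω h v =
      ∑ v ∈ box (M + 1), ∑ w ∈ box (M + 1), conduct lam ω v w * (f v * (h v - h w)) := by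
    refine Finset.sum_congr rfl fun v _ => ?_
    by_cases hv : v ∈ box M
    · rw [lap, sum_nbrs_eq_sum_box hv, Finset.mul_sum]
      refine Finset.sum_congr rfl fun w _ => by ring
    · rw [hf v (by rw [mem_box] at hv; omega)]
      simp
  have e2 : ∑ v ∈ box (M + 1), ∑ w ∈ box (M + 1), conduct lam ω v w * (f v * (h v - h w)) =
      ∑ v ∈ box (M + 1), ∑ w ∈ box (M + 1), conduct lam ω v w * (f w * (h w - h v)) := by
    rw [Finset.sum_comm]
    refine Finset.sum_congr rfl fun v _ => Finset.sum_congr rfl fun w _ => ?_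
    rw [conduct_comm]
  rw [e1, eq_div_iff two_ne_zero, mul_two]
  nth_rw 2 [e2]
  rw [← Finset.sum_add_distrib]
  refine Finset.sum_congr rfl fun v _ => ?_
  rw [← Finset.sum_add_distrib]
  exact Finset.sum_congr rfl fun w _ => by ring

lemma sum_mul_lap_comm {M : ℕ} {f h : V → ℝ} (hf : SuppBox M f) (hh : SuppBox M h) (lam : ℝ)
    (ω : Config) : ∑ v ∈ box (M + 1), f v * lap lam ω h v =
      ∑ v ∈ box (M + 1), h v * lap lam ω f v := by
  rw [sum_mul_lap hf, sum_mul_lap hh]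
  congr 1
  exact Finset.sum_congr rfl fun v _ => Finset.sum_congr rfl fun w _ => by ring

lemma sum_stepOp_comm {M : ℕ} {f h : V → ℝ} (hf : SuppBox M f) (hh : SuppBox M h) (lam : ℝ)
    (ω : Config) : ∑ v ∈ box (M + 1), revMeasure lam v * (f v * stepOp lam ω h v) =
      ∑ v ∈ box (M + 1), revMeasure lam v * (stepOp lam ω f v * h v) := by
  have e := sum_mul_lap_comm hf hh lam ω
  simp only [lap_eq] at e
  have e' : ∑ v ∈ box (M + 1), (revMeasure lam v * (f v * h v) - f v *
      (revMeasure lam v * (h v - stepOp lam ω h v))) = ∑ v ∈ box (M + 1),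
      (revMeasure lam v * (f v * h v) - h v * (revMeasure lam v * (f v - stepOp lam ω f v))) := by
    rw [Finset.sum_sub_distrib, Finset.sum_sub_distrib, e]
  refine Eq.trans (Finset.sum_congr rfl fun v _ => by ring)
    (e'.trans (Finset.sum_congr rfl fun v _ => by ring))

/-- The transition operator is self-adjoint for the reversible measure, so steps move one by one
from one factor to the other. The heat kernels have finite range, and in a sufficiently large box
there are no boundary terms. -/
lemma sum_heat_comm (lam : ℝ) (ω : Config) (x y : V) (n k M : ℕ)
    (hM : x.1.natAbs + y.1.natAbs + n + k ≤ M) :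
    ∑ v ∈ box (M + 1), revMeasure lam v * (heat lam ω k v x * heat lam ω n v y) =
    ∑ v ∈ box (M + 1), revMeasure lam v * (heat lam ω (k + n) v x * heat lam ω 0 v y) := by
  induction n generalizing k with
  | zero => rfl
  | succ n ih =>
    have h := sum_stepOp_comm ((suppBox_heat lam ω k x).mono (M' := M) (by omega))
      ((suppBox_heat lam ω n y).mono (M' := M) (by omega)) lam ω
    rw [show k + (n + 1) = (k + 1) + n by ring, ← ih (k + 1) (by omega)]
    exact h

lemma heat_comm (lam : ℝ) (ω : Config) (x y : V) (n : ℕ) :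
    revMeasure lam x * heat lam ω n x y = revMeasure lam y * heat lam ω n y x := by
  have h := sum_heat_comm lam ω x y n 0 (x.1.natAbs + y.1.natAbs + n) (by omega)
  have hx : x ∈ box (x.1.natAbs + y.1.natAbs + n + 1) := by rw [mem_box, Int.abs_eq_natAbs]; omega
  have hy : y ∈ box (x.1.natAbs + y.1.natAbs + n + 1) := by rw [mem_box, Int.abs_eq_natAbs]; omega
  simp only [heat, ite_mul, mul_ite, one_mul, mul_one, zero_mul, mul_zero, zero_add] at h
  rw [Finset.sum_ite_eq' _ x, Finset.sum_ite_eq' _ y, if_pos hx, if_pos hy] at h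
  exact h

/-- The potential at `v` of a unit current that enters at `y`, truncated at time `N`. -/
def pot (lam : ℝ) (ω : Config) (N : ℕ) (y v : V) : ℝ :=
  (∑ k ∈ Finset.range N, heat lam ω k v y) / revMeasure lam y

lemma pot_nonneg (lam : ℝ) (ω : Config) (N : ℕ) (y v : V) : 0 ≤ pot lam ω N y v :=
  div_nonneg (Finset.sum_nonneg fun _ _ => heat_nonneg _ _ _ _ _) (revMeasure_pos _ _).le

lemma pot_mono (lam : ℝ) (ω : Config) (y v : V) : Monotone fun N => pot lam ω N y v := by
  refine monotone_nat_of_le_succ fun N => ?_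
  simp only [pot, Finset.sum_range_succ]
  have := heat_nonneg lam ω N v y
  have := revMeasure_pos lam y
  gcongr
  linarith

lemma pot_comm (lam : ℝ) (ω : Config) (N : ℕ) (y v : V) : pot lam ω N y v = pot lam ω N v y := by
  unfold pot
  rw [div_eq_div_iff (revMeasure_pos _ _).ne' (revMeasure_pos _ _).ne', Finset.sum_mul,
    Finset.sum_mul]
  refine Finset.sum_congr rfl fun k _ => ?_
  rw [mul_comm, heat_comm, mul_comm]

lemma suppBox_pot (lam : ℝ) (ω : Config) (N : ℕ) (y : V) :
    SuppBox (y.1.natAbs + N) (pot lam ω N y) := by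
  intro v hv
  unfold pot
  rw [Finset.sum_eq_zero, zero_div]
  intro k hk
  have := Finset.mem_range.1 hk
  exact (suppBox_heat lam ω k y).mono (by omega) v hv

/-- The sum of the heat kernels telescopes under the Laplacian. The remainder at time N is turned
around by reversibility and is the mass that has not yet left. -/
lemma lap_pot (lam : ℝ) (ω : Config) (N : ℕ) (y v : V) :
    lap lam ω (pot lam ω N y) v = (if v = y then 1 else 0) - heat lam ω N y v := by
  have hlin : stepOp lam ω (pot lam ω N y) v =
      (∑ k ∈ Finset.range N, heat lam ω (k + 1) v y) / revMeasure lam y := by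
    simp only [stepOp, pot, heat]
    rw [Finset.sum_comm, Finset.sum_div]
    refine Finset.sum_congr rfl fun w _ => ?_
    rw [← Finset.mul_sum, mul_div_assoc]
  rw [lap_eq, hlin, pot, ← sub_div, ← Finset.sum_sub_distrib]
  have htel : ∑ k ∈ Finset.range N, (heat lam ω k v y - heat lam ω (k + 1) v y) =
      heat lam ω 0 v y - heat lam ω N v y :=
    Finset.sum_range_sub' (fun k => heat lam ω k v y) N
  have hy := (revMeasure_pos lam y).ne'
  rw [htel, mul_div_assoc', mul_sub, heat_comm lam ω v y N, sub_div,
    mul_div_cancel_left₀ _ hy]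
  congr 1
  simp only [heat]
  split_ifs with h
  · rw [h, mul_one, div_self hy]
  · simp

/-- The current through an edge is at most the current that enters the network. -/
lemma conduct_mul_sub_le (lam : ℝ) (ω : Config) (N : ℕ) (y a b : V) :
    conduct lam ω a b * (pot lam ω N y a - pot lam ω N y b) ≤ 1 := by
  set g := pot lam ω N y with hg
  rcases le_or_gt (g a) (g b) with hab | hab
  · exact (mul_nonpos_of_nonneg_of_nonpos (conduct_nonneg _ _ _ _) (by linarith)).trans zero_le_one
  have hga : 0 < g a := (pot_nonneg lam ω N y b).trans_lt hab
  by_cases hadj : (openGraph ω).Adj a b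
  swap
  · rw [conduct_of_not_adj hadj, zero_mul]; exact zero_le_one
  set M := y.1.natAbs + N
  have hsupp : SuppBox M g := suppBox_pot lam ω N y
  have hbox : ∀ v, 0 < g v → v ∈ box M := by
    intro v hv
    rw [mem_box]
    by_contra hcon
    rw [hsupp v (by omega)] at hv
    exact lt_irrefl _ hv
  classical
  -- Take the superlevel set of the potential at a. The total current out of it is at most 1, every
  -- edge leaving it carries current outwards, and the edge from a to b is one of them.
  set S := (box M).filter fun v => g a ≤ g v with hS
  have hSB : S ⊆ box (M + 1) := (Finset.filter_subset _ _).trans fun v hv => by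
    rw [mem_box] at *; push_cast; omega
  have haS : a ∈ S := Finset.mem_filter.2 ⟨hbox a hga, le_rfl⟩
  have hbS : b ∉ S := fun h => absurd (Finset.mem_filter.1 h).2 (not_le.2 hab)
  have hbB : b ∈ box (M + 1) := nbrs_subset_box (hbox a hga) (mem_nbrs_of_adj hadj)
  have hflux : ∑ v ∈ S, lap lam ω g v ≤ 1 := by
    simp only [hg, lap_pot, Finset.sum_sub_distrib]
    have h1 : ∑ v ∈ S, (if v = y then (1 : ℝ) else 0) ≤ 1 := by
      rw [Finset.sum_ite_eq']
      split_ifs <;> norm_num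
    have h2 : 0 ≤ ∑ v ∈ S, heat lam ω N y v := Finset.sum_nonneg fun v _ => heat_nonneg _ _ _ _ _
    linarith
  have e1 : ∑ v ∈ S, lap lam ω g v =
      ∑ v ∈ S, ∑ w ∈ S, conduct lam ω v w * (g v - g w) +
      ∑ v ∈ S, ∑ w ∈ box (M + 1) \ S, conduct lam ω v w * (g v - g w) := by
    rw [← Finset.sum_add_distrib]
    refine Finset.sum_congr rfl fun v hv => ?_
    rw [lap, sum_nbrs_eq_sum_box (Finset.mem_filter.1 hv).1 lam ω (fun w => g v - g w),
      ← Finset.sum_sdiff hSB]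
    exact add_comm _ _
  -- Currents inside S cancel in pairs, by symmetry of the conductances.
  have e2 : ∑ v ∈ S, ∑ w ∈ S, conduct lam ω v w * (g v - g w) = 0 := by
    have : ∑ v ∈ S, ∑ w ∈ S, conduct lam ω v w * (g v - g w) =
        -∑ v ∈ S, ∑ w ∈ S, conduct lam ω v w * (g v - g w) := by
      conv_lhs => rw [Finset.sum_comm]
      rw [← Finset.sum_neg_distrib]
      refine Finset.sum_congr rfl fun v _ => ?_
      rw [← Finset.sum_neg_distrib]
      refine Finset.sum_congr rfl fun w _ => ?_
      rw [conduct_comm]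
      ring
    linarith
  have hnn : ∀ v ∈ S, ∀ w ∈ box (M + 1) \ S, 0 ≤ conduct lam ω v w * (g v - g w) := by
    intro v hv w hw
    refine mul_nonneg (conduct_nonneg _ _ _ _) ?_
    have h1 := (Finset.mem_filter.1 hv).2
    have h2 : g w < g a := by
      by_contra hcon
      have hcon := not_lt.1 hcon
      exact (Finset.mem_sdiff.1 hw).2 (Finset.mem_filter.2 ⟨hbox w (hga.trans_le hcon), hcon⟩)
    linarith
  have e3 : conduct lam ω a b * (g a - g b) ≤
      ∑ v ∈ S, ∑ w ∈ box (M + 1) \ S, conduct lam ω v w * (g v - g w) :=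
    (Finset.single_le_sum (f := fun w => conduct lam ω a w * (g a - g w)) (hnn a haS)
      (Finset.mem_sdiff.2 ⟨hbB, hbS⟩)).trans
    (Finset.single_le_sum (f := fun v => ∑ w ∈ box (M + 1) \ S, conduct lam ω v w * (g v - g w))
      (fun v hv => Finset.sum_nonneg (hnn v hv)) haS)
  linarith

lemma conduct_mul_abs_sub_le (lam : ℝ) (ω : Config) (N : ℕ) (y a b : V) :
    conduct lam ω a b * |pot lam ω N y a - pot lam ω N y b| ≤ 1 := by
  rcases abs_cases (pot lam ω N y a - pot lam ω N y b) with h | h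
  · rw [h.1]; exact conduct_mul_sub_le _ _ _ _ _ _
  · rw [h.1, neg_sub, conduct_comm]; exact conduct_mul_sub_le _ _ _ _ _ _

lemma abs_pot_sub_le {lam : ℝ} {ω : Config} {a b : V} (h : (openGraph ω).Adj a b) (N : ℕ) (y : V) :
    |pot lam ω N y a - pot lam ω N y b| ≤ Real.exp (-(lam * ((a.1 : ℝ) + b.1))) := by
  have := conduct_mul_abs_sub_le lam ω N y a b
  rw [conduct_of_adj h] at this
  rw [Real.exp_neg, ← one_div, le_div_iff₀ (Real.exp_pos _), mul_comm]
  exact this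

/-- The vertex `u` is joined to `+∞` within the columns `≥ i`. -/
def ToInfty (ω : Config) (i : ℤ) (u : V) : Prop :=
  ∀ M : ℤ, ∃ w : V, M ≤ w.1 ∧ (rightGraph ω i).Reachable u w

/-- A bound for the resistance to `+∞` from column `0`. -/
def resBound (lam : ℝ) : ℝ := 2 * Real.exp lam / (1 - Real.exp (-(2 * lam)))

lemma exp_neg_two_mul_lt_one {lam : ℝ} (hl : 0 < lam) : Real.exp (-(2 * lam)) < 1 :=
  Real.exp_lt_one_iff.2 (by linarith)

lemma resBound_pos {lam : ℝ} (hl : 0 < lam) : 0 < resBound lam := by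
  have := exp_neg_two_mul_lt_one hl
  unfold resBound
  have : 0 < 1 - Real.exp (-(2 * lam)) := by linarith
  positivity

/-- Each column holds two vertices, so the sum is dominated by twice a geometric series. It bounds
the resistance of a self-avoiding path, whose length plays no role. -/
lemma sum_columns_le {lam : ℝ} (hl : 0 < lam) {i : ℤ} {S : Finset V} (hS : ∀ v ∈ S, i ≤ v.1) :
    ∑ v ∈ S, Real.exp lam * Real.exp (-(2 * lam * v.1)) ≤
      resBound lam * Real.exp (-(2 * lam * i)) := by
  classical
  set x := Real.exp (-(2 * lam)) with hx
  have hx1 : x < 1 := exp_neg_two_mul_lt_one hl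
  have hx0 : 0 < x := Real.exp_pos _
  obtain ⟨K, hK⟩ : ∃ K : ℕ, ∀ v ∈ S, v.1 < i + K := by
    refine ⟨∑ v ∈ S, ((v.1 - i).toNat + 1), fun v hv => ?_⟩
    have := Finset.single_le_sum (f := fun v : V => (v.1 - i).toNat + 1)
      (fun _ _ => Nat.zero_le _) hv
    have h2 := hS v hv
    zify at this
    push_cast at *
    omega
  let φ : ℕ × Fin 2 → V := fun n => (i + n.1, n.2)
  have hφ : Function.Injective φ := by
    rintro ⟨a, b⟩ ⟨c, d⟩ h
    simp only [φ, Prod.mk.injEq] at h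
    ext
    · simp; omega
    · simp [h.2]
  have hsub : S ⊆ (Finset.range K ×ˢ Finset.univ).image φ := by
    intro v hv
    refine Finset.mem_image.2 ⟨((v.1 - i).toNat, v.2), ?_, ?_⟩
    · have h1 := hS v hv
      have h2 := hK v hv
      simp only [Finset.mem_product, Finset.mem_range, Finset.mem_univ, and_true]
      omega
    · have h1 := hS v hv
      refine Prod.ext ?_ rfl
      simp only [φ]
      omega
  have hterm : ∀ n : ℕ × Fin 2, Real.exp lam * Real.exp (-(2 * lam * (φ n).1)) =
      Real.exp lam * Real.exp (-(2 * lam * i)) * x ^ n.1 := by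
    intro n
    rw [hx, ← Real.exp_nat_mul, ← Real.exp_add, ← Real.exp_add, ← Real.exp_add]
    congr 1
    simp only [φ]
    push_cast
    ring
  calc ∑ v ∈ S, Real.exp lam * Real.exp (-(2 * lam * v.1))
      ≤ ∑ v ∈ (Finset.range K ×ˢ Finset.univ).image φ,
        Real.exp lam * Real.exp (-(2 * lam * v.1)) :=
        Finset.sum_le_sum_of_subset_of_nonneg hsub fun _ _ _ => by positivity
    _ = ∑ n ∈ Finset.range K ×ˢ (Finset.univ : Finset (Fin 2)),
        Real.exp lam * Real.exp (-(2 * lam * i)) * x ^ n.1 := by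
        rw [Finset.sum_image fun _ _ _ _ h => hφ h]
        exact Finset.sum_congr rfl fun n _ => hterm n
    _ = 2 * (Real.exp lam * Real.exp (-(2 * lam * i))) * ∑ n ∈ Finset.range K, x ^ n := by
        rw [Finset.sum_product, Finset.mul_sum]
        refine Finset.sum_congr rfl fun n _ => ?_
        simp only [Finset.sum_const, Finset.card_univ, Fintype.card_fin, nsmul_eq_mul]
        push_cast
        ring
    _ ≤ 2 * (Real.exp lam * Real.exp (-(2 * lam * i))) * (1 - x)⁻¹ := by
        gcongr
        rw [← tsum_geometric_of_lt_one hx0.le hx1]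
        exact (summable_geometric_of_lt_one hx0.le hx1).sum_le_tsum _ fun _ _ => by positivity
    _ = _ := by rw [resBound, ← hx]; ring

/-- The potential is bounded by the resistance of a path to infinity. -/
lemma pot_le_of_toInfty {lam : ℝ} (hl : 0 < lam) {ω : Config} {i : ℤ} {u : V} (hui : i ≤ u.1)
    (h : ToInfty ω i u) (N : ℕ) (y : V) :
    pot lam ω N y u ≤ resBound lam * Real.exp (-(2 * lam * i)) := by
  classical
  -- End the path beyond the range of N steps from y, where the truncated potential is 0. The
  -- resulting bound does not depend on N.
  obtain ⟨w, hw, hreach⟩ := h (y.1.natAbs + N + 1)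
  have hw0 : pot lam ω N y w = 0 := suppBox_pot lam ω N y w (by
    have := le_abs_self w.1
    push_cast
    push_cast at hw
    omega)
  obtain ⟨p, hp⟩ := hreach.exists_isPath
  -- The resistance of an edge is charged to its first end point; the other one is at most one
  -- column further left, which costs the factor exp(lam).
  have key : ∀ {u w : V} (p : (rightGraph ω i).Walk u w), i ≤ u.1 →
      |pot lam ω N y u - pot lam ω N y w| ≤
        (p.support.map fun v : V => Real.exp lam * Real.exp (-(2 * lam * v.1))).sum ∧
      ∀ v ∈ p.support, i ≤ v.1 := by
    intro u w p
    induction p with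
    | nil => intro hu; constructor <;> simp [hu]; positivity
    | @cons u v w hadj p ih =>
      intro hu
      obtain ⟨ih1, ih2⟩ := ih hadj.2.2
      constructor
      · rw [SimpleGraph.Walk.support_cons, List.map_cons, List.sum_cons]
        refine (abs_sub_le _ (pot lam ω N y v) _).trans (add_le_add ?_ ih1)
        refine (abs_pot_sub_le hadj.1 N y).trans ?_
        rw [← Real.exp_add]
        refine Real.exp_le_exp.2 ?_
        have h1 : (u.1 : ℝ) - 1 ≤ v.1 := by
          have := abs_sub_le_of_mem_nbrs (mem_nbrs_of_adj hadj.1)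
          rw [abs_le] at this
          have h2 : u.1 - 1 ≤ v.1 := by omega
          exact_mod_cast h2
        nlinarith
      · rw [SimpleGraph.Walk.support_cons]
        intro v hv
        rcases List.mem_cons.1 hv with rfl | hv
        · exact hu
        · exact ih2 v hv
  obtain ⟨h1, h2⟩ := key p hui
  rw [hw0, sub_zero, abs_of_nonneg (pot_nonneg _ _ _ _ _)] at h1
  refine h1.trans ?_
  rw [← List.sum_toFinset _ hp.support_nodup]
  exact sum_columns_le hl fun v hv => h2 v (List.mem_toFinset.1 hv)

/-! ### The limiting potential -/

/-- The potential at `v` of a unit current that enters at `y` and flows to infinity. -/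
def green (lam : ℝ) (ω : Config) (y v : V) : ℝ := ⨆ N, pot lam ω N y v

lemma green_comm (lam : ℝ) (ω : Config) (y v : V) : green lam ω y v = green lam ω v y := by
  simp only [green, pot_comm lam ω _ y v]

section Green

variable {lam : ℝ} (hl : 0 < lam) {ω : Config} {i : ℤ} {y : V} (hy : i ≤ y.1) (h : ToInfty ω i y)

include hl hy h

lemma pot_le_of_toInfty' (N : ℕ) (v : V) :
    pot lam ω N y v ≤ resBound lam * Real.exp (-(2 * lam * i)) := by
  rw [pot_comm]
  exact pot_le_of_toInfty hl hy h N v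

lemma tendsto_pot (v : V) : Tendsto (fun N => pot lam ω N y v) atTop (𝓝 (green lam ω y v)) :=
  tendsto_atTop_ciSup (pot_mono lam ω y v)
    ⟨_, by rintro _ ⟨N, rfl⟩; exact pot_le_of_toInfty' hl hy h N v⟩

lemma pot_le_green (N : ℕ) (v : V) : pot lam ω N y v ≤ green lam ω y v :=
  (pot_mono lam ω y v).ge_of_tendsto (tendsto_pot hl hy h v) N

lemma green_le (v : V) : green lam ω y v ≤ resBound lam * Real.exp (-(2 * lam * i)) :=
  ciSup_le fun N => pot_le_of_toInfty' hl hy h N v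

lemma green_nonneg (v : V) : 0 ≤ green lam ω y v :=
  (pot_nonneg lam ω 0 y v).trans (pot_le_green hl hy h 0 v)

/-- Up to a factor, the heat kernel is the increment of the truncated potentials, which converge. -/
lemma tendsto_heat (v : V) : Tendsto (fun N => heat lam ω N y v) atTop (𝓝 0) := by
  have h1 := tendsto_pot hl hy h v
  have h2 := ((h1.comp (tendsto_add_atTop_nat 1)).sub h1).const_mul (revMeasure lam v)
  rw [sub_self, mul_zero] at h2
  refine h2.congr fun N => ?_
  simp only [Function.comp, pot, Finset.sum_range_succ]
  rw [← sub_div, add_sub_cancel_left, mul_div_assoc', ← heat_comm lam ω y v N,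
    mul_div_cancel_left₀ _ (revMeasure_pos lam y).ne']

lemma lap_green (v : V) : lap lam ω (green lam ω y) v = if v = y then 1 else 0 := by
  have h1 : Tendsto (fun N => lap lam ω (pot lam ω N y) v) atTop
      (𝓝 (lap lam ω (green lam ω y) v)) :=
    tendsto_finsetSum _ fun w _ =>
      ((tendsto_pot hl hy h v).sub (tendsto_pot hl hy h w)).const_mul _
  have h2 : Tendsto (fun N => lap lam ω (pot lam ω N y) v) atTop
      (𝓝 ((if v = y then 1 else 0) - 0)) := by
    simp only [lap_pot]
    exact (tendsto_heat hl hy h v).const_sub _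
  rw [tendsto_nhds_unique h1 h2, sub_zero]

lemma inv_revMeasure_le_green : 1 / revMeasure lam y ≤ green lam ω y y := by
  refine le_trans (le_of_eq ?_) (pot_le_green hl hy h 1 y)
  simp [pot, heat]

end Green

/-! ### Unreachable vertices -/

lemma heat_eq_zero {lam : ℝ} {ω : Config} {y v : V} (h : ¬ (openGraph ω).Reachable y v) (n : ℕ) :
    heat lam ω n v y = 0 := by
  induction n generalizing v with
  | zero =>
    have : v ≠ y := by rintro rfl; exact h (SimpleGraph.Reachable.refl _)
    simp [heat, this]
  | succ n ih =>
    simp only [heat]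
    rw [stepOp_eq, ih h, zero_sub, neg_eq_zero]
    refine Finset.sum_eq_zero fun w _ => ?_
    by_cases hw : (openGraph ω).Adj v w
    · rw [ih fun hr => h (hr.trans hw.symm.reachable), sub_self, mul_zero]
    · simp [hop, hw]

lemma pot_eq_zero {lam : ℝ} {ω : Config} {y v : V} (h : ¬ (openGraph ω).Reachable y v) (N : ℕ) :
    pot lam ω N y v = 0 := by
  simp [pot, heat_eq_zero h]

lemma green_eq_zero {lam : ℝ} {ω : Config} {y v : V} (h : ¬ (openGraph ω).Reachable y v) :
    green lam ω y v = 0 := by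
  simp [green, pot_eq_zero h]

/-! ### Dependence of the potential on the bias -/

/-- The tangent inequality at the larger of the two exponentials. Which one is larger depends on the
sign of s, and in the application this separates the edges to the left of column 0 from those to the
right. -/
lemma abs_exp_sub_le {l l' s : ℝ} (hll : l ≤ l') :
    |Real.exp (l * s) - Real.exp (l' * s)| ≤
      (l' - l) * |s| * (if s ≤ 0 then Real.exp (l * s) else Real.exp (l' * s)) := by
  have key : ∀ x y : ℝ, x ≤ y → Real.exp y - Real.exp x ≤ (y - x) * Real.exp y := by
    intro x y _
    have := Real.add_one_le_exp (x - y)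
    have h2 : Real.exp x = Real.exp (x - y) * Real.exp y := by rw [← Real.exp_add]; congr 1; ring
    nlinarith [Real.exp_pos y]
  split_ifs with hs
  · have h1 : l' * s ≤ l * s := by nlinarith
    rw [abs_of_nonneg (sub_nonneg.2 (Real.exp_le_exp.2 h1)), abs_of_nonpos hs]
    refine (key _ _ h1).trans (le_of_eq (by ring))
  · have hs := not_le.1 hs
    have h1 : l * s ≤ l' * s := by nlinarith
    rw [abs_sub_comm, abs_of_nonneg (sub_nonneg.2 (Real.exp_le_exp.2 h1)), abs_of_pos hs]
    refine (key _ _ h1).trans (le_of_eq (by ring))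

/-- A bound for the change of the energy per unit of bias at the vertices of column `a`. -/
def columnBound (l l' : ℝ) (m : ℤ) (R : ℝ) (a : ℤ) : ℝ :=
  (if m ≤ a ∧ a ≤ 0 then (2 * |(m : ℝ)| + 1) * R else 0) +
    if 0 ≤ a then (2 * (a.toNat : ℝ) + 1) * (Real.exp l' * Real.exp (-(2 * l)) ^ a.toNat) else 0

lemma summable_columnBound {l : ℝ} (hl : 0 < l) (l' : ℝ) :
    Summable fun n : ℕ => (2 * (n : ℝ) + 1) * (Real.exp l' * Real.exp (-(2 * l)) ^ n) := by
  have hx1 := exp_neg_two_mul_lt_one hl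
  have hx : ‖Real.exp (-(2 * l))‖ < 1 := by rwa [Real.norm_of_nonneg (Real.exp_pos _).le]
  have h1 := (summable_pow_mul_geometric_of_norm_lt_one 1 hx).mul_left (2 * Real.exp l')
  have h2 := (summable_geometric_of_norm_lt_one hx).mul_left (Real.exp l')
  refine (h1.add h2).congr fun n => ?_
  simp
  ring

lemma sum_box_columnBound_le {l : ℝ} (hl : 0 < l) (l' : ℝ) {m : ℤ} (hm : m ≤ 0) {R : ℝ}
    (hR : 0 ≤ R) (K : ℕ) :
    ∑ v ∈ box K, columnBound l l' m R v.1 ≤ 2 * ((2 * |(m : ℝ)| + 1) * R * (|(m : ℝ)| + 1) +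
      ∑' n : ℕ, (2 * (n : ℝ) + 1) * (Real.exp l' * Real.exp (-(2 * l)) ^ n)) := by
  have e1 : ∑ v ∈ box K, columnBound l l' m R v.1 =
      2 * ∑ a ∈ Finset.Icc (-(K : ℤ)) K, columnBound l l' m R a := by
    rw [box, Finset.sum_product, Finset.mul_sum]
    refine Finset.sum_congr rfl fun a _ => ?_
    simp
  rw [e1]
  refine mul_le_mul_of_nonneg_left ?_ (by norm_num)
  simp only [columnBound, Finset.sum_add_distrib]
  refine add_le_add ?_ ?_
  · rw [← Finset.sum_filter, Finset.sum_const, nsmul_eq_mul, mul_comm]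
    refine mul_le_mul_of_nonneg_left ?_ (by positivity)
    have hsub : (Finset.Icc (-(K : ℤ)) K).filter (fun a => m ≤ a ∧ a ≤ 0) ⊆ Finset.Icc m 0 := by
      intro a ha
      simp only [Finset.mem_filter, Finset.mem_Icc] at *
      exact ha.2
    have := Finset.card_le_card hsub
    rw [Int.card_Icc] at this
    have h2 : ((0 + 1 - m).toNat : ℝ) = |(m : ℝ)| + 1 := by
      have h3 : ((0 + 1 - m).toNat : ℤ) = 1 - m := by omega
      have h4 : ((0 + 1 - m).toNat : ℝ) = 1 - m := by exact_mod_cast h3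
      rw [h4, abs_of_nonpos (by exact_mod_cast hm)]
      ring
    rw [← h2]
    exact_mod_cast this
  · rw [← Finset.sum_filter]
    have hinj : Set.InjOn Int.toNat ((Finset.Icc (-(K : ℤ)) K).filter fun a => 0 ≤ a : Finset ℤ) := by
      intro a ha b hb hab
      simp only [Finset.coe_filter, Set.mem_ofPred_eq] at ha hb
      omega
    rw [← Finset.sum_image
      (f := fun n : ℕ => (2 * (n : ℝ) + 1) * (Real.exp l' * Real.exp (-(2 * l)) ^ n)) hinj]
    exact (summable_columnBound hl l').sum_le_tsum _ fun _ _ => by positivity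

section Lipschitz

variable {ω : Config} {l l' : ℝ} (hl : 0 < l) (hll : l ≤ l') {m L : ℤ} {y u : V}
  (hm : m ≤ 0) (hym : m ≤ y.1) (hy : ToInfty ω m y)
  (huL : L ≤ u.1) (hu : ToInfty ω L u) (hreach : ∀ v, (openGraph ω).Reachable y v → m ≤ v.1)

include hl hll huL hu hreach

/-- For x(v) + x(w) ≤ 0, the current of the first potential is at most 1 and the second potential is
at most its resistance bound; reachability from y confines such edges to the columns from m on. To
the right, the current of the second potential is at most 1 and the gradient of the first is at most
the exponentially small inverse conductance. -/
lemma abs_energy_term_le (N M : ℕ) (v w : V) :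
    |(conduct l ω v w - conduct l' ω v w) *
      ((pot l' ω M u v - pot l' ω M u w) * (pot l ω N y v - pot l ω N y w))| ≤
      if w ∈ nbrs v then
        (l' - l) * columnBound l l' m (resBound l' * Real.exp (-(2 * l' * L))) v.1 else 0 := by
  have hl' : 0 < l' := hl.trans_le hll
  set R := resBound l' * Real.exp (-(2 * l' * L)) with hR
  have hR0 : 0 ≤ R := mul_nonneg (resBound_pos hl').le (Real.exp_pos _).le
  have hcol0 : ∀ a : ℤ, 0 ≤ columnBound l l' m R a := fun a => by
    unfold columnBound
    refine add_nonneg ?_ ?_ <;> split_ifs <;> positivity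
  have hrhs : 0 ≤ if w ∈ nbrs v then (l' - l) * columnBound l l' m R v.1 else 0 := by
    split_ifs
    · exact mul_nonneg (by linarith) (hcol0 _)
    · exact le_rfl
  by_cases hadj : (openGraph ω).Adj v w
  swap
  · simpa [conduct_of_not_adj hadj] using hrhs
  by_cases hv : (openGraph ω).Reachable y v
  swap
  · rw [pot_eq_zero hv, pot_eq_zero fun h => hv (h.trans hadj.symm.reachable)]
    simpa using hrhs
  have hvm := hreach v hv
  rw [if_pos (mem_nbrs_of_adj hadj), conduct_of_adj hadj, conduct_of_adj hadj, abs_mul, abs_mul]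
  have hd1 := conduct_mul_abs_sub_le l ω N y v w
  have hd2 := conduct_mul_abs_sub_le l' ω M u v w
  rw [conduct_of_adj hadj] at hd1 hd2
  have hd3 := abs_pot_sub_le (lam := l) hadj N y
  have hd4 : |pot l' ω M u v - pot l' ω M u w| ≤ R := by
    rw [abs_le]
    have h1 := pot_le_of_toInfty' hl' huL hu M v
    have h2 := pot_le_of_toInfty' hl' huL hu M w
    have h3 := pot_nonneg l' ω M u v
    have h4 := pot_nonneg l' ω M u w
    constructor <;> linarith
  have hexp := abs_exp_sub_le (s := (v.1 : ℝ) + w.1) hll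
  set A := |pot l' ω M u v - pot l' ω M u w|
  set B := |pot l ω N y v - pot l ω N y w|
  have hA : 0 ≤ A := abs_nonneg _
  have hB : 0 ≤ B := abs_nonneg _
  have hnb := abs_sub_le_of_mem_nbrs (mem_nbrs_of_adj hadj)
  rw [abs_le] at hnb
  have hΔ : 0 ≤ l' - l := by linarith
  refine (mul_le_mul_of_nonneg_right hexp (by positivity)).trans ?_
  have hwv : (w.1 : ℝ) ≤ v.1 + 1 := by
    have : w.1 ≤ v.1 + 1 := by omega
    exact_mod_cast this
  have hvw : (v.1 : ℝ) - 1 ≤ w.1 := by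
    have : v.1 - 1 ≤ w.1 := by omega
    exact_mod_cast this
  rw [mul_assoc, mul_assoc]
  refine mul_le_mul_of_nonneg_left ?_ hΔ
  rcases le_or_gt ((v.1 : ℝ) + w.1) 0 with hs | hs
  · rw [if_pos hs]
    have hv0 : v.1 ≤ 0 := by
      have : v.1 + w.1 ≤ 0 := by exact_mod_cast hs
      omega
    have hvR : (v.1 : ℝ) ≤ 0 := by exact_mod_cast hv0
    have hmR : (m : ℝ) ≤ v.1 := by exact_mod_cast hvm
    have hs' : |(v.1 : ℝ) + w.1| ≤ 2 * |(m : ℝ)| + 1 := by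
      rw [abs_of_nonpos hs, abs_of_nonpos (hmR.trans hvR)]
      linarith
    have h1 : (2 * |(m : ℝ)| + 1) * R ≤ columnBound l l' m R v.1 := by
      unfold columnBound
      rw [if_pos ⟨hvm, hv0⟩]
      refine le_add_of_nonneg_right ?_
      split_ifs <;> positivity
    refine le_trans ?_ h1
    refine mul_le_mul hs' ?_ (by positivity) (by positivity)
    calc _ = A * (Real.exp (l * (↑v.1 + ↑w.1)) * B) := by ring
      _ ≤ R * 1 := mul_le_mul hd4 hd1 (by positivity) hR0
      _ = R := mul_one R
  · rw [if_neg (not_le.2 hs)]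
    have hv0 : 0 ≤ v.1 := by
      have : 0 < v.1 + w.1 := by exact_mod_cast hs
      omega
    have hnat : ((v.1.toNat : ℕ) : ℝ) = v.1 := by
      have : ((v.1.toNat : ℕ) : ℤ) = v.1 := Int.toNat_of_nonneg hv0
      exact_mod_cast this
    have h1 : (2 * (v.1 : ℝ) + 1) * (Real.exp l' * Real.exp (-(2 * l)) ^ v.1.toNat) ≤
        columnBound l l' m R v.1 := by
      unfold columnBound
      rw [if_pos hv0, hnat]
      refine le_add_of_nonneg_left ?_
      split_ifs <;> positivity
    refine le_trans ?_ h1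
    rw [abs_of_pos hs]
    refine mul_le_mul (by linarith) ?_ (by positivity) (by linarith)
    calc _ = (Real.exp (l' * (↑v.1 + ↑w.1)) * A) * B := by ring
      _ ≤ 1 * Real.exp (-(l * ((v.1 : ℝ) + w.1))) := mul_le_mul hd2 hd3 (by positivity) (by norm_num)
      _ ≤ _ := by
        rw [one_mul, ← Real.exp_nat_mul, ← Real.exp_add, hnat]
        refine Real.exp_le_exp.2 ?_
        nlinarith

include hm

lemma abs_energy_le (N M K : ℕ) :
    |(∑ v ∈ box K, ∑ w ∈ box K, (conduct l ω v w - conduct l' ω v w) *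
      ((pot l' ω M u v - pot l' ω M u w) * (pot l ω N y v - pot l ω N y w))) / 2| ≤
      (l' - l) * (3 * ((2 * |(m : ℝ)| + 1) * (resBound l' * Real.exp (-(2 * l' * L))) *
        (|(m : ℝ)| + 1) +
      ∑' n : ℕ, (2 * (n : ℝ) + 1) * (Real.exp l' * Real.exp (-(2 * l)) ^ n))) := by
  have hl' : 0 < l' := hl.trans_le hll
  set R := resBound l' * Real.exp (-(2 * l' * L)) with hR
  have hR0 : 0 ≤ R := mul_nonneg (resBound_pos hl').le (Real.exp_pos _).le
  have hΔ : 0 ≤ l' - l := by linarith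
  have hcol0 : ∀ a : ℤ, 0 ≤ columnBound l l' m R a := fun a => by
    unfold columnBound
    refine add_nonneg ?_ ?_ <;> split_ifs <;> positivity
  rw [abs_div, abs_two, div_le_iff₀ two_pos]
  calc |∑ v ∈ box K, ∑ w ∈ box K, (conduct l ω v w - conduct l' ω v w) *
      ((pot l' ω M u v - pot l' ω M u w) * (pot l ω N y v - pot l ω N y w))|
      ≤ ∑ v ∈ box K, ∑ w ∈ box K, if w ∈ nbrs v then (l' - l) * columnBound l l' m R v.1 else 0 :=
        (Finset.abs_sum_le_sum_abs _ _).trans (Finset.sum_le_sum fun v _ =>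
          (Finset.abs_sum_le_sum_abs _ _).trans (Finset.sum_le_sum fun w _ =>
            abs_energy_term_le hl hll huL hu hreach N M v w))
    _ ≤ ∑ v ∈ box K, 3 * ((l' - l) * columnBound l l' m R v.1) := by
        refine Finset.sum_le_sum fun v _ => ?_
        rw [← Finset.sum_filter, Finset.sum_const, nsmul_eq_mul]
        refine mul_le_mul_of_nonneg_right ?_ (mul_nonneg hΔ (hcol0 _))
        have h1 : (box K).filter (fun w => w ∈ nbrs v) ⊆ nbrs v := fun w hw =>
          (Finset.mem_filter.1 hw).2
        have h2 : (nbrs v).card ≤ 3 := Finset.card_le_three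
        exact_mod_cast (Finset.card_le_card h1).trans h2
    _ = 3 * (l' - l) * ∑ v ∈ box K, columnBound l l' m R v.1 := by
        rw [Finset.mul_sum]
        exact Finset.sum_congr rfl fun v _ => by ring
    _ ≤ 3 * (l' - l) * (2 * ((2 * |(m : ℝ)| + 1) * R * (|(m : ℝ)| + 1) +
      ∑' n : ℕ, (2 * (n : ℝ) + 1) * (Real.exp l' * Real.exp (-(2 * l)) ^ n))) :=
        mul_le_mul_of_nonneg_left (sum_box_columnBound_le hl l' hm hR0 K) (by positivity)
    _ = _ := by ring

include hym hy

/-- The potential is Lipschitz continuous in the bias. -/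
lemma abs_green_sub_le : |green l' ω y u - green l ω y u| ≤
      (l' - l) * (3 * ((2 * |(m : ℝ)| + 1) * (resBound l' * Real.exp (-(2 * l' * L))) *
        (|(m : ℝ)| + 1) +
      ∑' n : ℕ, (2 * (n : ℝ) + 1) * (Real.exp l' * Real.exp (-(2 * l)) ^ n))) := by
  have hl' : 0 < l' := hl.trans_le hll
  set Bd := (l' - l) * (3 * ((2 * |(m : ℝ)| + 1) * (resBound l' * Real.exp (-(2 * l' * L))) *
        (|(m : ℝ)| + 1) +
      ∑' n : ℕ, (2 * (n : ℝ) + 1) * (Real.exp l' * Real.exp (-(2 * l)) ^ n))) with hBd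
  have hheat0 : ∀ (lam : ℝ) (ω : Config) (N : ℕ) (y : V) (f : V → ℝ) (K : ℕ), (∀ v, 0 ≤ f v) →
      0 ≤ ∑ v ∈ box K, f v * heat lam ω N y v := fun lam ω N y f K hf =>
    Finset.sum_nonneg fun v _ => mul_nonneg (hf v) (heat_nonneg _ _ _ _ _)
  have hsum : ∀ (lam : ℝ) (N : ℕ) (y : V) (f : V → ℝ) (K : ℕ), y ∈ box (K + 1) →
      ∑ v ∈ box (K + 1), f v * lap lam ω (pot lam ω N y) v =
        f y - ∑ v ∈ box (K + 1), f v * heat lam ω N y v := by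
    intro lam N y f K hyK
    simp only [lap_pot, mul_sub, Finset.sum_sub_distrib, mul_ite, mul_one, mul_zero]
    rw [Finset.sum_ite_eq', if_pos hyK]
  -- The truncated resolvent identity: test the equation of each potential against the other one and
  -- subtract. What remains is the mixed energy weighted by the difference of conductances, plus two
  -- heat terms.
  have hbase : ∀ N M K : ℕ, y.1.natAbs + u.1.natAbs + N + M ≤ K →
      |pot l' ω M u y - pot l ω N y u - ∑ v ∈ box (K + 1), pot l' ω M u v * heat l ω N y v +
        ∑ v ∈ box (K + 1), pot l ω N y v * heat l' ω M u v| ≤ Bd := by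
    intro N M K hK
    have hyK : y ∈ box (K + 1) := by rw [mem_box, Int.abs_eq_natAbs]; omega
    have huK : u ∈ box (K + 1) := by rw [mem_box, Int.abs_eq_natAbs]; omega
    have e1 := hsum l N y (pot l' ω M u) K hyK
    have e2 := hsum l' M u (pot l ω N y) K huK
    rw [sum_mul_lap ((suppBox_pot l' ω M u).mono (by omega))] at e1
    rw [sum_mul_lap ((suppBox_pot l ω N y).mono (by omega))] at e2
    have := abs_energy_le hl hll hm huL hu hreach N M (K + 1)
    refine le_trans (le_of_eq (congrArg _ ?_)) this
    have e3 : (∑ v ∈ box (K + 1), ∑ w ∈ box (K + 1), (conduct l ω v w - conduct l' ω v w) *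
      ((pot l' ω M u v - pot l' ω M u w) * (pot l ω N y v - pot l ω N y w))) / 2 =
      (∑ v ∈ box (K + 1), ∑ w ∈ box (K + 1), conduct l ω v w *
        ((pot l' ω M u v - pot l' ω M u w) * (pot l ω N y v - pot l ω N y w))) / 2 -
      (∑ v ∈ box (K + 1), ∑ w ∈ box (K + 1), conduct l' ω v w *
        ((pot l ω N y v - pot l ω N y w) * (pot l' ω M u v - pot l' ω M u w))) / 2 := by
      rw [← sub_div, ← Finset.sum_sub_distrib]
      congr 1
      refine Finset.sum_congr rfl fun v _ => ?_
      rw [← Finset.sum_sub_distrib]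
      exact Finset.sum_congr rfl fun w _ => by ring
    rw [e3, e1, e2]
    ring
  -- A heat term lives on the support of the other potential, a finite set independent of N, so
  -- pointwise decay is enough.
  have hvanish : ∀ (lam lam' : ℝ) (z z' : V) (M : ℕ), (∀ v, Tendsto (fun N => heat lam ω N z v)
      atTop (𝓝 0)) → ∀ K : ℕ → ℕ, (∀ N, z'.1.natAbs + M ≤ K N) →
      Tendsto (fun N => ∑ v ∈ box (K N + 1), pot lam' ω M z' v * heat lam ω N z v)
        atTop (𝓝 0) := by
    intro lam lam' z z' M hz K hK
    have : ∀ N, ∑ v ∈ box (K N + 1), pot lam' ω M z' v * heat lam ω N z v =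
        ∑ v ∈ box (z'.1.natAbs + M), pot lam' ω M z' v * heat lam ω N z v := by
      intro N
      symm
      refine Finset.sum_subset ?_ ?_
      · intro v hv
        have := hK N
        rw [mem_box, Int.abs_eq_natAbs] at *
        omega
      · intro v _ hv
        rw [suppBox_pot lam' ω M z' v (by rw [mem_box] at hv; omega), zero_mul]
    simp only [this]
    have h0 : (0 : ℝ) = ∑ v ∈ box (z'.1.natAbs + M), pot lam' ω M z' v * 0 := by simp
    rw [h0]
    exact tendsto_finsetSum _ fun v _ => (hz v).const_mul _
  rw [abs_sub_le_iff]
  constructor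
  -- Let N tend to infinity first: one heat term vanishes and the other is dropped because of its
  -- sign; then let M tend to infinity. The opposite bound takes the limits in the other order.
  · have h1 : ∀ M, pot l' ω M u y - green l ω y u ≤ Bd := by
      intro M
      have hv := hvanish l l' y u M (tendsto_heat hl hym hy)
        (fun N => y.1.natAbs + u.1.natAbs + N + M) (fun N => by omega)
      have ht := ((tendsto_pot hl hym hy u).const_sub (pot l' ω M u y)).sub hv
      rw [sub_zero] at ht
      refine le_of_tendsto ht (Eventually.of_forall fun N => ?_)
      have h2 := (abs_le.1 (hbase N M _ le_rfl)).2
      have h3 := hheat0 l' ω M u (pot l ω N y) (y.1.natAbs + u.1.natAbs + N + M + 1)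
        (pot_nonneg l ω N y)
      linarith
    rw [green_comm l']
    exact le_of_tendsto ((tendsto_pot hl' huL hu y).sub_const _) (Eventually.of_forall h1)
  · have h1 : ∀ N, pot l ω N y u - green l' ω u y ≤ Bd := by
      intro N
      have hv := hvanish l' l u y N (tendsto_heat hl' huL hu)
        (fun M => y.1.natAbs + u.1.natAbs + N + M) (fun M => by omega)
      have ht := ((tendsto_pot hl' huL hu y).const_sub (pot l ω N y u)).sub hv
      rw [sub_zero] at ht
      refine le_of_tendsto ht (Eventually.of_forall fun M => ?_)
      have h2 := (abs_le.1 (hbase N M _ le_rfl)).1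
      have h3 := hheat0 l ω N y (pot l' ω M u) (y.1.natAbs + u.1.natAbs + N + M + 1)
        (pot_nonneg l' ω M u)
      linarith
    rw [green_comm l']
    exact le_of_tendsto ((tendsto_pot hl hym hy u).sub_const _) (Eventually.of_forall h1)

end Lipschitz

/-! ### The network to the right of a cut -/

/-- The configuration in which all edges that are not within the columns `≥ m` are closed. -/
def cutOff (m : ℤ) (ω : Config) : Config := fun e => ω e && decide (2 * m ≤ pos e)

lemma openGraph_cutOff (m : ℤ) (ω : Config) : openGraph (cutOff m ω) = rightGraph ω m := by
  ext v w
  have hpos : ∀ h : s(v, w) ∈ ladder.edgeSet, pos ⟨s(v, w), h⟩ = v.1 + w.1 := fun h => rfl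
  constructor
  · rintro ⟨h, hω⟩
    simp only [cutOff, Bool.and_eq_true, decide_eq_true_eq, hpos] at hω
    have := abs_sub_le_of_mem_nbrs ((mem_nbrs v w).2 ((SimpleGraph.mem_edgeSet _).1 h))
    rw [abs_le] at this
    exact ⟨⟨h, hω.1⟩, by omega, by omega⟩
  · rintro ⟨⟨h, hω⟩, h1, h2⟩
    refine ⟨h, ?_⟩
    simp only [cutOff, Bool.and_eq_true, decide_eq_true_eq, hpos]
    exact ⟨hω, by omega⟩

lemma rightGraph_cutOff {m i : ℤ} (h : m ≤ i) (ω : Config) :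
    rightGraph (cutOff m ω) i = rightGraph ω i := by
  ext v w
  simp only [rightGraph, openGraph_cutOff]
  constructor
  · rintro ⟨⟨h1, _⟩, h2⟩
    exact ⟨h1, h2⟩
  · rintro ⟨h1, h2, h3⟩
    exact ⟨⟨h1, by omega, by omega⟩, h2, h3⟩

lemma toInfty_cutOff {m i : ℤ} (h : m ≤ i) {ω : Config} {u : V} :
    ToInfty (cutOff m ω) i u ↔ ToInfty ω i u := by
  simp only [ToInfty, rightGraph_cutOff h]

lemma ToInfty.trans {ω : Config} {i : ℤ} {u v : V} (hu : ToInfty ω i u)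
    (h : (rightGraph ω i).Reachable v u) : ToInfty ω i v := fun M =>
  let ⟨w, hw, hr⟩ := hu M
  ⟨w, hw, h.trans hr⟩

/-- In every column the bi-infinite path enters for good through some horizontal edge. -/
lemma exists_toInfty {ω : Config} (hω : ω ∈ biInfinite) (i : ℤ) :
    ∃ j, ω (hEdge i j) = true ∧ ToInfty ω i (i, j) := by
  have h : ∀ M : ℕ, ∃ j, ω (hEdge i j) = true ∧
      ∃ w : V, (M : ℤ) ≤ w.1 ∧ (rightGraph ω i).Reachable (i, j) w := by
    intro M
    simp only [biInfinite, Set.mem_iInter] at hω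
    obtain ⟨v, w, hv, hw, hr⟩ := hω (i.natAbs + 1) (i.natAbs + M)
    rcases rightGraph_enter (a := i) hr (by omega) with ⟨h1, _⟩ | ⟨j, h1, h2⟩
    · omega
    · exact ⟨j, h1, w, by omega, h2⟩
  by_contra hcon
  push Not at hcon
  have : ∀ j, ω (hEdge i j) = true → ∃ M : ℕ, ∀ w : V, (M : ℤ) ≤ w.1 →
      ¬ (rightGraph ω i).Reachable (i, j) w := by
    intro j hj
    have := hcon j hj
    simp only [ToInfty, not_forall, not_exists, not_and] at this
    obtain ⟨M, hM⟩ := this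
    exact ⟨M.toNat, fun w hw => hM w (by omega)⟩
  choose! M hM using this
  obtain ⟨j, hj, w, hw, hr⟩ := h (∑ j, M j)
  have hle := Finset.single_le_sum (f := M) (fun _ _ => Nat.zero_le _) (Finset.mem_univ j)
  refine hM j hj w (le_trans ?_ hw) hr
  exact_mod_cast hle

lemma toInfty_of_isCut {ω : Config} (hω : ω ∈ biInfinite) {m : ℤ} (hm : IsCut ω m) :
    ToInfty ω m (m, 0) := by
  obtain ⟨j, hj, h⟩ := exists_toInfty hω m
  rcases fin_two_cases j with rfl | rfl
  · exact h
  · rw [hm.2] at hj; simp at hj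

/-- A column that is not plain has no dead ends to the left of it that matter: vertices to the
right of it are joined to infinity without crossing it. -/
lemma toInfty_of_not_isPlain {ω : Config} (hω : ω ∈ biInfinite) {m i : ℤ} (hm : IsCut ω m)
    (hmi : m ≤ i) {u : V} (hiu : i ≤ u.1) (hi : ¬ IsPlain ω i)
    (h : (rightGraph ω m).Reachable (m, 0) u) : ToInfty ω i u := by
  rcases hmi.eq_or_lt with rfl | hmi
  · exact (toInfty_of_isCut hω hm).trans h.symm
  rcases rightGraph_enter (a := i) (h.mono (rightGraph_le ω m)) hiu with ⟨h1, _⟩ | ⟨j, hj, hr⟩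
  · exact absurd h1 (not_le.2 hmi)
  obtain ⟨j', hj', hinf⟩ := exists_toInfty hω i
  by_cases hjj : j = j'
  · exact hinf.trans (hjj ▸ hr.symm)
  -- The path and the bi-infinite path enter column i in different rows, so both horizontal edges
  -- are open; were the vertical edge closed, the column would be plain.
  · have hrung : ω (rEdge i) = true := by
      by_contra hcon
      refine hi ?_
      have hr' : ω (rEdge i) = false := by simpa using hcon
      rcases fin_two_cases j with rfl | rfl <;> rcases fin_two_cases j' with rfl | rfl
      · exact absurd rfl hjj
      · exact ⟨hj, hj', hr'⟩
      · exact ⟨hj', hj, hr'⟩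
      · exact absurd rfl hjj
    have hadj : (rightGraph ω i).Adj (i, j) (i, j') := ⟨openGraph_adj_rung' hrung hjj, le_rfl, le_rfl⟩
    exact hinf.trans (hr.symm.trans hadj.reachable)

/-- A vertex to the right of a cut in an infinite cluster is joined to `+∞` to the right of it. -/
lemma toInfty_of_infinite {ω : Config} (hω : ω ∈ biInfinite) {m : ℤ} (hm : IsCut ω m) {u : V}
    (hu : m ≤ u.1) (hinf : (cluster ω u).Infinite) : ToInfty ω m u := by
  by_cases h : (rightGraph ω m).Reachable (m, 0) u
  · exact (toInfty_of_isCut hω hm).trans h.symm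
  -- The cut can be entered only at (m, 0). A cluster that avoids this vertex on the right stays to
  -- the right of the cut, so its being infinite forces it out to +∞.
  have key : ∀ w ∈ cluster ω u, m ≤ w.1 ∧ (rightGraph ω m).Reachable w u := by
    intro w hw
    rcases rightGraph_enter (SimpleGraph.Reachable.symm hw) hu with h1 | ⟨j, hj, hr⟩
    · exact h1
    · rcases fin_two_cases j with rfl | rfl
      · exact absurd hr h
      · rw [hm.2] at hj; simp at hj
  intro M
  by_contra hcon
  push Not at hcon
  refine hinf (Set.Finite.subset ((Set.finite_Icc m M).prod (Set.finite_univ (α := Fin 2))) ?_)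
  intro w hw
  obtain ⟨h1, h2⟩ := key w hw
  refine ⟨⟨h1, ?_⟩, trivial⟩
  by_contra hcon'
  exact hcon w (le_of_lt (not_le.1 hcon')) h2.symm

/-! ### The nearest cut -/

/-- The distance from column `0` to the nearest cut on the left. -/
def cutDist (ω : Config) : ℕ := sInf {d : ℕ | IsCut ω (-d)}

/-- The number of consecutive plain columns `0, -1, -2, …`. -/
def plainLen (ω : Config) : ℕ := sInf {n : ℕ | ¬ IsPlain ω (-n)}

/-- There is a bi-infinite open path, and a cut to the left of column `1`. -/
def IsGood (ω : Config) : Prop := ω ∈ biInfinite ∧ ∃ d : ℕ, IsCut ω (-d)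

/-- The network to the right of the nearest cut. -/
def rightNet (ω : Config) : Config := cutOff (-(cutDist ω : ℤ)) ω

/-- The vertex through which the network to the right of the nearest cut is entered. -/
def entry (ω : Config) : V := (-(cutDist ω : ℤ), 0)

/-- The sum of the potentials in column `0` of the network to the right of the nearest cut. -/
def colGreen (lam : ℝ) (ω : Config) : ℝ := ∑ j, green lam (rightNet ω) (entry ω) (0, j)

lemma le_of_reachable_entry {ω : Config} {v : V} (h : (openGraph (rightNet ω)).Reachable (entry ω) v) :
    -(cutDist ω : ℤ) ≤ v.1 := by
  rw [rightNet, openGraph_cutOff] at h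
  obtain ⟨p⟩ := h.symm
  cases p with
  | nil => exact le_rfl
  | cons hadj _ => exact hadj.2.1

section Good

variable {ω : Config} (hω : IsGood ω)

include hω

/-- `IsGood` guarantees that the infimum is attained and is not the default value 0 of an empty set.
-/
lemma IsGood.isCut : IsCut ω (-(cutDist ω : ℤ)) := Nat.sInf_mem (s := {d : ℕ | IsCut ω (-d)}) hω.2

lemma IsGood.not_isPlain_cutDist : ¬ IsPlain ω (-(cutDist ω : ℤ)) := fun h => by
  have := hω.isCut.2
  rw [h.2.1] at this
  simp at this

lemma IsGood.not_isPlain : ¬ IsPlain ω (-(plainLen ω : ℤ)) :=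
  Nat.sInf_mem (s := {n : ℕ | ¬ IsPlain ω (-n)}) ⟨_, hω.not_isPlain_cutDist⟩

lemma IsGood.plainLen_le : plainLen ω ≤ cutDist ω := Nat.sInf_le hω.not_isPlain_cutDist

lemma IsGood.toInfty_entry : ToInfty (rightNet ω) (-(cutDist ω : ℤ)) (entry ω) :=
  (toInfty_cutOff le_rfl).2 (toInfty_of_isCut hω.1 hω.isCut)

/-- A vertex of column 0 has to back out only to the first column on the left that is not plain.
This is what makes the length of the dead end, and not the distance to the cut, appear in the
exponential bounds. -/
lemma IsGood.toInfty {u : V} (hu : u.1 = 0) (h : (openGraph (rightNet ω)).Reachable (entry ω) u) :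
    ToInfty (rightNet ω) (-(plainLen ω : ℤ)) u := by
  have h1 := hω.plainLen_le
  rw [rightNet, openGraph_cutOff] at h
  exact (toInfty_cutOff (by omega)).2
    (toInfty_of_not_isPlain hω.1 hω.isCut (by omega) (by omega) hω.not_isPlain h)

/-- By symmetry of the Green function the resistance from (0, j) to +∞ may be used in place of that
from the entry. If (0, j) is not reachable, the potential is 0. -/
lemma IsGood.green_le {lam : ℝ} (hl : 0 < lam) (j : Fin 2) :
    green lam (rightNet ω) (entry ω) (0, j) ≤
      resBound lam * Real.exp (2 * lam * plainLen ω) := by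
  by_cases h : (openGraph (rightNet ω)).Reachable (entry ω) (0, j)
  · rw [green_comm]
    have := LadderWalk.green_le hl (by simp) (hω.toInfty rfl h) (entry ω)
    simpa using this
  · rw [green_eq_zero h]
    have := resBound_pos hl
    positivity

lemma IsGood.green_nonneg {lam : ℝ} (hl : 0 < lam) (u : V) :
    0 ≤ green lam (rightNet ω) (entry ω) u :=
  LadderWalk.green_nonneg hl le_rfl hω.toInfty_entry u

lemma IsGood.colGreen_nonneg {lam : ℝ} (hl : 0 < lam) : 0 ≤ colGreen lam ω :=
  Finset.sum_nonneg fun _ _ => hω.green_nonneg hl _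

lemma IsGood.colGreen_le {lam : ℝ} (hl : 0 < lam) :
    colGreen lam ω ≤ 2 * (resBound lam * Real.exp (2 * lam * plainLen ω)) := by
  unfold colGreen
  rw [Fin.sum_univ_two, two_mul]
  exact add_le_add (hω.green_le hl 0) (hω.green_le hl 1)

/-- The network extends to the cut, which gives the polynomial factor, whereas the resistance from
column 0 involves only `plainLen`. The constant 6 is 3 for each of the two rows. -/
lemma IsGood.abs_colGreen_sub_le {l l' : ℝ} (hl : 0 < l) (hll : l ≤ l') :
    |colGreen l' ω - colGreen l ω| ≤ (l' - l) * (6 * ((2 * (cutDist ω : ℝ) + 1) *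
      (resBound l' * Real.exp (2 * l' * plainLen ω)) * (cutDist ω + 1) +
        ∑' n : ℕ, (2 * (n : ℝ) + 1) * (Real.exp l' * Real.exp (-(2 * l)) ^ n))) := by
  have hpos := resBound_pos (hl.trans_le hll)
  have hj : ∀ j, |green l' (rightNet ω) (entry ω) (0, j) - green l (rightNet ω) (entry ω) (0, j)| ≤
      (l' - l) * (3 * ((2 * (cutDist ω : ℝ) + 1) *
      (resBound l' * Real.exp (2 * l' * plainLen ω)) * (cutDist ω + 1) +
        ∑' n : ℕ, (2 * (n : ℝ) + 1) * (Real.exp l' * Real.exp (-(2 * l)) ^ n))) := by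
    intro j
    by_cases h : (openGraph (rightNet ω)).Reachable (entry ω) (0, j)
    · have := abs_green_sub_le hl hll (m := -(cutDist ω : ℤ)) (by omega) le_rfl hω.toInfty_entry
        (by simp) (hω.toInfty rfl h) fun v hv => le_of_reachable_entry hv
      simpa using this
    · rw [green_eq_zero h, green_eq_zero h, sub_self, abs_zero]
      have h1 : 0 ≤ l' - l := by linarith
      have h2 : 0 ≤ ∑' n : ℕ, (2 * (n : ℝ) + 1) * (Real.exp l' * Real.exp (-(2 * l)) ^ n) :=
        tsum_nonneg fun n => by positivity
      positivity
  unfold colGreen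
  rw [Fin.sum_univ_two, Fin.sum_univ_two]
  calc _ = |(green l' (rightNet ω) (entry ω) (0, 0) - green l (rightNet ω) (entry ω) (0, 0)) +
        (green l' (rightNet ω) (entry ω) (0, 1) - green l (rightNet ω) (entry ω) (0, 1))| := by
        congr 1; ring
    _ ≤ _ := abs_add_le _ _
    _ ≤ _ := add_le_add (hj 0) (hj 1)
    _ = _ := by ring

end Good

/-! ### Dead ends -/

lemma IsCut.not_isPlain {ω : Config} {i : ℤ} (h : IsCut ω i) : ¬ IsPlain ω i := fun h' => by
  have := h.2
  rw [h'.2.1] at this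
  simp at this

/-- Plain columns are not cuts, so the mouth of the trap is the nearest cut. In particular the trap
events are disjoint for different lengths. -/
lemma cutDist_of_trapEvent {ω : Config} {n : ℕ} (h : ω ∈ trapEvent n) : cutDist ω = n := by
  obtain ⟨⟨⟨h1, _⟩, h2⟩, _⟩ := h
  refine le_antisymm (Nat.sInf_le h1) (le_csInf ⟨n, h1⟩ fun d hd => ?_)
  by_contra hcon
  have hdn : d < n := not_le.1 hcon
  exact IsCut.not_isPlain hd (h2 (-d) (by omega) (by omega))

lemma lap_three (lam : ℝ) (ω : Config) (f : V → ℝ) (a : ℤ) (j : Fin 2) :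
    lap lam ω f (a, j) = conduct lam ω (a, j) (a + 1, j) * (f (a, j) - f (a + 1, j)) +
      (conduct lam ω (a, j) (a - 1, j) * (f (a, j) - f (a - 1, j)) +
      conduct lam ω (a, j) (a, j + 1) * (f (a, j) - f (a, j + 1))) := by
  unfold lap nbrs
  rw [Finset.sum_insert, Finset.sum_insert, Finset.sum_singleton]
  · simp
  · simp; omega

lemma conduct_pos {lam : ℝ} {ω : Config} {v w : V} (h : (openGraph ω).Adj v w) :
    0 < conduct lam ω v w := by
  rw [conduct_of_adj h]
  positivity

/-- The potential in column `0` is large at the end of a long dead end. -/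
lemma le_colGreen_of_trapEvent {lam : ℝ} (hl : 0 < lam) {ω : Config} (hω : IsGood ω) {n : ℕ}
    (h : ω ∈ trapEvent n) : Real.exp (2 * lam * n) / norm lam ≤ colGreen lam ω := by
  have hD := cutDist_of_trapEvent h
  obtain ⟨⟨⟨h1, h2⟩, h3⟩, h4⟩ := h
  have hinf := hω.toInfty_entry
  set g := green lam (rightNet ω) (entry ω) with hg
  have hlap : ∀ v, v ≠ entry ω → lap lam (rightNet ω) g v = 0 := fun v hv => by
    rw [lap_green hl le_rfl hinf, if_neg hv]
  have hent : entry ω = (-(n : ℤ), 0) := by rw [entry, hD]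
  have hnet : openGraph (rightNet ω) = rightGraph ω (-(n : ℤ)) := by
    rw [rightNet, openGraph_cutOff, hD]
  have hright : ∀ i : ℤ, ω (hEdge i 1) = false → ¬ (openGraph (rightNet ω)).Adj (i - 1, 1) (i, 1) := by
    intro i hi hadj
    rw [hnet] at hadj
    have := openGraph_adj_right.1 hadj.1
    rw [hi] at this
    simp at this
  -- Induction from the tip towards the mouth: row 1 is closed at its right end and has no open
  -- vertical edge on the way, so no current flows and the potential is constant along it.
  have hdead : ∀ k : ℕ, k ≤ n → conduct lam (rightNet ω) (-(k : ℤ), 1) (-(k : ℤ) + 1, 1) *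
      (g (-(k : ℤ), 1) - g (-(k : ℤ) + 1, 1)) = 0 ∧ g (0, 1) = g (-(k : ℤ), 1) := by
    intro k
    induction k with
    | zero =>
      intro _
      have := hright 1 h4.2
      refine ⟨?_, by simp⟩
      rw [conduct_of_not_adj (by simpa using this), zero_mul]
    | succ k ih =>
      intro hk
      obtain ⟨ih1, ih2⟩ := ih (by omega)
      have hp := h3 (-k) (by omega) (by omega)
      have hl0 := hlap (-(k : ℤ), 1) (by rw [hent]; simp)
      have hrung : ¬ (openGraph (rightNet ω)).Adj (-(k : ℤ), 1) (-(k : ℤ), 1 + 1) := by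
        intro hadj
        rw [hnet] at hadj
        have := openGraph_adj_rung.1 hadj.1.symm
        rw [hp.2.2] at this
        simp at this
      have hleft : (openGraph (rightNet ω)).Adj (-(k : ℤ), 1) (-(k : ℤ) - 1, 1) := by
        rw [hnet]
        exact ⟨(openGraph_adj_right.2 hp.2.1).symm, by simp; omega, by simp; omega⟩
      rw [lap_three, ih1, conduct_of_not_adj hrung, zero_mul, zero_add, add_zero] at hl0
      have heq : g (-(k : ℤ), 1) = g (-(k : ℤ) - 1, 1) := by
        rcases mul_eq_zero.1 hl0 with h | h
        · exact absurd h (conduct_pos hleft).ne'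
        · linarith
      have hcast : (-((k + 1 : ℕ) : ℤ)) = -(k : ℤ) - 1 := by push_cast; ring
      rw [hcast, sub_add_cancel]
      exact ⟨by rw [heq, sub_self, mul_zero], ih2.trans heq⟩
  obtain ⟨hd1, hd2⟩ := hdead n le_rfl
  have hl0 := hlap (-(n : ℤ), 1) (by rw [hent]; simp)
  have hleft : ¬ (openGraph (rightNet ω)).Adj (-(n : ℤ), 1) (-(n : ℤ) - 1, 1) := fun hadj =>
    hright _ h1.2 hadj.symm
  have hrung : (openGraph (rightNet ω)).Adj (-(n : ℤ), 1) (-(n : ℤ), 1 + 1) := by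
    rw [hnet]
    exact ⟨(openGraph_adj_rung.2 h2).symm, le_rfl, le_rfl⟩
  rw [lap_three, hd1, conduct_of_not_adj hleft, zero_mul, zero_add, zero_add] at hl0
  have heq : g (-(n : ℤ), 1) = g (entry ω) := by
    rcases mul_eq_zero.1 hl0 with h | h
    · exact absurd h (conduct_pos hrung).ne'
    · rw [hent]
      exact sub_eq_zero.1 h
  have hlow := inv_revMeasure_le_green hl (show -(cutDist ω : ℤ) ≤ (entry ω).1 from le_rfl) hinf
  have hrev : 1 / revMeasure lam (entry ω) = Real.exp (2 * lam * n) / norm lam := by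
    rw [revMeasure, hent, one_div, mul_inv, ← Real.exp_neg]
    push_cast
    rw [div_eq_inv_mul]
    congr 2
    ring
  rw [← hrev]
  calc _ ≤ g (0, 1) := by rw [hd2, heq]; exact hlow
    _ ≤ ∑ j, g (0, j) := Finset.single_le_sum (f := fun j => g (0, j))
        (fun j _ => hω.green_nonneg hl _) (Finset.mem_univ 1)

/-! ### The walk driven by stacks of directions -/

/-- The neighbour of `v` in the direction `d`: right, left, or across. -/
def dest (v : V) (d : Fin 3) : V := ![(v.1 + 1, v.2), (v.1 - 1, v.2), (v.1, v.2 + 1)] d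

/-- The probability of choosing the direction `d`. -/
def dirProb (lam : ℝ) (d : Fin 3) : ℝ := ![Real.exp lam, Real.exp (-lam), 1] d / norm lam

open Classical in
/-- Move from `v` in the direction `d` if the edge is open. -/
def move (ω : Config) (v : V) (d : Fin 3) : V :=
  if (openGraph ω).Adj v (dest v d) then dest v d else v

/-- A direction for every vertex and every visit to it. -/
abbrev Stacks : Type := V × ℕ → Fin 3

/-- One step of the walk; the state consists of the position and the list of past positions. -/
def walkStep (ω : Config) (ξ : Stacks) (s : V × List V) : V × List V :=
  (move ω s.1 (ξ (s.1, s.2.count s.1)), s.1 :: s.2)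

/-- The state at time `n` of the walk started at `y`. -/
def walkState (ω : Config) (ξ : Stacks) (y : V) : ℕ → V × List V
  | 0 => (y, [])
  | n + 1 => walkStep ω ξ (walkState ω ξ y n)

/-- The position at time `n` of the walk started at `y`. -/
def walk (ω : Config) (ξ : Stacks) (y : V) (n : ℕ) : V := (walkState ω ξ y n).1

/-- The positions before time `n`, the latest first. -/
def hist (a : ℕ → V) : ℕ → List V
  | 0 => []
  | n + 1 => a n :: hist a n

lemma walkState_eq (ω : Config) (ξ : Stacks) (y : V) (n : ℕ) :
    walkState ω ξ y n = (walk ω ξ y n, hist (walk ω ξ y) n) := by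
  induction n with
  | zero => rfl
  | succ n ih =>
    refine Prod.ext rfl ?_
    change (walkState ω ξ y n).1 :: (walkState ω ξ y n).2 = _
    rw [ih]
    rfl

lemma walk_succ (ω : Config) (ξ : Stacks) (y : V) (n : ℕ) :
    walk ω ξ y (n + 1) = move ω (walk ω ξ y n)
      (ξ (walk ω ξ y n, (hist (walk ω ξ y) n).count (walk ω ξ y n))) := by
  change (walkStep ω ξ (walkState ω ξ y n)).1 = _
  rw [walkState_eq]
  rfl

lemma hist_eq_iff {a b : ℕ → V} {n : ℕ} : hist a n = hist b n ↔ ∀ i < n, a i = b i := by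
  induction n with
  | zero => simp [hist]
  | succ n ih =>
    simp only [hist, List.cons.injEq, ih]
    constructor
    · rintro ⟨h1, h2⟩ i hi
      rcases Nat.lt_succ_iff_lt_or_eq.1 hi with h | rfl
      · exact h2 i h
      · exact h1
    · exact fun h => ⟨h n (by omega), fun i hi => h i (by omega)⟩

lemma setOf_walk_path (ω : Config) (y : V) (n : ℕ) (a : ℕ → V) :
    {ξ : Stacks | ∀ i ≤ n, walk ω ξ y i = a i} = {ξ | walkState ω ξ y n = (a n, hist a n)} := by
  ext ξ
  simp only [Set.mem_ofPred_eq, walkState_eq, Prod.mk.injEq, hist_eq_iff]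
  constructor
  · exact fun h => ⟨h n le_rfl, fun i hi => h i hi.le⟩
  · rintro ⟨h1, h2⟩ i hi
    rcases hi.lt_or_eq with h | rfl
    · exact h2 i h
    · exact h1

lemma setOf_walkState_succ (ω : Config) (y w v : V) (l : List V) (n : ℕ) :
    {ξ : Stacks | walkState ω ξ y (n + 1) = (w, v :: l)} =
      {ξ | walkState ω ξ y n = (v, l)} ∩ {ξ | move ω v (ξ (v, l.count v)) = w} := by
  ext ξ
  simp only [walkState, walkStep, Set.mem_ofPred_eq, Set.mem_inter_iff, Prod.mk.injEq,
    List.cons.injEq]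
  constructor
  · rintro ⟨h1, h2, h3⟩
    have : walkState ω ξ y n = (v, l) := Prod.ext h2 h3
    rw [this] at h1
    exact ⟨this, h1⟩
  · rintro ⟨h1, h2⟩
    rw [h1]
    exact ⟨h2, rfl, rfl⟩

lemma setOf_walkState_nil (ω : Config) (y w : V) (n : ℕ) :
    {ξ : Stacks | walkState ω ξ y (n + 1) = (w, [])} = ∅ := by
  ext ξ
  simp [walkState, walkStep]

/-- Only the directions already used, one for each past visit, have been revealed. The next entry of
the current stack is fresh, hence independent of the past. -/
lemma walkState_dependsOn (ω : Config) (y : V) (n : ℕ) (s : V × List V) :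
    SetDependsOn {ξ : Stacks | walkState ω ξ y n = s} {c | c.2 < s.2.count c.1} := by
  induction n generalizing s with
  | zero => exact fun _ _ _ => Iff.rfl
  | succ n ih =>
    obtain ⟨w, l⟩ := s
    cases l with
    | nil => rw [setOf_walkState_nil]; exact fun _ _ _ => Iff.rfl
    | cons v l =>
      rw [setOf_walkState_succ]
      have h2 : SetDependsOn {ξ : Stacks | move ω v (ξ (v, l.count v)) = w} {(v, l.count v)} :=
        fun ξ ξ' h => by
          simp only [Set.mem_ofPred_eq]
          rw [h _ rfl]
      refine ((ih (v, l)).inter h2).mono (Set.union_subset ?_ ?_)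
      · rintro ⟨u, k⟩ hk
        simp only [Set.mem_ofPred_eq] at hk ⊢
        exact hk.trans_le (List.count_le_count_cons)
      · rintro _ rfl
        simp

/-! ### Measurability -/

lemma measurableSet_adj (v w : V) : MeasurableSet {ω : Config | (openGraph ω).Adj v w} := by
  by_cases h : s(v, w) ∈ ladder.edgeSet
  · have : {ω : Config | (openGraph ω).Adj v w} = {ω | ω ⟨s(v, w), h⟩ = true} := by
      ext ω
      exact ⟨fun ⟨_, h'⟩ => h', fun h' => ⟨h, h'⟩⟩
    rw [this]
    exact measurableSet_edge _ _
  · have : {ω : Config | (openGraph ω).Adj v w} = ∅ := by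
      ext ω
      simp only [openGraph, Set.mem_ofPred_eq, Set.mem_empty_iff_false, iff_false]
      exact fun ⟨h', _⟩ => h h'
    rw [this]
    exact MeasurableSet.empty

lemma measurableSet_move (v w : V) (d : Fin 3) : MeasurableSet {ω : Config | move ω v d = w} := by
  have : {ω : Config | move ω v d = w} =
      ({ω | (openGraph ω).Adj v (dest v d)} ∩ {_ω | dest v d = w}) ∪
      ({ω | (openGraph ω).Adj v (dest v d)}ᶜ ∩ {_ω | v = w}) := by
    ext ω
    by_cases h : (openGraph ω).Adj v (dest v d) <;> simp [move, h]
  rw [this]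
  exact ((measurableSet_adj _ _).inter (MeasurableSet.const _)).union
    ((measurableSet_adj _ _).compl.inter (MeasurableSet.const _))

lemma measurableSet_walkState (y : V) (n : ℕ) (s : V × List V) :
    MeasurableSet {z : Config × Stacks | walkState z.1 z.2 y n = s} := by
  induction n generalizing s with
  | zero => simp only [walkState]; exact MeasurableSet.const _
  | succ n ih =>
    obtain ⟨w, l⟩ := s
    cases l with
    | nil =>
      convert MeasurableSet.empty
      ext z
      simp [walkState, walkStep]
    | cons v l =>
      have : {z : Config × Stacks | walkState z.1 z.2 y (n + 1) = (w, v :: l)} =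
          {z | walkState z.1 z.2 y n = (v, l)} ∩
            ⋃ d, {z | z.2 (v, l.count v) = d} ∩ {z | move z.1 v d = w} := by
        ext z
        have := Set.ext_iff.1 (setOf_walkState_succ z.1 y w v l n) z.2
        simp only [Set.mem_ofPred_eq, Set.mem_inter_iff] at this
        simp [this]
      rw [this]
      refine (ih _).inter (MeasurableSet.iUnion fun d => MeasurableSet.inter ?_ ?_)
      · exact measurableSet_eq_fun ((measurable_pi_apply _).comp measurable_snd) measurable_const
      · exact (measurableSet_move v w d).preimage measurable_fst

lemma measurable_walk (y : V) (n : ℕ) :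
    Measurable fun z : Config × Stacks => walk z.1 z.2 y n := by
  refine measurable_to_countable' fun v => ?_
  have : (fun z : Config × Stacks => walk z.1 z.2 y n) ⁻¹' {v} =
      ⋃ l : List V, {z | walkState z.1 z.2 y n = (v, l)} := by
    ext z
    simp only [walk, Set.mem_preimage, Set.mem_singleton_iff, Set.mem_iUnion, Set.mem_ofPred_eq]
    exact ⟨fun h => ⟨_, Prod.ext h rfl⟩, fun ⟨l, h⟩ => by rw [h]⟩
  rw [this]
  exact MeasurableSet.iUnion fun l => measurableSet_walkState y n _

lemma measurable_walk_right (ω : Config) (y : V) :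
    Measurable fun ξ : Stacks => walk ω ξ y :=
  measurable_pi_lambda _ fun n => (measurable_walk y n).comp measurable_prodMk_left

/-! ### The law of the walk -/

lemma dirProb_nonneg (lam : ℝ) (d : Fin 3) : 0 ≤ dirProb lam d := by
  have := norm_pos lam
  fin_cases d <;> simp [dirProb] <;> positivity

lemma sum_dirProb (lam : ℝ) : ∑ d, dirProb lam d = 1 := by
  have := (norm_pos lam).ne'
  simp only [dirProb, ← Finset.sum_div]
  rw [Fin.sum_univ_three, div_eq_one_iff_eq this, norm]
  simp
  ring

lemma dest_injective (v : V) : Function.Injective (dest v) := by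
  intro d d' h
  fin_cases d <;> fin_cases d' <;> simp [dest] at h <;> first | rfl | omega

lemma mem_nbrs_iff_dest {v w : V} : w ∈ nbrs v ↔ ∃ d, dest v d = w := by
  simp only [nbrs, Finset.mem_insert, Finset.mem_singleton, Fin.exists_fin_succ, dest]
  simp [eq_comm]

lemma sum_nbrs (v : V) (F : V → ℝ) : ∑ w ∈ nbrs v, F w = ∑ d, F (dest v d) := by
  have : nbrs v = Finset.univ.image (dest v) := by
    ext w
    simp [mem_nbrs_iff_dest]
  rw [this, Finset.sum_image fun _ _ _ _ h => dest_injective v h]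

open Classical in
lemma hop_dest (lam : ℝ) (ω : Config) (v : V) (d : Fin 3) :
    hop lam ω v (dest v d) = if (openGraph ω).Adj v (dest v d) then dirProb lam d else 0 := by
  unfold hop
  split_ifs
  · fin_cases d <;> simp [dest, dirProb, norm]
  · rfl

lemma sum_move (lam : ℝ) (ω : Config) (v w : V) :
    ∑ d, (if move ω v d = w then dirProb lam d else 0) = transProb lam ω v w := by
  unfold transProb
  split_ifs with hw
  · subst hw
    rw [sum_nbrs, ← sum_dirProb lam, ← Finset.sum_sub_distrib]
    refine Finset.sum_congr rfl fun d _ => ?_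
    rw [hop_dest]
    by_cases h : (openGraph ω).Adj w (dest w d)
    · have : dest w d ≠ w := h.ne'
      simp [move, h, this]
    · simp [move, h]
  · have hterm : ∀ d, (if move ω v d = w then dirProb lam d else 0) =
        if dest v d = w then hop lam ω v w else 0 := by
      intro d
      by_cases h : dest v d = w
      · subst h
        rw [hop_dest]
        by_cases h : (openGraph ω).Adj v (dest v d)
        · simp [move, h]
        · simp [move, h, Ne.symm hw]
      · rw [if_neg h, if_neg]
        unfold move
        split_ifs
        · exact h
        · exact Ne.symm hw
    simp only [hterm]
    by_cases h : ∃ d, dest v d = w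
    · obtain ⟨d, rfl⟩ := h
      simp [(dest_injective v).eq_iff]
    · have : ¬ (openGraph ω).Adj v w := fun hadj => h (mem_nbrs_iff_dest.1 (mem_nbrs_of_adj hadj))
      simp [hop, this]

/-- The law of one direction. -/
def dirLaw (lam : ℝ) : Measure (Fin 3) :=
  (PMF.ofFintype (fun d => ENNReal.ofReal (dirProb lam d)) (by
    rw [← ENNReal.ofReal_sum_of_nonneg fun d _ => dirProb_nonneg lam d, sum_dirProb,
      ENNReal.ofReal_one])).toMeasure

instance (lam : ℝ) : IsProbabilityMeasure (dirLaw lam) :=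
  inferInstanceAs (IsProbabilityMeasure (PMF.toMeasure _))

/-- The law of independent stacks of directions. -/
def stackLaw (lam : ℝ) : Measure Stacks := Measure.infinitePi fun _ => dirLaw lam

instance (lam : ℝ) : IsProbabilityMeasure (stackLaw lam) :=
  inferInstanceAs (IsProbabilityMeasure (Measure.infinitePi _))

lemma dirLaw_move (lam : ℝ) (ω : Config) (v w : V) :
    dirLaw lam {d | move ω v d = w} = ENNReal.ofReal (transProb lam ω v w) := by
  rw [dirLaw, PMF.toMeasure_apply_fintype, ← sum_move, ENNReal.ofReal_sum_of_nonneg]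
  · refine Finset.sum_congr rfl fun d _ => ?_
    by_cases h : move ω v d = w <;> simp [h, Set.indicator]
  · intro d _
    split_ifs
    · exact dirProb_nonneg lam d
    · exact le_rfl

lemma measurableSet_walkState_right (ω : Config) (y : V) (n : ℕ) (s : V × List V) :
    MeasurableSet {ξ : Stacks | walkState ω ξ y n = s} :=
  (measurableSet_walkState y n s).preimage (f := fun ξ : Stacks => (ω, ξ)) measurable_prodMk_left

lemma stackLaw_walkState_succ (lam : ℝ) (ω : Config) (y w v : V) (l : List V) (n : ℕ) :
    stackLaw lam {ξ | walkState ω ξ y (n + 1) = (w, v :: l)} =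
      stackLaw lam {ξ | walkState ω ξ y n = (v, l)} * ENNReal.ofReal (transProb lam ω v w) := by
  have h2 : SetDependsOn {ξ : Stacks | move ω v (ξ (v, l.count v)) = w} {(v, l.count v)} :=
    fun ξ ξ' h => by
      simp only [Set.mem_ofPred_eq]
      rw [h _ rfl]
  have hm2 := h2.measurableSet_of_finite (Set.finite_singleton _)
  rw [setOf_walkState_succ, stackLaw, infinitePi_inter_of_disjoint _ (walkState_dependsOn ω y n _) h2
    (measurableSet_walkState_right ω y n _) hm2, ← dirLaw_move lam ω v w]
  · congr 1
    have h3 := (measurePreserving_eval_infinitePi (fun _ : V × ℕ => dirLaw lam)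
      (v, l.count v)).measure_preimage (s := {d | move ω v d = w})
      (Set.toFinite _).measurableSet.nullMeasurableSet
    exact h3
  · rw [Set.disjoint_singleton_right]
    simp

lemma stackLaw_path (lam : ℝ) (v : V) (ω : Config) (n : ℕ) (a : ℕ → V) :
    stackLaw lam {ξ | ∀ i ≤ n, walk ω ξ v i = a i} =
      (if a 0 = v then 1 else 0) *
        ∏ i ∈ Finset.range n, ENNReal.ofReal (transProb lam ω (a i) (a (i + 1))) := by
  rw [setOf_walk_path]
  induction n with
  | zero =>
    by_cases h : a 0 = v
    · simp [walkState, hist, h]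
    · simp [walkState, hist, h, Ne.symm h]
  | succ n ih =>
    rw [hist, stackLaw_walkState_succ, ih, Finset.prod_range_succ, mul_assoc]

lemma measurableSet_path (n : ℕ) (a : ℕ → V) : MeasurableSet {y : ℕ → V | ∀ i ≤ n, y i = a i} := by
  rw [setOf_path]
  exact (measurableSet_singleton _).preimage (by fun_prop)

/-- A law on trajectories is determined by the probabilities of finite paths. -/
lemma ext_of_path {μ ν : Measure (ℕ → V)} [IsProbabilityMeasure μ] [IsProbabilityMeasure ν]
    (h : ∀ (n : ℕ) (a : ℕ → V), μ {y | ∀ i ≤ n, y i = a i} = ν {y | ∀ i ≤ n, y i = a i}) :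
    μ = ν := by
  refine ext_of_generate_finite (measurableCylinders fun _ : ℕ => V)
    generateFrom_measurableCylinders.symm isPiSystem_measurableCylinders (fun t ht => ?_) (by simp)
  obtain ⟨N, S, mS, rfl⟩ : ∃ N S, MeasurableSet S ∧ t = cylinder (Finset.Iic N) S := by
    simpa [measurableCylinders_nat] using ht
  have hm : Measurable (Preorder.frestrictLe (π := fun _ : ℕ => V) N) := by fun_prop
  change μ (Preorder.frestrictLe (π := fun _ : ℕ => V) N ⁻¹' S) =
    ν (Preorder.frestrictLe (π := fun _ : ℕ => V) N ⁻¹' S)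
  rw [← Measure.map_apply hm mS, ← Measure.map_apply hm mS]
  congr 1
  refine Measure.ext_of_singleton fun x => ?_
  obtain ⟨a, ha⟩ : ∃ a : ℕ → V, Preorder.frestrictLe (π := fun _ : ℕ => V) N a = x :=
    ⟨fun i => if hi : i ∈ Finset.Iic N then x ⟨i, hi⟩ else (0, 0), by
      ext1 i
      simp [Finset.mem_Iic.1 i.2]⟩
  rw [Measure.map_apply hm (measurableSet_singleton _),
    Measure.map_apply hm (measurableSet_singleton _), ← ha, ← setOf_path]
  exact h N a

/-- Since every step uses a fresh entry, both laws give each finite path the same product of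
transition probabilities. -/
lemma map_walk (lam : ℝ) (ω : Config) (y : V) :
    (stackLaw lam).map (fun ξ => walk ω ξ y) = quenchedLaw lam y ω := by
  have := Measure.isProbabilityMeasure_map (μ := stackLaw lam)
    (measurable_walk_right ω y).aemeasurable
  refine ext_of_path fun n a => ?_
  rw [Measure.map_apply (measurable_walk_right ω y) (measurableSet_path n a), quenchedLaw_path]
  exact stackLaw_path lam y ω n a

/-- The Markov property. -/
lemma quenchedLaw_step (lam : ℝ) (v : V) (ω : Config) (n : ℕ) (u w : V) :
    quenchedLaw lam v ω {y | y n = u ∧ y (n + 1) = w} =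
      quenchedLaw lam v ω {y | y n = u} * ENNReal.ofReal (transProb lam ω u w) := by
  have hset : {y : ℕ → V | y n = u ∧ y (n + 1) = w} =
      (fun y : ℕ → V => (Preorder.frestrictLe (π := fun _ => V) n y, y (n + 1))) ⁻¹'
        ({h | h ⟨n, Finset.mem_Iic.2 le_rfl⟩ = u} ×ˢ {w}) := by
    ext y
    simp
  have hset' : {y : ℕ → V | y n = u} = Preorder.frestrictLe (π := fun _ => V) n ⁻¹'
      {h | h ⟨n, Finset.mem_Iic.2 le_rfl⟩ = u} := by
    ext y
    simp
  have hm : MeasurableSet {h : Finset.Iic n → V | h ⟨n, Finset.mem_Iic.2 le_rfl⟩ = u} :=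
    measurableSet_eq_fun (measurable_pi_apply _) measurable_const
  have key := Kernel.map_frestrictLe_trajMeasure_compProd_eq_map_trajMeasure
    (X := fun _ => V) (μ₀ := Measure.dirac v) (κ := historyKernel lam ω) (a := n)
  rw [hset, hset', ← Measure.map_apply (by fun_prop) (hm.prod (measurableSet_singleton _)),
    ← Measure.map_apply (by fun_prop) hm]
  unfold quenchedLaw
  rw [← key, Measure.compProd_apply_prod hm (measurableSet_singleton _),
    setLIntegral_congr_fun hm (g := fun _ => ENNReal.ofReal (transProb lam ω u w)),
    setLIntegral_const, mul_comm]
  intro h hh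
  change (stepPMF lam ω (h ⟨n, _⟩)).toMeasure {w} = _
  rw [PMF.toMeasure_apply_singleton _ _ (measurableSet_singleton _)]
  rw [show h ⟨n, _⟩ = u from hh]
  rfl

lemma revMeasure_mul_transProb (lam : ℝ) (ω : Config) (u w : V) :
    revMeasure lam u * transProb lam ω u w = revMeasure lam w * transProb lam ω w u := by
  unfold transProb
  by_cases h : w = u
  · subst h; rfl
  · rw [if_neg h, if_neg (Ne.symm h), revMeasure_mul_hop, revMeasure_mul_hop, conduct_comm]

/-- The recursion for `heat` expands the first step, but the Markov property on trajectories expands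
the last one. Multiplying by the reversible measure reconciles the two. -/
lemma quenchedLaw_eval (lam : ℝ) (v : V) (ω : Config) (n : ℕ) (w : V) :
    quenchedLaw lam v ω {y | y n = w} = ENNReal.ofReal (heat lam ω n v w) := by
  have hv := revMeasure_pos lam v
  suffices h : ∀ w, ENNReal.ofReal (revMeasure lam v) * quenchedLaw lam v ω {y | y n = w} =
      ENNReal.ofReal (revMeasure lam w * heat lam ω n w v) by
    have h1 := h w
    rw [← heat_comm, ENNReal.ofReal_mul hv.le] at h1
    exact (ENNReal.mul_right_inj (ENNReal.ofReal_pos.2 hv).ne' ENNReal.ofReal_ne_top).1 h1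
  clear w
  induction n with
  | zero =>
    intro w
    have h := quenchedLaw_path lam v ω 0 fun _ => w
    simp only [Nat.le_zero, forall_eq, Finset.range_zero, Finset.prod_empty, mul_one] at h
    rw [h]
    by_cases hw : w = v <;> simp [heat, hw]
  | succ n ih =>
    intro w
    have hdecomp : quenchedLaw lam v ω {y | y (n + 1) = w} =
        ∑' u, quenchedLaw lam v ω {y | y n = u ∧ y (n + 1) = w} := by
      rw [← measure_iUnion]
      · congr 1
        ext y
        simp
      · intro u u' huu
        rw [Function.onFun, Set.disjoint_left]
        rintro y ⟨h1, _⟩ ⟨h2, _⟩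
        exact huu (h1.symm.trans h2)
      · intro u
        exact (measurableSet_eq_fun (measurable_pi_apply _) measurable_const).inter
          (measurableSet_eq_fun (measurable_pi_apply _) measurable_const)
    have hterm : ∀ u, ENNReal.ofReal (revMeasure lam v) *
        quenchedLaw lam v ω {y | y n = u ∧ y (n + 1) = w} =
        ENNReal.ofReal (revMeasure lam w * (transProb lam ω w u * heat lam ω n u v)) := by
      intro u
      rw [quenchedLaw_step, ← mul_assoc, ih, ← ENNReal.ofReal_mul
        (mul_nonneg (revMeasure_pos lam u).le (heat_nonneg _ _ _ _ _))]
      congr 1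
      calc _ = revMeasure lam u * transProb lam ω u w * heat lam ω n u v := by ring
        _ = _ := by rw [revMeasure_mul_transProb]; ring
    rw [hdecomp, ← ENNReal.tsum_mul_left]
    simp only [hterm]
    rw [tsum_eq_sum (s := insert w (nbrs w))]
    · rw [← ENNReal.ofReal_sum_of_nonneg, ← Finset.mul_sum]
      · rfl
      · intro u _
        exact mul_nonneg (revMeasure_pos lam w).le
          (mul_nonneg (transProb_nonneg _ _ _ _) (heat_nonneg _ _ _ _ _))
    · intro u hu
      have h := transProb_eq_zero lam ω w u hu
      rw [ENNReal.ofReal_eq_zero] at h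
      rw [le_antisymm h (transProb_nonneg _ _ _ _)]
      simp

/-! ### Numbers of visits -/

open Classical in
/-- The number of visits of the trajectory `a` to column `i`. -/
def visits (a : ℕ → V) (i : ℤ) : ℝ≥0∞ := ∑' n, if (a n).1 = i then 1 else 0

open Classical in
/-- The number of visits of the trajectory `a` to column `i` before column `i + J` is reached. -/
def visitsBefore (a : ℕ → V) (i : ℤ) (J : ℕ) : ℝ≥0∞ :=
  ∑' n, if (a n).1 = i ∧ ∀ k ≤ n, (a k).1 < i + J then 1 else 0

/-- The bridge from probability to the network: an expected number of visits is the reversible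
measure times the Green function. -/
lemma tsum_ofReal_heat {lam : ℝ} (hl : 0 < lam) {ω : Config} {i : ℤ} {y : V} (hy : i ≤ y.1)
    (h : ToInfty ω i y) (u : V) :
    ∑' n, ENNReal.ofReal (heat lam ω n y u) =
      ENNReal.ofReal (revMeasure lam u * green lam ω y u) := by
  refine tendsto_nhds_unique (ENNReal.tendsto_nat_tsum _) ?_
  have h1 := ENNReal.tendsto_ofReal ((tendsto_pot hl hy h u).const_mul (revMeasure lam u))
  refine h1.congr fun N => ?_
  rw [← ENNReal.ofReal_sum_of_nonneg fun n _ => heat_nonneg _ _ _ _ _, pot_comm, pot,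
    mul_div_cancel₀ _ (revMeasure_pos lam u).ne']

lemma measurable_visits (i : ℤ) : Measurable fun a : ℕ → V => visits a i := by
  classical
  refine Measurable.tsum fun n => Measurable.ite ?_ measurable_const measurable_const
  exact measurableSet_eq_fun (measurable_fst.comp (measurable_pi_apply n)) measurable_const

lemma measurable_visitsBefore (i : ℤ) (J : ℕ) : Measurable fun a : ℕ → V => visitsBefore a i J := by
  classical
  refine Measurable.tsum fun n => Measurable.ite ?_ measurable_const measurable_const
  have h : {a : ℕ → V | (a n).1 = i ∧ ∀ k ≤ n, (a k).1 < i + J} =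
      {a | (a n).1 = i} ∩ ⋂ k, ⋂ (_ : k ≤ n), {a | (a k).1 < i + J} := by
    ext
    simp
  rw [h]
  refine (measurableSet_eq_fun (measurable_fst.comp (measurable_pi_apply n))
    measurable_const).inter ?_
  exact MeasurableSet.iInter fun k => MeasurableSet.iInter fun _ =>
    measurableSet_lt (measurable_fst.comp (measurable_pi_apply k)) measurable_const

lemma lintegral_visits (lam : ℝ) (ω : Config) (y : V) (i : ℤ) :
    ∫⁻ ξ, visits (walk ω ξ y) i ∂(stackLaw lam) =
      ∑ j, ∑' n, ENNReal.ofReal (heat lam ω n y (i, j)) := by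
  classical
  have hmap := map_walk lam ω y
  rw [← lintegral_map (measurable_visits i) (measurable_walk_right ω y), hmap]
  unfold visits
  have hms : ∀ n : ℕ, MeasurableSet {a : ℕ → V | (a n).1 = i} := fun n =>
    measurableSet_eq_fun (measurable_fst.comp (measurable_pi_apply n)) measurable_const
  rw [lintegral_tsum fun n =>
    (Measurable.ite (hms n) measurable_const measurable_const).aemeasurable,
    ← Summable.tsum_finsetSum fun j _ => ENNReal.summable]
  refine tsum_congr fun n => ?_
  have h1 : ∫⁻ a, (if (a n).1 = i then (1 : ℝ≥0∞) else 0) ∂(quenchedLaw lam y ω) =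
      quenchedLaw lam y ω {a | (a n).1 = i} := by
    rw [← lintegral_indicator_one (hms n)]
    refine lintegral_congr fun a => ?_
    by_cases h : (a n).1 = i <;> simp [h]
  rw [h1, Fin.sum_univ_two, ← quenchedLaw_eval, ← quenchedLaw_eval, ← measure_union]
  · congr 1
    ext a
    simp only [Set.mem_ofPred_eq, Set.mem_union, Prod.ext_iff]
    rcases fin_two_cases (a n).2 with h | h <;> simp [h]
  · rw [Set.disjoint_left]
    intro a h1 h2
    simp only [Set.mem_ofPred_eq] at h1 h2
    rw [h1] at h2
    simp at h2
  · exact measurableSet_eq_fun (measurable_pi_apply _) measurable_const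

lemma visitsBefore_mono (a : ℕ → V) (i : ℤ) : Monotone (visitsBefore a i) := by
  classical
  intro J J' hJ
  refine ENNReal.tsum_le_tsum fun n => ?_
  by_cases h : (a n).1 = i ∧ ∀ k ≤ n, (a k).1 < i + J
  · rw [if_pos h, if_pos ⟨h.1, fun k hk => (h.2 k hk).trans_le (by omega)⟩]
  · rw [if_neg h]; exact zero_le

lemma visitsBefore_le (a : ℕ → V) (i : ℤ) (J : ℕ) : visitsBefore a i J ≤ visits a i := by
  classical
  refine ENNReal.tsum_le_tsum fun n => ?_
  by_cases h : (a n).1 = i ∧ ∀ k ≤ n, (a k).1 < i + J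
  · rw [if_pos h, if_pos h.1]
  · rw [if_neg h]; exact zero_le

lemma iSup_visitsBefore (a : ℕ → V) (i : ℤ) : ⨆ J, visitsBefore a i J = visits a i := by
  classical
  refine le_antisymm (iSup_le fun J => visitsBefore_le a i J) ?_
  unfold visits
  rw [ENNReal.tsum_eq_iSup_nat]
  refine iSup_le fun N => ?_
  obtain ⟨J, hJ⟩ : ∃ J : ℕ, ∀ k < N, (a k).1 < i + J := by
    refine ⟨∑ k ∈ Finset.range N, (((a k).1 - i).toNat + 1), fun k hk => ?_⟩
    have := Finset.single_le_sum (f := fun k => ((a k).1 - i).toNat + 1)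
      (fun _ _ => Nat.zero_le _) (Finset.mem_range.2 hk)
    omega
  refine le_trans ?_ (le_iSup _ J)
  refine le_trans (Finset.sum_le_sum fun n hn => ?_) (ENNReal.sum_le_tsum (Finset.range N))
  by_cases h : (a n).1 = i
  · rw [if_pos h, if_pos ⟨h, fun k hk => hJ k (by have := Finset.mem_range.1 hn; omega)⟩]
  · rw [if_neg h]; exact zero_le

/-! ### The trace of the walk to the right of a cut -/

lemma move_eq_or (ω : Config) (v : V) (d : Fin 3) :
    move ω v d = v ∨ ((openGraph ω).Adj v (move ω v d)) := by
  by_cases h : (openGraph ω).Adj v (dest v d)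
  · right; simp [move, h]
  · left; simp [move, h]

lemma abs_walk_succ_sub_le (ω : Config) (ξ : Stacks) (y : V) (n : ℕ) :
    |(walk ω ξ y (n + 1)).1 - (walk ω ξ y n).1| ≤ 1 := by
  rw [walk_succ]
  rcases move_eq_or ω (walk ω ξ y n)
      (ξ (walk ω ξ y n, (hist (walk ω ξ y) n).count (walk ω ξ y n))) with h | h
  · rw [h]; simp
  · exact abs_sub_le_of_mem_nbrs (mem_nbrs_of_adj h)

lemma move_of_adj {ω : Config} {v : V} {d : Fin 3} (h : (openGraph ω).Adj v (dest v d)) :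
    move ω v d = dest v d := by simp [move, h]

lemma move_of_not_adj {ω : Config} {v : V} {d : Fin 3} (h : ¬ (openGraph ω).Adj v (dest v d)) :
    move ω v d = v := by simp [move, h]

/-- The walk can leave through the cut only from (m, 0), and then the same direction makes the walk
in the cut-off network stay at (m, 0). -/
lemma move_cutOff {ω : Config} {m : ℤ} (hm : IsCut ω m) {v : V} (hv : m ≤ v.1) (d : Fin 3) :
    move (cutOff m ω) v d = if m ≤ (move ω v d).1 then move ω v d else (m, 0) := by
  by_cases h : (openGraph ω).Adj v (dest v d)
  · rw [move_of_adj h]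
    by_cases h' : m ≤ (dest v d).1
    · rw [if_pos h', move_of_adj]
      rw [openGraph_cutOff]
      exact ⟨h, hv, h'⟩
    · rw [if_neg h', move_of_not_adj]
      · rcases openGraph_adj_cases h with ⟨h1, h2⟩ | ⟨h1, h2⟩ | ⟨h1, h2⟩
        · rw [h1] at h'; simp at h'; omega
        · rw [h1] at h'
          have hvm : v.1 = m := by simp at h'; omega
          rw [hvm] at h2
          refine Prod.ext hvm ?_
          rcases fin_two_cases v.2 with h3 | h3
          · exact h3
          · rw [h3, hm.2] at h2; simp at h2
        · rw [h1] at h'; simp at h'; omega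
      · rw [openGraph_cutOff]
        exact fun h2 => h' h2.2.2
  · rw [move_of_not_adj h, if_pos hv, move_of_not_adj]
    rw [openGraph_cutOff]
    exact fun h2 => h h2.1

lemma move_of_lt {ω : Config} {m : ℤ} (hm : IsCut ω m) {v : V} (hv : v.1 < m) {d : Fin 3}
    (h : m ≤ (move ω v d).1) : move ω v d = (m, 0) := by
  rcases move_eq_or ω v d with h' | h'
  · rw [h'] at h; omega
  · rcases openGraph_adj_cases h' with ⟨h1, h2⟩ | ⟨h1, h2⟩ | ⟨h1, h2⟩
    · rw [h1] at h ⊢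
      have hvm : v.1 + 1 = m := by simp at h; omega
      rw [hvm] at h2
      refine Prod.ext hvm ?_
      rcases fin_two_cases v.2 with h3 | h3
      · exact h3
      · rw [h3, hm.2] at h2; simp at h2
    · rw [h1] at h; simp at h; omega
    · rw [h1] at h; simp at h; omega

section Trace

variable {ω : Config} {ξ : Stacks} {m : ℤ} (hm : IsCut ω m) {y : V} (hy : y.1 < m)

include hm hy

open Classical in
/-- The walk watched in the columns to the right of a cut is the walk in the network there, driven
by the same stacks. -/
lemma trace_aux (n : ℕ) :
    walk (cutOff m ω) ξ (m, 0) (Nat.count (fun k => m ≤ (walk ω ξ y k).1) n) =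
      (if m ≤ (walk ω ξ y n).1 then walk ω ξ y n else (m, 0)) ∧
    ∀ v : V, m ≤ v.1 → (hist (walk (cutOff m ω) ξ (m, 0))
      (Nat.count (fun k => m ≤ (walk ω ξ y k).1) n)).count v = (hist (walk ω ξ y) n).count v := by
  induction n with
  | zero =>
    have : ¬ m ≤ (walk ω ξ y 0).1 := not_le.2 hy
    simp [hist, this]
    rfl
  | succ n ih =>
    obtain ⟨ih1, ih2⟩ := ih
    set k := Nat.count (fun k => m ≤ (walk ω ξ y k).1) n with hk
    by_cases hn : m ≤ (walk ω ξ y n).1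
    -- To the right of the cut both walks are at the same vertex with the same number of earlier
    -- visits, hence use the same stack entry.
    · rw [if_pos hn] at ih1
      rw [Nat.count_succ, if_pos hn, ← hk]
      constructor
      · rw [walk_succ, ih1, ih2 _ hn, move_cutOff hm hn, walk_succ ω ξ y n]
      · intro v hv
        rw [hist, hist, List.count_cons, List.count_cons, ih2 v hv, ih1]
    -- To the left of the cut the clock of the cut-off walk stands still while it waits at (m, 0),
    -- the only place where the full walk can come back.
    · rw [if_neg hn] at ih1
      rw [Nat.count_succ, if_neg hn, add_zero, ← hk]
      constructor
      · rw [ih1, walk_succ]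
        split_ifs with h
        · exact (move_of_lt hm (not_le.1 hn) h).symm
        · rfl
      · intro v hv
        have : walk ω ξ y n ≠ v := by rintro rfl; exact hn hv
        rw [hist, List.count_cons_of_ne this, ih2 v hv]

variable (hinf : {k | m ≤ (walk ω ξ y k).1}.Infinite)

include hinf

lemma walk_nth (k : ℕ) :
    walk (cutOff m ω) ξ (m, 0) k =
      walk ω ξ y (Nat.nth (fun k => m ≤ (walk ω ξ y k).1) k) := by
  classical
  have h := (trace_aux hm hy (ξ := ξ) (Nat.nth (fun k => m ≤ (walk ω ξ y k).1) k)).1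
  rw [Nat.count_nth_of_infinite hinf] at h
  rw [h, if_pos (Nat.nth_mem_of_infinite hinf k)]

lemma visits_cutOff {i : ℤ} (hi : m ≤ i) :
    visits (walk (cutOff m ω) ξ (m, 0)) i = visits (walk ω ξ y) i := by
  classical
  unfold visits
  simp only [walk_nth hm hy hinf]
  refine (Nat.nth_injective hinf).tsum_eq (f := fun n => if (walk ω ξ y n).1 = i then
    (1 : ℝ≥0∞) else 0) fun n hn => ?_
  have hn' : (walk ω ξ y n).1 = i := by
    by_contra hcon
    simp [hcon] at hn
  exact ⟨_, Nat.nth_count (p := fun k => m ≤ (walk ω ξ y k).1) (by rw [hn']; exact hi)⟩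

lemma visitsBefore_cutOff {i : ℤ} (hi : m ≤ i) (J : ℕ) :
    visitsBefore (walk (cutOff m ω) ξ (m, 0)) i J = visitsBefore (walk ω ξ y) i J := by
  classical
  unfold visitsBefore
  -- The omitted times are spent to the left of m ≤ i, where column i + J cannot be reached, so the
  -- truncation is the same for both walks.
  have hequiv : ∀ k, (walk (cutOff m ω) ξ (m, 0) k).1 = i →
      ((∀ k' ≤ k, (walk (cutOff m ω) ξ (m, 0) k').1 < i + J) ↔
      ∀ n ≤ Nat.nth (fun k => m ≤ (walk ω ξ y k).1) k, (walk ω ξ y n).1 < i + J) := by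
    intro k _
    constructor
    · intro h n hn
      by_cases hmn : m ≤ (walk ω ξ y n).1
      · have h1 := h (Nat.count (fun k => m ≤ (walk ω ξ y k).1) n) (by
          rw [← Nat.count_nth_of_infinite hinf k]
          exact Nat.count_monotone _ hn)
        rwa [walk_nth hm hy hinf, Nat.nth_count (p := fun k => m ≤ (walk ω ξ y k).1) hmn] at h1
      · omega
    · intro h k' hk'
      rw [walk_nth hm hy hinf]
      exact h _ (Nat.nth_monotone hinf hk')
  let F : ℕ → ℝ≥0∞ := fun n => if (walk ω ξ y n).1 = i ∧ ∀ n' ≤ n, (walk ω ξ y n').1 < i + J then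
    1 else 0
  have hterm : ∀ k, (if (walk (cutOff m ω) ξ (m, 0) k).1 = i ∧
      ∀ k' ≤ k, (walk (cutOff m ω) ξ (m, 0) k').1 < i + J then (1 : ℝ≥0∞) else 0) =
      F (Nat.nth (fun k => m ≤ (walk ω ξ y k).1) k) := by
    intro k
    have h1 : (walk (cutOff m ω) ξ (m, 0) k).1 =
      (walk ω ξ y (Nat.nth (fun k => m ≤ (walk ω ξ y k).1) k)).1 := by rw [walk_nth hm hy hinf]
    have h2 := hequiv k
    by_cases h : (walk (cutOff m ω) ξ (m, 0) k).1 = i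
    · simp only [F, h, ← h1, h2 h]
    · simp only [F, h, ← h1, false_and]
  simp only [hterm]
  refine (Nat.nth_injective hinf).tsum_eq (f := F) fun n hn => ?_
  have hn' : (walk ω ξ y n).1 = i := by
    by_contra hcon
    simp [F, hcon] at hn
  exact ⟨_, Nat.nth_count (p := fun k => m ≤ (walk ω ξ y k).1) (by rw [hn']; exact hi)⟩

end Trace

/-! ### Translations -/

/-- The translate of a vertex by `k` columns. -/
def shiftVertex (k : ℤ) (v : V) : V := (v.1 + k, v.2)

/-- The stacks seen from column `k`. -/
def shiftStack (k : ℤ) (ξ : Stacks) : Stacks := fun c => ξ (shiftVertex k c.1, c.2)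

lemma shiftVertex_injective (k : ℤ) : Function.Injective (shiftVertex k) := by
  intro v w h
  simp only [shiftVertex, Prod.mk.injEq] at h
  exact Prod.ext (by omega) h.2

lemma measurable_shiftStack (k : ℤ) : Measurable (shiftStack k) :=
  measurable_pi_lambda _ fun _ => measurable_pi_apply _

lemma measurePreserving_shiftStack (lam : ℝ) (k : ℤ) :
    MeasurePreserving (shiftStack k) (stackLaw lam) (stackLaw lam) :=
  ⟨measurable_shiftStack k, Measure.map_infinitePi_infinitePi_of_inj
    (P := fun _ : V × ℕ => dirLaw lam) (f := fun c : V × ℕ => (shiftVertex k c.1, c.2))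
    fun c c' h => by
      simp only [Prod.mk.injEq] at h
      exact Prod.ext (shiftVertex_injective k h.1) h.2⟩

lemma openGraph_shiftConfig (k : ℤ) (ω : Config) (v w : V) :
    (openGraph (shiftConfig k ω)).Adj v w ↔
      (openGraph ω).Adj (shiftVertex k v) (shiftVertex k w) := by
  constructor
  · rintro ⟨h, hω⟩
    exact ⟨(shiftEdge k ⟨s(v, w), h⟩).2, hω⟩
  · rintro ⟨h, hω⟩
    have h' : s(v, w) ∈ ladder.edgeSet := by
      rw [SimpleGraph.mem_edgeSet] at h ⊢
      simpa [ladder, shiftVertex] using h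
    exact ⟨h', hω⟩

lemma dest_shiftVertex (k : ℤ) (v : V) (d : Fin 3) :
    dest (shiftVertex k v) d = shiftVertex k (dest v d) := by
  fin_cases d <;> simp [dest, shiftVertex] <;> ring

lemma move_shiftConfig (k : ℤ) (ω : Config) (v : V) (d : Fin 3) :
    shiftVertex k (move (shiftConfig k ω) v d) = move ω (shiftVertex k v) d := by
  by_cases h : (openGraph (shiftConfig k ω)).Adj v (dest v d)
  · rw [move_of_adj h, move_of_adj, dest_shiftVertex]
    rwa [openGraph_shiftConfig, ← dest_shiftVertex] at h
  · rw [move_of_not_adj h, move_of_not_adj]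
    rwa [openGraph_shiftConfig, ← dest_shiftVertex] at h

lemma hist_map (f : V → V) (a : ℕ → V) (n : ℕ) :
    hist (fun k => f (a k)) n = (hist a n).map f := by
  induction n with
  | zero => rfl
  | succ n ih => simp [hist, ih]

lemma walk_shift (k : ℤ) (ω : Config) (ξ : Stacks) (y : V) (n : ℕ) :
    shiftVertex k (walk (shiftConfig k ω) (shiftStack k ξ) y n) =
      walk ω ξ (shiftVertex k y) n := by
  induction n using Nat.strong_induction_on with
  | _ n ih =>
    cases n with
    | zero => rfl
    | succ n =>
      rw [walk_succ, move_shiftConfig, walk_succ, ← ih n (by omega)]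
      congr 1
      rw [shiftStack]
      congr 2
      rw [← List.count_map_of_injective _ _ (shiftVertex_injective k), ← hist_map]
      rw [hist_eq_iff.2 fun i hi => ih i (by omega)]

lemma cutOff_shiftConfig (k m : ℤ) (ω : Config) :
    cutOff m (shiftConfig k ω) = shiftConfig k (cutOff (m + k) ω) := by
  funext e
  simp only [cutOff, shiftConfig, pos_shiftEdge]
  congr 2
  exact propext ⟨fun h => by omega, fun h => by omega⟩

/-! ### Ergodicity of the environment and the stacks -/

/-- The environment and the stacks seen from column `k`. -/
def jointShift (k : ℤ) (z : Config × Stacks) : Config × Stacks :=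
  (shiftConfig k z.1, shiftStack k z.2)

lemma measurable_jointShift (k : ℤ) : Measurable (jointShift k) :=
  ((measurable_shiftConfig k).comp measurable_fst).prodMk
    ((measurable_shiftStack k).comp measurable_snd)

lemma iterate_jointShift (n : ℕ) (z : Config × Stacks) : (jointShift 1)^[n] z = jointShift n z := by
  induction n with
  | zero =>
    refine Prod.ext (shiftConfig_zero z.1).symm ?_
    funext c
    simp [jointShift, shiftStack, shiftVertex]
  | succ n ih =>
    rw [Function.iterate_succ_apply', ih]
    refine Prod.ext ?_ ?_
    · simp only [jointShift]
      rw [shiftConfig_shiftConfig, add_comm]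
      push_cast
      rfl
    · funext c
      simp only [jointShift, shiftStack, shiftVertex]
      push_cast
      rw [add_right_comm, add_assoc]

/-- Membership in `A` is determined by the environment and the stacks in the columns
`-m, …, m`. -/
def IsLocal (m : ℕ) (A : Set (Config × Stacks)) : Prop :=
  ∀ z z' : Config × Stacks, (∀ e ∈ span (-2 * (m : ℤ)) (2 * m), z.1 e = z'.1 e) →
    (∀ c : V × ℕ, |c.1.1| ≤ m → z.2 c = z'.2 c) → (z ∈ A ↔ z' ∈ A)

lemma IsLocal.mono {m m' : ℕ} (h : m ≤ m') {A : Set (Config × Stacks)} (hA : IsLocal m A) :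
    IsLocal m' A := fun z z' h1 h2 =>
  hA z z' (fun e he => h1 e (span_mono (by omega) (by omega) he)) fun c hc => h2 c (by omega)

/-- The measurable local sets. -/
def localSets : Set (Set (Config × Stacks)) := {A | MeasurableSet A ∧ ∃ m, IsLocal m A}

lemma isSetRing_localSets : IsSetRing localSets where
  empty_mem := ⟨MeasurableSet.empty, 0, fun _ _ _ _ => Iff.rfl⟩
  union_mem := by
    rintro A B ⟨hA, m, hm⟩ ⟨hB, k, hk⟩
    exact ⟨hA.union hB, max m k, fun z z' h1 h2 =>
      or_congr (hm.mono (le_max_left m k) z z' h1 h2) (hk.mono (le_max_right m k) z z' h1 h2)⟩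
  sdiff_mem := by
    rintro A B ⟨hA, m, hm⟩ ⟨hB, k, hk⟩
    exact ⟨hA.diff hB, max m k, fun z z' h1 h2 => and_congr (hm.mono (le_max_left m k) z z' h1 h2)
      (not_congr (hk.mono (le_max_right m k) z z' h1 h2))⟩

lemma univ_mem_localSets : Set.univ ∈ localSets :=
  ⟨MeasurableSet.univ, 0, fun _ _ _ _ => Iff.rfl⟩

lemma generateFrom_localSets :
    (inferInstance : MeasurableSpace (Config × Stacks)) = MeasurableSpace.generateFrom localSets := by
  refine le_antisymm ?_ (MeasurableSpace.generateFrom_le fun A hA => hA.1)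
  refine sup_le ?_ ?_
  · rw [← measurable_iff_comap_le]
    refine @measurable_pi_lambda _ _ _ (_) _ _ fun e => ?_
    intro s hs
    refine MeasurableSpace.measurableSet_generateFrom
      ⟨hs.preimage ((measurable_pi_apply e).comp measurable_fst), ?_⟩
    obtain ⟨m, hm⟩ := exists_subset_span (Set.finite_singleton e)
    refine ⟨m, fun z z' h1 _ => ?_⟩
    simp only [Set.mem_preimage, h1 e (hm rfl)]
  · rw [← measurable_iff_comap_le]
    refine @measurable_pi_lambda _ _ _ (_) _ _ fun c => ?_
    intro s hs
    refine MeasurableSpace.measurableSet_generateFrom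
      ⟨hs.preimage ((measurable_pi_apply c).comp measurable_snd), c.1.1.natAbs,
        fun z z' _ h2 => ?_⟩
    simp only [Set.mem_preimage, h2 c (by rw [Int.abs_eq_natAbs])]

section

variable {p : unitInterval} (h0 : 0 < p) (h1 : p < 1) {P : Measure Config}
  [IsProbabilityMeasure P] (hP : IsLocalLimit p P) (lam : ℝ)

include hP in
lemma measurePreserving_jointShift :
    MeasurePreserving (jointShift 1) (P.prod (stackLaw lam)) (P.prod (stackLaw lam)) :=
  (measurePreserving_shift_limit hP).prod (measurePreserving_shiftStack lam 1)

include hP in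
lemma measurePreserving_shiftConfig_nat (n : ℕ) : MeasurePreserving (shiftConfig n) P P := by
  have := (measurePreserving_shift_limit hP).iterate n
  convert this using 1
  funext ω
  have h := congrArg Prod.fst (iterate_jointShift n (ω, fun _ => 0))
  have h2 : ∀ (n : ℕ) (z : Config × Stacks),
      ((jointShift 1)^[n] z).1 = (shiftConfig 1)^[n] z.1 := by
    intro n
    induction n with
    | zero => exact fun z => rfl
    | succ n ih => exact fun z => by rw [Function.iterate_succ_apply, ih]; rfl
  rw [h2] at h
  exact h.symm

include h0 h1 hP in
lemma limit_mixing_ennreal {A B : Set Config} {α β i : ℤ} (hA : SetDependsOn A (span α (2 * i)))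
    (hB : SetDependsOn B (span (2 * i + 3) β)) :
    ENNReal.ofReal ((p : ℝ) ^ 6) * (P A * P B) ≤ P (A ∩ B) := by
  have h := limit_mixing h0 h1 hP hA hB
  have hp : (0 : ℝ) < p := h0
  rw [← ofReal_measureReal (μ := P) (s := A), ← ofReal_measureReal (μ := P) (s := B),
    ← ofReal_measureReal (μ := P) (s := A ∩ B), ← ENNReal.ofReal_mul measureReal_nonneg,
    ← ENNReal.ofReal_mul (by positivity)]
  exact ENNReal.ofReal_le_ofReal h

-- For fixed stacks the mixing of the environment applies to the sections. The section probabilities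
-- depend on stacks in disjoint ranges of columns, so they are independent and the integral of their
-- product factors.
include h0 h1 hP in
lemma joint_mixing {A B : Set (Config × Stacks)} {m n : ℕ} (hA : IsLocal m A) (hB : IsLocal m B)
    (hAm : MeasurableSet A) (hBm : MeasurableSet B) (hn : 2 * m + 2 ≤ n) :
    ENNReal.ofReal ((p : ℝ) ^ 6) * (P.prod (stackLaw lam) A * P.prod (stackLaw lam) B) ≤
      P.prod (stackLaw lam) (A ∩ jointShift n ⁻¹' B) := by
  set a : Stacks → ℝ≥0∞ := fun ξ => P ((fun ω => (ω, ξ)) ⁻¹' A) with ha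
  set b : Stacks → ℝ≥0∞ := fun ξ => P ((fun ω => (ω, ξ)) ⁻¹' B) with hb
  have ham : Measurable a := measurable_measure_prodMk_right hAm
  have hbm : Measurable b := measurable_measure_prodMk_right hBm
  have hbsm : Measurable fun ξ => b (shiftStack n ξ) := hbm.comp (measurable_shiftStack n)
  have hindep : IndepFun a (fun ξ => b (shiftStack n ξ)) (stackLaw lam) := by
    rw [indepFun_iff_measure_inter_preimage_eq_mul]
    intro s t hs ht
    refine infinitePi_inter_of_disjoint _ (S := {c : V × ℕ | |c.1.1| ≤ m})
      (T := {c : V × ℕ | |c.1.1 - n| ≤ m}) ?_ ?_ (ham hs) (hbsm ht) ?_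
    · intro ξ ξ' h
      have : a ξ = a ξ' := by
        simp only [ha]
        congr 1
        ext ω
        exact hA _ _ (fun _ _ => rfl) h
      simp only [Set.mem_preimage, this]
    · intro ξ ξ' h
      have : b (shiftStack n ξ) = b (shiftStack n ξ') := by
        simp only [hb]
        congr 1
        ext ω
        refine hB _ _ (fun _ _ => rfl) fun c hc => h _ ?_
        simpa [shiftVertex] using hc
      simp only [Set.mem_preimage, this]
    · rw [Set.disjoint_left]
      intro c hc hc'
      simp only [Set.mem_ofPred_eq] at hc hc'
      rw [abs_le] at hc hc'
      omega
  have hsec : ∀ ξ, ENNReal.ofReal ((p : ℝ) ^ 6) * (a ξ * b (shiftStack n ξ)) ≤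
      P ((fun ω => (ω, ξ)) ⁻¹' (A ∩ jointShift n ⁻¹' B)) := by
    intro ξ
    have hd1 : SetDependsOn ((fun ω => (ω, ξ)) ⁻¹' A) (span (-2 * (m : ℤ)) (2 * m)) :=
      fun ω ω' h => hA _ _ h fun _ _ => rfl
    have hd2 : SetDependsOn ((fun ω => (ω, ξ)) ⁻¹' (jointShift n ⁻¹' B))
        (span (2 * (m : ℤ) + 3) (2 * m + 2 * n)) := by
      intro ω ω' h
      refine hB _ _ (fun e he => h _ ⟨?_, ?_⟩) fun _ _ => rfl
      · rw [pos_shiftEdge]; have := he.1; omega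
      · rw [pos_shiftEdge]; have := he.2; omega
    have h := limit_mixing_ennreal h0 h1 hP hd1 hd2
    have hb' : P ((fun ω => (ω, ξ)) ⁻¹' (jointShift n ⁻¹' B)) = b (shiftStack n ξ) :=
      (measurePreserving_shiftConfig_nat hP n).measure_preimage
        (s := (fun ω => (ω, shiftStack n ξ)) ⁻¹' B)
        (hBm.preimage measurable_prodMk_right).nullMeasurableSet
    rw [hb'] at h
    exact h
  rw [Measure.prod_apply_symm (hAm.inter (measurable_jointShift n hBm)),
    Measure.prod_apply_symm hAm, Measure.prod_apply_symm hBm]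
  have hbint : ∫⁻ ξ, b ξ ∂(stackLaw lam) = ∫⁻ ξ, b (shiftStack n ξ) ∂(stackLaw lam) :=
    ((measurePreserving_shiftStack lam n).lintegral_comp hbm).symm
  change ENNReal.ofReal ((p : ℝ) ^ 6) * ((∫⁻ ξ, a ξ ∂(stackLaw lam)) * ∫⁻ ξ, b ξ ∂(stackLaw lam)) ≤ _
  rw [hbint, ← lintegral_mul_eq_lintegral_mul_lintegral_of_indepFun'' ham.aemeasurable
    hbsm.aemeasurable hindep,
    ← lintegral_const_mul (f := fun ξ => a ξ * b (shiftStack n ξ)) _ (ham.mul hbsm)]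
  exact lintegral_mono hsec

-- An invariant set A is nearly a local set A'. A far translate of the complement of A' must meet A'
-- with probability at least p⁶ times the product, yet by invariance this intersection lies in small
-- error sets; so A or its complement is null.
include h0 h1 hP in
lemma ergodic_jointShift : Ergodic (jointShift 1) (P.prod (stackLaw lam)) := by
  have hmp := measurePreserving_jointShift hP lam
  refine ⟨hmp, ⟨fun A hA hinv => ?_⟩⟩
  set ν := P.prod (stackLaw lam) with hν
  have hp : (0 : ℝ) < p := h0
  have hinvn : ∀ n : ℕ, jointShift n ⁻¹' A = A := by
    intro n
    have : jointShift n = (jointShift 1)^[n] := by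
      funext z
      exact (iterate_jointShift n z).symm
    rw [this]
    induction n with
    | zero => rfl
    | succ n ih =>
      rw [Function.iterate_succ, Set.preimage_comp, ih (by
        funext z
        exact (iterate_jointShift n z).symm), hinv]
  have hmpn : ∀ n : ℕ, MeasurePreserving (jointShift n) ν ν := by
    intro n
    convert hmp.iterate n using 1
    funext z
    exact (iterate_jointShift n z).symm
  have key : ∀ ε : ℝ, 0 < ε →
      (p : ℝ) ^ 6 * ((ν.real A - ε) * (ν.real Aᶜ - ε)) ≤ 2 * ε ∨ ν.real A < ε ∨ ν.real Aᶜ < ε := by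
    intro ε hε
    obtain ⟨A', ⟨hA'm, m, hA'⟩, hlt⟩ := exists_measure_symmDiff_lt_of_generateFrom_isSetRing
      (μ := ν) isSetRing_localSets ⟨{Set.univ}, Set.countable_singleton _, by
        simpa using univ_mem_localSets, by simp⟩ generateFrom_localSets hA (ENNReal.ofReal_pos.2 hε)
    have hlt' : ν.real (symmDiff A' A) < ε := by
      rw [measureReal_def]
      exact (ENNReal.lt_ofReal_iff_toReal_lt (measure_ne_top _ _)).1 hlt
    have h2 := joint_mixing h0 h1 hP lam hA' (B := A'ᶜ)
      (fun z z' h1 h2 => not_congr (hA' z z' h1 h2)) hA'm hA'm.compl (n := 2 * m + 2) le_rfl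
    have h3 : (p : ℝ) ^ 6 * (ν.real A' * ν.real A'ᶜ) ≤
        ν.real (A' ∩ jointShift (2 * m + 2 : ℕ) ⁻¹' A'ᶜ) := by
      have := ENNReal.toReal_mono (measure_ne_top _ _) h2
      rw [ENNReal.toReal_mul, ENNReal.toReal_mul, ENNReal.toReal_ofReal (by positivity)] at this
      exact this
    -- As A is invariant, such a point has either itself or its translate in the symmetric
    -- difference of A' and A.
    have h4 : ν.real (A' ∩ jointShift (2 * m + 2 : ℕ) ⁻¹' A'ᶜ) ≤ 2 * ε := by
      have hsub : A' ∩ jointShift (2 * m + 2 : ℕ) ⁻¹' A'ᶜ ⊆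
          symmDiff A' A ∪ jointShift (2 * m + 2 : ℕ) ⁻¹' (symmDiff A' A) := by
        rintro z ⟨hz1, hz2⟩
        by_cases hz : z ∈ A
        · right
          right
          rw [← hinvn (2 * m + 2)] at hz
          exact ⟨hz, hz2⟩
        · exact Or.inl (Or.inl ⟨hz1, hz⟩)
      have hpre : ν.real (jointShift (2 * m + 2 : ℕ) ⁻¹' (symmDiff A' A)) =
          ν.real (symmDiff A' A) := by
        rw [measureReal_def, (hmpn _).measure_preimage (hA'm.symmDiff hA).nullMeasurableSet]
        rfl
      have := (measureReal_mono hsub).trans (measureReal_union_le _ _)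
      linarith
    have h5 : ν.real A - ε ≤ ν.real A' := by
      have : A ⊆ A' ∪ symmDiff A' A := fun z hz => by
        by_cases h : z ∈ A'
        · exact Or.inl h
        · exact Or.inr (Or.inr ⟨hz, h⟩)
      have := (measureReal_mono (μ := ν) this).trans (measureReal_union_le _ _)
      linarith
    have h6 : ν.real Aᶜ - ε ≤ ν.real A'ᶜ := by
      have : Aᶜ ⊆ A'ᶜ ∪ symmDiff A' A := fun z hz => by
        by_cases h : z ∈ A'
        · exact Or.inr (Or.inl ⟨h, hz⟩)
        · exact Or.inl h
      have := (measureReal_mono (μ := ν) this).trans (measureReal_union_le _ _)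
      linarith
    by_cases h7 : ν.real A < ε
    · exact Or.inr (Or.inl h7)
    by_cases h8 : ν.real Aᶜ < ε
    · exact Or.inr (Or.inr h8)
    left
    refine le_trans ?_ (h3.trans h4)
    refine mul_le_mul_of_nonneg_left ?_ (by positivity)
    exact mul_le_mul h5 h6 (by linarith) measureReal_nonneg
  have hzero : ν.real A = 0 ∨ ν.real Aᶜ = 0 := by
    by_contra hcon
    push Not at hcon
    have hx : 0 < ν.real A := lt_of_le_of_ne measureReal_nonneg (Ne.symm hcon.1)
    have hy : 0 < ν.real Aᶜ := lt_of_le_of_ne measureReal_nonneg (Ne.symm hcon.2)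
    set x := ν.real A
    set y := ν.real Aᶜ
    have hx1 : x ≤ 1 := measureReal_le_one
    have hy1 : y ≤ 1 := measureReal_le_one
    have hp1 : (p : ℝ) ≤ 1 := p.2.2
    have hp6 : (p : ℝ) ^ 6 ≤ 1 := pow_le_one₀ hp.le hp1
    have hp60 : (0 : ℝ) < (p : ℝ) ^ 6 := by positivity
    set q := (p : ℝ) ^ 6
    have hxy : 0 < x * y := mul_pos hx hy
    -- With this ε the first alternative would read qxy / 4 ≤ qxy / 8, and the other two contradict
    -- the smallness of ε.
    rcases key (q * (x * y) / 16) (by positivity) with h | h | h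
    · have e1 : q * (x * y) / 16 ≤ x / 2 := by nlinarith
      have e2 : q * (x * y) / 16 ≤ y / 2 := by nlinarith
      have e3 : x / 2 * (y / 2) ≤ (x - q * (x * y) / 16) * (y - q * (x * y) / 16) :=
        mul_le_mul (by linarith) (by linarith) (by positivity) (by linarith)
      have e4 := mul_le_mul_of_nonneg_left e3 hp60.le
      have e5 : 0 < q * (x * y) := by positivity
      have e6 : q * (x / 2 * (y / 2)) = q * (x * y) / 4 := by ring
      linarith
    · nlinarith
    · nlinarith
  rw [eventuallyConst_set']
  rcases hzero with h | h
  · left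
    exact ae_eq_empty.2 ((measureReal_eq_zero_iff).1 h)
  · right
    exact ae_eq_univ.2 ((measureReal_eq_zero_iff).1 h)

end

/-! ### The speed of a trajectory in terms of numbers of visits -/

section Deterministic

variable {a : ℕ → V} {c₀ J : ℕ} {ψ : ℕ → ℝ}

lemma eventually_mul_le_sum {s s' : ℝ} (hs : s' < s)
    (h : Tendsto (fun n : ℕ => (∑ i ∈ Finset.range n, ψ i) / n) atTop (𝓝 s)) :
    ∀ᶠ n : ℕ in atTop, s' * n ≤ ∑ i ∈ Finset.range n, ψ i := by
  filter_upwards [h.eventually (lt_mem_nhds hs), eventually_gt_atTop 0] with n hn hn0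
  have : (0 : ℝ) < n := by exact_mod_cast hn0
  exact ((lt_div_iff₀ this).1 hn).le

lemma eventually_sum_le_mul {s s' : ℝ} (hs : s < s')
    (h : Tendsto (fun n : ℕ => (∑ i ∈ Finset.range n, ψ i) / n) atTop (𝓝 s)) :
    ∀ᶠ n : ℕ in atTop, ∑ i ∈ Finset.range n, ψ i ≤ s' * n := by
  filter_upwards [h.eventually (gt_mem_nhds hs), eventually_gt_atTop 0] with n hn hn0
  have : (0 : ℝ) < n := by exact_mod_cast hn0
  exact ((div_lt_iff₀ this).1 hn).le

/-- The visits to columns before a column to the right is reached take place before the time at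
which that column is reached. -/
lemma sum_visitsBefore_le (n r : ℕ) (hr : (r : ℤ) + J ≤ (a n).1 + 1) :
    ∑ i ∈ Finset.Ico c₀ r, visitsBefore a i J ≤ n := by
  classical
  have h1 : ∀ i ∈ Finset.Ico c₀ r, visitsBefore a i J ≤
      ∑ k ∈ Finset.range n, if (a k).1 = (i : ℤ) then (1 : ℝ≥0∞) else 0 := by
    intro i hi
    have hi := (Finset.mem_Ico.1 hi).2
    unfold visitsBefore
    rw [tsum_eq_sum (s := Finset.range n)]
    · refine Finset.sum_le_sum fun k _ => ?_
      by_cases h : (a k).1 = (i : ℤ)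
      · rw [if_pos h]; split_ifs <;> simp
      · rw [if_neg h, if_neg fun h' => h h'.1]
    -- At time n the walk is already at column i + J or beyond, so no visit from that time on is
    -- counted.
    · intro k hk
      rw [if_neg]
      rintro ⟨_, h⟩
      have := h n (by simpa using hk)
      omega
  refine (Finset.sum_le_sum h1).trans ?_
  rw [Finset.sum_comm]
  calc _ ≤ ∑ k ∈ Finset.range n, (1 : ℝ≥0∞) := by
        refine Finset.sum_le_sum fun k _ => ?_
        by_cases h : 0 ≤ (a k).1
        · have : ∀ i : ℕ, (a k).1 = (i : ℤ) ↔ (a k).1.toNat = i := fun i => by omega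
          simp only [this]
          rw [Finset.sum_ite_eq]
          split_ifs <;> simp
        · rw [Finset.sum_eq_zero]
          · simp
          · intro i _
            rw [if_neg (by omega)]
    _ = n := by simp

/-- An upper bound for the speed. -/
lemma eventually_le_of_visitsBefore (hψ : ∀ i, 0 ≤ ψ i)
    (hv : ∀ i : ℕ, c₀ ≤ i → ENNReal.ofReal (ψ i) ≤ visitsBefore a i J) {s : ℝ}
    (h : Tendsto (fun n : ℕ => (∑ i ∈ Finset.range n, ψ i) / n) atTop (𝓝 s))
    (ha : Tendsto (fun n => (a n).1) atTop atTop) {c : ℝ} (hs : 0 < s) (hc : 1 / s < c) :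
    ∀ᶠ n : ℕ in atTop, ((a n).1 : ℝ) / n ≤ c := by
  obtain ⟨s', hs'0, hs's, hs'c⟩ : ∃ s', 0 < s' ∧ s' < s ∧ 1 / s' < c := by
    have hc0 : 0 < c := (by positivity : 0 < 1 / s).trans hc
    have hlt : 1 / c < s := by rwa [one_div_lt hc0 hs]
    obtain ⟨s', h1, h2⟩ := exists_between hlt
    have h0 : 0 < s' := (by positivity : 0 < 1 / c).trans h1
    exact ⟨s', h0, h2, by rwa [one_div_lt h0 hc0]⟩
  set K := ∑ i ∈ Finset.range c₀, ψ i with hK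
  obtain ⟨r₀, hr₀⟩ := eventually_atTop.1 (eventually_mul_le_sum hs's h)
  have hbig : ∀ᶠ n : ℕ in atTop, (K / s' + J) / (c - 1 / s') ≤ n :=
    tendsto_natCast_atTop_atTop.eventually_ge_atTop _
  filter_upwards [ha.eventually_ge_atTop ((r₀ + c₀ + J : ℕ) : ℤ), hbig, eventually_gt_atTop 0] with
    n hn hnb hn0
  have hn0' : (0 : ℝ) < n := by exact_mod_cast hn0
  obtain ⟨r, hr⟩ : ∃ r : ℕ, (r : ℤ) + J = (a n).1 := ⟨((a n).1 - J).toNat, by push_cast at hn; omega⟩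
  have hrr : r₀ ≤ r := by push_cast at hn; omega
  have hrc : c₀ ≤ r := by push_cast at hn; omega
  have h1 := sum_visitsBefore_le (a := a) (c₀ := c₀) (J := J) n r (by omega)
  have h2 : ∑ i ∈ Finset.Ico c₀ r, ψ i ≤ n := by
    have h3 : ENNReal.ofReal (∑ i ∈ Finset.Ico c₀ r, ψ i) ≤ n := by
      rw [ENNReal.ofReal_sum_of_nonneg fun i _ => hψ i]
      exact (Finset.sum_le_sum fun i hi => hv i (Finset.mem_Ico.1 hi).1).trans h1
    have := ENNReal.toReal_mono (by simp) h3
    rwa [ENNReal.toReal_ofReal (Finset.sum_nonneg fun i _ => hψ i), ENNReal.toReal_natCast] at this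
  have h3 := hr₀ r hrr
  rw [← Finset.sum_range_add_sum_Ico _ hrc] at h3
  have h4 : ((a n).1 : ℝ) = r + J := by exact_mod_cast hr.symm
  rw [h4, div_le_iff₀ hn0']
  have h5 : (r : ℝ) ≤ (n + K) / s' := by
    rw [le_div_iff₀ hs'0]
    linarith
  have h6 : K / s' + J ≤ n * (c - 1 / s') := by
    rwa [div_le_iff₀ (by linarith)] at hnb
  have h7 : (n + K) / s' = n * (1 / s') + K / s' := by ring
  nlinarith

lemma exists_eq_of_abs_sub_le_one {x : ℕ → ℤ} (hx : ∀ n, |x (n + 1) - x n| ≤ 1) {k n : ℕ}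
    (hkn : k ≤ n) {i : ℤ} (h1 : i ≤ x k) (h2 : x n ≤ i) : ∃ l, k ≤ l ∧ l ≤ n ∧ x l = i := by
  induction n, hkn using Nat.le_induction with
  | base => exact ⟨k, le_rfl, le_rfl, by omega⟩
  | succ n hkn ih =>
    by_cases h : x n ≤ i
    · obtain ⟨l, hl1, hl2, hl3⟩ := ih h
      exact ⟨l, hl1, by omega, hl3⟩
    · have := hx n
      rw [abs_le] at this
      exact ⟨n + 1, by omega, le_rfl, by omega⟩

/-- The largest column among the first `n + 1` positions. -/
def maxColumn (a : ℕ → V) (n : ℕ) : ℕ := (Finset.range (n + 1)).sup fun k => (a k).1.toNat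

lemma le_maxColumn (a : ℕ → V) {k n : ℕ} (h : k ≤ n) : (a k).1 ≤ maxColumn a n := by
  have := Finset.le_sup (f := fun k => (a k).1.toNat) (Finset.mem_range.2 (Nat.lt_succ_of_le h))
  change (a k).1.toNat ≤ maxColumn a n at this
  omega

lemma exists_eq_maxColumn (a : ℕ → V) (h0 : (a 0).1 = 0) (n : ℕ) :
    ∃ k ≤ n, (a k).1 = maxColumn a n := by
  obtain ⟨k, hk, h⟩ := Finset.exists_mem_eq_sup (Finset.range (n + 1)) ⟨0, by simp⟩
    fun k => (a k).1.toNat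
  have hk' : k ≤ n := by have := Finset.mem_range.1 hk; omega
  change maxColumn a n = _ at h
  by_cases hpos : 0 ≤ (a k).1
  · exact ⟨k, hk', by omega⟩
  · exact ⟨0, Nat.zero_le n, by omega⟩

lemma visitsBefore_add_one_le {i : ℤ} {k l : ℕ} (hkl : k ≤ l) (hk : i + J ≤ (a k).1)
    (hl : (a l).1 = i) : visitsBefore a i J + 1 ≤ visits a i := by
  classical
  have h1 : (1 : ℝ≥0∞) = ∑' n, if n = l then 1 else 0 := by simp
  rw [h1, visitsBefore, ← ENNReal.tsum_add]
  refine ENNReal.tsum_le_tsum fun n => ?_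
  by_cases hn : n = l
  · subst hn
    rw [if_pos rfl, if_pos hl, if_neg, zero_add]
    rintro ⟨_, h⟩
    have := h k hkl
    omega
  · rw [if_neg hn, add_zero]
    by_cases h : (a n).1 = i
    · rw [if_pos h]; split_ifs <;> simp
    · rw [if_neg h, if_neg fun h' => h h'.1]

variable {φ : ℕ → ℝ}

/-- A lower bound for the speed. -/
lemma eventually_ge_of_visits (hψ : ∀ i, 0 ≤ ψ i) (hψφ : ∀ i, ψ i ≤ φ i)
    (hv : ∀ i : ℕ, c₀ ≤ i → visits a i = ENNReal.ofReal (φ i))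
    (hvJ : ∀ i : ℕ, c₀ ≤ i → visitsBefore a i J = ENNReal.ofReal (ψ i)) {F FJ : ℝ}
    (hF : Tendsto (fun n : ℕ => (∑ i ∈ Finset.range n, φ i) / n) atTop (𝓝 F))
    (hFJ : Tendsto (fun n : ℕ => (∑ i ∈ Finset.range n, ψ i) / n) atTop (𝓝 FJ))
    (h0 : (a 0).1 = 0) (hstep : ∀ n, |(a (n + 1)).1 - (a n).1| ≤ 1)
    (ha : Tendsto (fun n => (a n).1) atTop atTop) (hF0 : 0 < F) {c : ℝ} (hc0 : 0 ≤ c)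
    (hc : c < (1 - (F - FJ)) / F) :
    ∀ᶠ n : ℕ in atTop, c ≤ ((a n).1 : ℝ) / n := by
  classical
  -- The inner δ's absorb the errors in the two averages, and the last one the bounded terms
  -- collected in B.
  obtain ⟨δ, hδ0, hδ⟩ : ∃ δ : ℝ, 0 < δ ∧ c < (1 - (F - FJ + δ)) / (F + δ) - δ := by
    have ht : Tendsto (fun δ : ℝ => (1 - (F - FJ + δ)) / (F + δ) - δ) (𝓝[>] 0)
        (𝓝 ((1 - (F - FJ + 0)) / (F + 0) - 0)) := by
      have hcont : ContinuousAt (fun δ : ℝ => (1 - (F - FJ + δ)) / (F + δ) - δ) 0 := by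
        refine ContinuousAt.sub (ContinuousAt.div ?_ ?_ (by simpa using hF0.ne')) continuousAt_id
        · fun_prop
        · fun_prop
      exact hcont.tendsto.mono_left nhdsWithin_le_nhds
    rw [add_zero, add_zero, sub_zero] at ht
    obtain ⟨δ, h1, h2⟩ := ((ht.eventually (lt_mem_nhds hc)).and self_mem_nhdsWithin).exists
    exact ⟨δ, h2, h1⟩
  set η := F - FJ + δ with hη
  have hFδ : 0 < F + δ := by linarith
  have hη1 : 0 < 1 - η := by
    have : 0 < (1 - η) / (F + δ) := by linarith
    exact (div_pos_iff_of_pos_right hFδ).1 this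
  have hD : Tendsto (fun n : ℕ => (∑ i ∈ Finset.range n, (φ i - ψ i)) / n) atTop (𝓝 (F - FJ)) := by
    refine (hF.sub hFJ).congr fun n => ?_
    rw [Finset.sum_sub_distrib, sub_div]
  obtain ⟨r₁, hr₁⟩ := eventually_atTop.1 (eventually_sum_le_mul (s' := F + δ) (by linarith) hF)
  obtain ⟨r₂, hr₂⟩ := eventually_atTop.1 (eventually_sum_le_mul (s' := η) (by linarith) hD)
  -- In the columns before c₀ nothing is known about the numbers of visits, but the total time spent
  -- there is finite.
  have hfin : {k | (a k).1 < c₀}.Finite := by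
    obtain ⟨N, hN⟩ := eventually_atTop.1 (ha.eventually_ge_atTop (c₀ : ℤ))
    refine (Set.finite_lt_nat N).subset fun k hk => ?_
    by_contra hcon
    have h1 := hN k (not_lt.1 hcon)
    have h2 : (a k).1 < c₀ := hk
    omega
  set T := hfin.toFinset.card with hT
  set B := (1 - η) * (T / (F + δ) + 1) + J + |η| with hB
  have hbig : ∀ᶠ n : ℕ in atTop, B / δ ≤ n := tendsto_natCast_atTop_atTop.eventually_ge_atTop _
  filter_upwards [ha.eventually_ge_atTop ((r₁ + r₂ + c₀ : ℕ) : ℤ), hbig, eventually_gt_atTop 0] with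
    n hn hnb hn0
  have hn0' : (0 : ℝ) < n := by exact_mod_cast hn0
  set R := maxColumn a n with hR
  have hRn : (a n).1 ≤ R := le_maxColumn a le_rfl
  have hRr₁ : r₁ ≤ R + 1 := by push_cast at hn; omega
  have hRr₂ : r₂ ≤ R + 1 := by push_cast at hn; omega
  have hncast : (c₀ : ℤ) ≤ (a n).1 := by push_cast at hn; omega
  have hφ0 : ∀ i, 0 ≤ φ i := fun i => (hψ i).trans (hψφ i)
  -- the time spent up to time `n`
  have htime : (n : ℝ) ≤ T + ∑ i ∈ Finset.range (R + 1), φ i := by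
    have h1 : (n : ℝ≥0∞) ≤ T + ∑ i ∈ Finset.Ico c₀ (R + 1), visits a i := by
      have h2 : ∀ k ∈ Finset.range n, (1 : ℝ≥0∞) ≤ (if k ∈ hfin.toFinset then 1 else 0) +
          ∑ i ∈ Finset.Ico c₀ (R + 1), if (a k).1 = (i : ℤ) then 1 else 0 := by
        intro k hk
        by_cases hkc : (a k).1 < c₀
        · rw [if_pos (hfin.mem_toFinset.2 hkc)]
          exact le_self_add
        · have hkR : (a k).1 ≤ R := le_maxColumn a (Finset.mem_range.1 hk).le
          have hmem : (a k).1.toNat ∈ Finset.Ico c₀ (R + 1) := by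
            rw [Finset.mem_Ico]; omega
          have h3 := Finset.single_le_sum (f := fun i : ℕ => if (a k).1 = (i : ℤ) then
            (1 : ℝ≥0∞) else 0) (fun _ _ => zero_le) hmem
          rw [if_pos (by omega)] at h3
          exact h3.trans le_add_self
      calc (n : ℝ≥0∞) = ∑ k ∈ Finset.range n, 1 := by simp
        _ ≤ _ := Finset.sum_le_sum h2
        _ = ∑ k ∈ Finset.range n, (if k ∈ hfin.toFinset then (1 : ℝ≥0∞) else 0) +
            ∑ i ∈ Finset.Ico c₀ (R + 1), ∑ k ∈ Finset.range n,
              if (a k).1 = (i : ℤ) then 1 else 0 := by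
            rw [Finset.sum_add_distrib, Finset.sum_comm]
        _ ≤ _ := by
            refine add_le_add ?_ (Finset.sum_le_sum fun i _ => ENNReal.sum_le_tsum _)
            rw [← Finset.sum_filter, Finset.sum_const, nsmul_eq_mul, mul_one]
            exact_mod_cast Finset.card_le_card fun k hk => (Finset.mem_filter.1 hk).2
    have h2 : ∑ i ∈ Finset.Ico c₀ (R + 1), visits a i =
        ENNReal.ofReal (∑ i ∈ Finset.Ico c₀ (R + 1), φ i) := by
      rw [ENNReal.ofReal_sum_of_nonneg fun i _ => hφ0 i]
      exact Finset.sum_congr rfl fun i hi => hv i (Finset.mem_Ico.1 hi).1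
    rw [h2] at h1
    have h3 := ENNReal.toReal_mono (by finiteness) h1
    rw [ENNReal.toReal_add (by finiteness) (by finiteness),
      ENNReal.toReal_ofReal (Finset.sum_nonneg fun i _ => hφ0 i), ENNReal.toReal_natCast,
      ENNReal.toReal_natCast] at h3
    refine h3.trans (add_le_add le_rfl ?_)
    refine Finset.sum_le_sum_of_subset_of_nonneg (fun i hi => ?_) fun i _ _ => hφ0 i
    exact Finset.mem_range.2 (Finset.mem_Ico.1 hi).2
  -- the columns which are visited again after the maximum
  have hback : (R : ℝ) - J - (a n).1 ≤ ∑ i ∈ Finset.range (R + 1), (φ i - ψ i) := by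
    obtain ⟨k, hkn, hk⟩ := exists_eq_maxColumn a h0 n
    obtain ⟨x, hx⟩ : ∃ x : ℕ, (a n).1 = x := ⟨(a n).1.toNat, by omega⟩
    -- On the way back from the maximum each such column is hit after column i + J has been reached,
    -- a visit that `visitsBefore` does not count.
    have h1 : ∀ i ∈ Finset.Ico x (R - J), 1 ≤ φ i - ψ i := by
      intro i hi
      rw [Finset.mem_Ico] at hi
      obtain ⟨l, hl1, _, hl3⟩ := exists_eq_of_abs_sub_le_one (x := fun n => (a n).1) hstep hkn
        (i := i) (by simp only [hk]; omega) (by simp only [hx]; omega)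
      have h2 := visitsBefore_add_one_le (J := J) hl1 (by rw [hk]; omega) hl3
      rw [hv i (by omega), hvJ i (by omega), ← ENNReal.ofReal_one,
        ← ENNReal.ofReal_add (hψ i) zero_le_one, ENNReal.ofReal_le_ofReal_iff (hφ0 i)] at h2
      linarith
    calc (R : ℝ) - J - (a n).1 ≤ (Finset.Ico x (R - J)).card := by
          rw [Nat.card_Ico, hx]
          have : R ≤ (R - J - x) + J + x := by omega
          have h2 : (R : ℝ) ≤ ((R - J - x : ℕ) : ℝ) + J + x := by exact_mod_cast this
          push_cast
          linarith
      _ = ∑ i ∈ Finset.Ico x (R - J), (1 : ℝ) := by simp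
      _ ≤ ∑ i ∈ Finset.Ico x (R - J), (φ i - ψ i) := Finset.sum_le_sum h1
      _ ≤ _ := by
          refine Finset.sum_le_sum_of_subset_of_nonneg (fun i hi => ?_) fun i _ _ => ?_
          · rw [Finset.mem_Ico] at hi
            exact Finset.mem_range.2 (by omega)
          · linarith [hψφ i]
  -- Up to bounded terms, n ≤ (F + δ) R and R - (a n).1 ≤ η R; hence (a n).1 is at least (1 - η) /
  -- (F + δ) · n.
  have e1 := htime.trans (add_le_add le_rfl (hr₁ (R + 1) hRr₁))
  have e2 := hback.trans (hr₂ (R + 1) hRr₂)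
  push_cast at e1 e2
  have e3 : (n : ℝ) / (F + δ) ≤ T / (F + δ) + 1 + R := by
    rw [div_le_iff₀ hFδ]
    have : (T / (F + δ) + 1 + R) * (F + δ) = T + (F + δ) * (R + 1) := by
      field_simp
      ring
    linarith
  have e4 : B ≤ δ * n := by rwa [div_le_iff₀ hδ0, mul_comm] at hnb
  have e5 := mul_le_mul_of_nonneg_left e3 hη1.le
  have e6 : (1 - η) * (n / (F + δ)) = (1 - η) / (F + δ) * n := by ring
  have e7 : (c + δ) * n ≤ (1 - η) / (F + δ) * n :=
    mul_le_mul_of_nonneg_right (by linarith) hn0'.le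
  have e8 := le_abs_self η
  rw [le_div_iff₀ hn0']
  nlinarith

end Deterministic

/-! ### Visits to a column as a stationary sequence -/

/-- The number of visits to column `0` of the walk in the network to the right of the nearest
cut. -/
def colVisits (z : Config × Stacks) : ℝ≥0∞ := visits (walk (rightNet z.1) z.2 (entry z.1)) 0

/-- The number of these visits before column `J` is reached. -/
def colVisitsBefore (J : ℕ) (z : Config × Stacks) : ℝ≥0∞ :=
  visitsBefore (walk (rightNet z.1) z.2 (entry z.1)) 0 J

lemma measurableSet_isCut (i : ℤ) : MeasurableSet {ω : Config | IsCut ω i} :=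
  (measurableSet_edge _ _).inter (measurableSet_edge _ _)

lemma measurable_cutDist : Measurable cutDist := by
  refine measurable_to_countable' fun d => ?_
  -- The second piece covers configurations without a cut on the left, for which the infimum
  -- defaults to 0.
  have : cutDist ⁻¹' {d} = ({ω | IsCut ω (-(d : ℤ))} ∩ ⋂ k : ℕ, ⋂ (_ : k < d),
      {ω | IsCut ω (-(k : ℤ))}ᶜ) ∪ ({_ω | d = 0} ∩ ⋂ k : ℕ, {ω | IsCut ω (-(k : ℤ))}ᶜ) := by
    ext ω
    simp only [Set.mem_preimage, Set.mem_singleton_iff, Set.mem_union, Set.mem_inter_iff,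
      Set.mem_ofPred_eq, Set.mem_iInter, Set.mem_compl_iff]
    by_cases hne : ∃ k : ℕ, IsCut ω (-(k : ℤ))
    · have hno : ¬ ∀ k : ℕ, ¬ IsCut ω (-(k : ℤ)) := fun h => hne.elim h
      simp only [hno, and_false, or_false]
      constructor
      · rintro rfl
        exact ⟨Nat.sInf_mem (s := {d : ℕ | IsCut ω (-d)}) hne, fun k hk => Nat.notMem_of_lt_sInf hk⟩
      · rintro ⟨h1, h2⟩
        refine le_antisymm (Nat.sInf_le h1) (le_csInf hne fun k hk => ?_)
        by_contra hcon
        exact h2 k (not_le.1 hcon) hk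
    · have hall : ∀ k : ℕ, ¬ IsCut ω (-(k : ℤ)) := fun k hk => hne ⟨k, hk⟩
      have hempty : {d : ℕ | IsCut ω (-d)} = ∅ := Set.eq_empty_of_forall_notMem hall
      have hD : cutDist ω = 0 := by rw [cutDist, hempty, Nat.sInf_empty]
      simp only [hD, hall, false_or, not_false_eq_true, implies_true, and_true]
      exact eq_comm
  rw [this]
  exact ((measurableSet_isCut _).inter (MeasurableSet.iInter fun k => MeasurableSet.iInter fun _ =>
    (measurableSet_isCut _).compl)).union ((MeasurableSet.const _).inter
      (MeasurableSet.iInter fun k => (measurableSet_isCut _).compl))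

lemma measurable_cutOff (m : ℤ) : Measurable (cutOff m) := by
  refine measurable_pi_lambda _ fun e => ?_
  exact (measurable_of_countable fun b : Bool => b && decide (2 * m ≤ pos e)).comp
    (measurable_pi_apply e)

lemma measurable_walk_rightNet :
    Measurable fun z : Config × Stacks => walk (rightNet z.1) z.2 (entry z.1) := by
  refine measurable_pi_lambda _ fun n => measurable_to_countable' fun v => ?_
  have : (fun z : Config × Stacks => walk (rightNet z.1) z.2 (entry z.1) n) ⁻¹' {v} =
      ⋃ d : ℕ, {z | cutDist z.1 = d} ∩
        {z | walk (cutOff (-(d : ℤ)) z.1) z.2 (-(d : ℤ), 0) n = v} := by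
    ext z
    simp [rightNet, entry]
  rw [this]
  refine MeasurableSet.iUnion fun d => MeasurableSet.inter ?_ ?_
  · exact (measurable_cutDist.comp measurable_fst) (measurableSet_singleton d)
  · have h : Measurable fun z : Config × Stacks => (cutOff (-(d : ℤ)) z.1, z.2) :=
      ((measurable_cutOff _).comp measurable_fst).prodMk measurable_snd
    exact ((measurable_walk (-(d : ℤ), 0) n).comp h) (measurableSet_singleton v)

lemma measurable_colVisits : Measurable colVisits :=
  (measurable_visits 0).comp measurable_walk_rightNet

lemma measurable_colVisitsBefore (J : ℕ) : Measurable (colVisitsBefore J) :=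
  (measurable_visitsBefore 0 J).comp measurable_walk_rightNet

lemma isCut_shiftConfig (k i : ℤ) (ω : Config) : IsCut (shiftConfig k ω) i ↔ IsCut ω (i + k) := by
  simp [IsCut, shiftConfig]

lemma visits_shiftVertex (a : ℕ → V) (k : ℤ) :
    visits (fun n => shiftVertex k (a n)) k = visits a 0 := by
  classical
  refine tsum_congr fun n => ?_
  simp [shiftVertex]

lemma visitsBefore_shiftVertex (a : ℕ → V) (k : ℤ) (J : ℕ) :
    visitsBefore (fun n => shiftVertex k (a n)) k J = visitsBefore a 0 J := by
  classical
  refine tsum_congr fun n => ?_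
  have : ∀ x : ℤ, x + k < k + J ↔ x < 0 + J := fun x => by omega
  simp [shiftVertex, this]

lemma walk_rightNet_shift (ω : Config) (ξ : Stacks) (i : ℤ) (n : ℕ) :
    shiftVertex i (walk (rightNet (shiftConfig i ω)) (shiftStack i ξ) (entry (shiftConfig i ω)) n) =
      walk (cutOff (i - cutDist (shiftConfig i ω)) ω) ξ (i - cutDist (shiftConfig i ω), 0) n := by
  rw [rightNet, cutOff_shiftConfig, walk_shift, entry, shiftVertex]
  simp only
  rw [neg_add_eq_sub]

section Link

variable {ω : Config} {ξ : Stacks} {c₀ : ℤ} (hc₀ : 0 < c₀) (hc : IsCut ω c₀)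
  (hX : Tendsto (fun n => (walk ω ξ (0, 0) n).1) atTop atTop) {i : ℤ} (hi : c₀ ≤ i)

-- Since c₀ is a cut, the nearest cut to the left of i is not further left than c₀. It therefore
-- lies to the right of the origin, as the trace argument requires.
include hc hi in
lemma isCut_sub_cutDist : IsCut ω (i - cutDist (shiftConfig i ω)) ∧
    c₀ ≤ i - cutDist (shiftConfig i ω) := by
  have hmem : IsCut (shiftConfig i ω) (-((i - c₀).toNat : ℤ)) := by
    rw [isCut_shiftConfig, show -((i - c₀).toNat : ℤ) + i = c₀ by omega]
    exact hc
  have h1 := Nat.sInf_mem (s := {d : ℕ | IsCut (shiftConfig i ω) (-d)}) ⟨_, hmem⟩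
  have h2 : cutDist (shiftConfig i ω) ≤ (i - c₀).toNat := Nat.sInf_le hmem
  refine ⟨?_, by omega⟩
  have h3 := (isCut_shiftConfig i _ ω).1 h1
  rw [neg_add_eq_sub] at h3
  exact h3

include hX in
lemma infinite_of_tendsto (m : ℤ) : {k | m ≤ (walk ω ξ (0, 0) k).1}.Infinite := by
  refine Set.infinite_of_not_bddAbove fun ⟨B, hB⟩ => ?_
  obtain ⟨n, h1, h2⟩ := ((hX.eventually_ge_atTop m).and (eventually_gt_atTop B)).exists
  exact absurd (hB h1) (not_le.2 h2)

include hc₀ hc hX hi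

/-- The nearest cut to the left of column i separates it from the origin, so the visits are those of
the trace there, and they form one fixed function along the column shift. Escape to the right
ensures that the trace is an infinite walk. -/
lemma visits_eq_colVisits :
    visits (walk ω ξ (0, 0)) i = colVisits (jointShift i (ω, ξ)) := by
  obtain ⟨h1, h2⟩ := isCut_sub_cutDist hc hi
  rw [← visits_cutOff h1 (y := (0, 0)) (by simp; omega) (infinite_of_tendsto hX _) (by omega),
    colVisits, ← visits_shiftVertex _ i]
  congr 1
  funext n
  exact (walk_rightNet_shift ω ξ i n).symm

lemma visitsBefore_eq_colVisitsBefore (J : ℕ) :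
    visitsBefore (walk ω ξ (0, 0)) i J = colVisitsBefore J (jointShift i (ω, ξ)) := by
  obtain ⟨h1, h2⟩ := isCut_sub_cutDist hc hi
  rw [← visitsBefore_cutOff h1 (y := (0, 0)) (by simp; omega) (infinite_of_tendsto hX _) (by omega),
    colVisitsBefore, ← visitsBefore_shiftVertex _ i]
  congr 1
  funext n
  exact (walk_rightNet_shift ω ξ i n).symm

end Link

/-! ### Transience -/

/-- The Green function is bounded and the reversible measure decays geometrically to the left, so
the expected time spent in all columns up to M is finite. -/
lemma ae_tendsto_walk {lam : ℝ} (hl : 0 < lam) {ω : Config} {m : ℤ} (hm : m ≤ 0)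
    (h : ToInfty ω m (0, 0)) :
    ∀ᵐ ξ ∂(stackLaw lam), Tendsto (fun n => (walk ω ξ (0, 0) n).1) atTop atTop := by
  classical
  have key : ∀ M : ℤ, ∀ᵐ ξ ∂(stackLaw lam), {n | (walk ω ξ (0, 0) n).1 ≤ M}.Finite := by
    intro M
    have hmeas : ∀ k : ℕ, Measurable fun ξ : Stacks => visits (walk ω ξ (0, 0)) (M - k) := fun k =>
      (measurable_visits _).comp (measurable_walk_right ω (0, 0))
    set C := resBound lam * Real.exp (-(2 * lam * m)) with hC
    have hC0 : 0 ≤ C := mul_nonneg (resBound_pos hl).le (Real.exp_pos _).le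
    have hbound : ∀ k : ℕ, ∫⁻ ξ, visits (walk ω ξ (0, 0)) (M - k) ∂(stackLaw lam) ≤
        ENNReal.ofReal (2 * (norm lam * Real.exp (2 * lam * M) * C) *
          Real.exp (-(2 * lam)) ^ k) := by
      intro k
      have hj : ∀ j : Fin 2, ∑' n, ENNReal.ofReal (heat lam ω n (0, 0) (M - k, j)) ≤
          ENNReal.ofReal (norm lam * Real.exp (2 * lam * M) * C * Real.exp (-(2 * lam)) ^ k) := by
        intro j
        rw [tsum_ofReal_heat hl (by simpa using hm) h]
        refine ENNReal.ofReal_le_ofReal ?_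
        calc _ ≤ revMeasure lam (M - k, j) * C :=
              mul_le_mul_of_nonneg_left (green_le hl (by simpa using hm) h _)
                (revMeasure_pos _ _).le
          _ = _ := by
              rw [revMeasure, ← Real.exp_nat_mul]
              have : Real.exp (2 * lam * ((M - k : ℤ) : ℝ)) =
                  Real.exp (2 * lam * M) * Real.exp (k * (-(2 * lam))) := by
                rw [← Real.exp_add]
                congr 1
                push_cast
                ring
              simp only [this]
              ring
      rw [lintegral_visits, Fin.sum_univ_two]
      refine (add_le_add (hj 0) (hj 1)).trans (le_of_eq ?_)
      have := norm_pos lam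
      rw [← ENNReal.ofReal_add (by positivity) (by positivity)]
      congr 1
      ring
    have hfin : ∫⁻ ξ, ∑' k : ℕ, visits (walk ω ξ (0, 0)) (M - k) ∂(stackLaw lam) ≠ ∞ := by
      rw [lintegral_tsum fun k => (hmeas k).aemeasurable]
      refine ne_top_of_le_ne_top ?_ (ENNReal.tsum_le_tsum hbound)
      exact ((summable_geometric_of_lt_one (Real.exp_pos _).le
        (exp_neg_two_mul_lt_one hl)).mul_left _).tsum_ofReal_ne_top
    filter_upwards [ae_lt_top (Measurable.tsum hmeas) hfin] with ξ hξ
    unfold visits at hξ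
    rw [ENNReal.tsum_comm] at hξ
    refine (ENNReal.finite_const_le_of_tsum_ne_top hξ.ne one_ne_zero).subset fun n hn => ?_
    have hn : (walk ω ξ (0, 0) n).1 ≤ M := hn
    have h1 := ENNReal.le_tsum (f := fun k : ℕ => if (walk ω ξ (0, 0) n).1 = M - k then
      (1 : ℝ≥0∞) else 0) (M - (walk ω ξ (0, 0) n).1).toNat
    rw [if_pos (by omega)] at h1
    exact h1
  have hall : ∀ᵐ ξ ∂(stackLaw lam), ∀ M : ℤ, {n | (walk ω ξ (0, 0) n).1 ≤ M}.Finite :=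
    ae_all_iff.2 key
  filter_upwards [hall] with ξ hξ
  refine tendsto_atTop.2 fun M => ?_
  have := (hξ M).eventually_cofinite_notMem
  rw [Nat.cofinite_eq_atTop] at this
  filter_upwards [this] with n hn
  exact (not_le.1 hn).le

/-! ### Measurability of the infinite cluster event -/

lemma measurableSet_reachable (v w : V) : MeasurableSet {ω : Config | (openGraph ω).Reachable v w} := by
  have hlen : ∀ (n : ℕ) (v : V),
      MeasurableSet {ω : Config | ∃ p : (openGraph ω).Walk v w, p.length = n} := by
    intro n
    induction n with
    | zero =>
      intro v
      by_cases h : v = w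
      · subst h
        convert MeasurableSet.univ
        ext ω
        simp only [Set.mem_ofPred_eq, Set.mem_univ, iff_true]
        exact ⟨SimpleGraph.Walk.nil, rfl⟩
      · convert MeasurableSet.empty
        ext ω
        simp only [Set.mem_ofPred_eq, Set.mem_empty_iff_false, iff_false]
        rintro ⟨p, hp⟩
        exact h (SimpleGraph.Walk.eq_of_length_eq_zero hp)
    | succ n ih =>
      intro v
      have : {ω : Config | ∃ p : (openGraph ω).Walk v w, p.length = n + 1} =
          ⋃ u, {ω | (openGraph ω).Adj v u} ∩ {ω | ∃ p : (openGraph ω).Walk u w, p.length = n} := by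
        ext ω
        simp only [Set.mem_ofPred_eq, Set.mem_iUnion, Set.mem_inter_iff]
        constructor
        · rintro ⟨p, hp⟩
          cases p with
          | nil => simp at hp
          | cons hadj p => exact ⟨_, hadj, p, by simpa using hp⟩
        · rintro ⟨u, hadj, p, hp⟩
          exact ⟨SimpleGraph.Walk.cons hadj p, by simp [hp]⟩
      rw [this]
      exact MeasurableSet.iUnion fun u => (measurableSet_adj v u).inter (ih u)
  have : {ω : Config | (openGraph ω).Reachable v w} =
      ⋃ n, {ω : Config | ∃ p : (openGraph ω).Walk v w, p.length = n} := by
    ext ω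
    simp only [Set.mem_ofPred_eq, Set.mem_iUnion]
    exact ⟨fun ⟨p⟩ => ⟨_, p, rfl⟩, fun ⟨_, p, _⟩ => ⟨p⟩⟩
  rw [this]
  exact MeasurableSet.iUnion fun n => hlen n v

lemma measurableSet_biInfinite : MeasurableSet biInfinite :=
  MeasurableSet.iInter fun N₁ => MeasurableSet.iInter fun N₂ => measurableSet_crossing N₁ N₂

lemma measurableSet_originInfinite : MeasurableSet originInfinite := by
  have hset : originInfinite = biInfinite ∩ {ω | (cluster ω (0, 0)).Infinite} := rfl
  have : {ω : Config | (cluster ω (0, 0)).Infinite} =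
      ⋂ M : ℕ, ⋃ (w : V) (_ : w ∉ box M), {ω | (openGraph ω).Reachable (0, 0) w} := by
    ext ω
    simp only [Set.mem_ofPred_eq, Set.mem_iInter, Set.mem_iUnion, exists_prop]
    constructor
    · intro h M
      by_contra hcon
      push Not at hcon
      refine h ((box M).finite_toSet.subset fun w hw => ?_)
      by_contra hw'
      exact hcon w hw' hw
    · intro h hfin
      obtain ⟨M, hM⟩ : ∃ M : ℕ, ∀ w ∈ cluster ω (0, 0), w ∈ box M := by
        refine ⟨∑ w ∈ hfin.toFinset, w.1.natAbs, fun w hw => ?_⟩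
        have := Finset.single_le_sum (f := fun w : V => w.1.natAbs) (fun _ _ => Nat.zero_le _)
          (hfin.mem_toFinset.2 hw)
        rw [mem_box, Int.abs_eq_natAbs]
        exact_mod_cast this
      obtain ⟨w, hw, hr⟩ := h M
      exact hw (hM w hr)
  rw [hset, this]
  exact measurableSet_biInfinite.inter (MeasurableSet.iInter fun M => MeasurableSet.iUnion fun w =>
    MeasurableSet.iUnion fun _ => measurableSet_reachable _ _)

/-! ### The speed of the walk -/

/-- The mean number of visits to a column. -/
def meanVisits (P : Measure Config) (lam : ℝ) : ℝ≥0∞ :=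
  ∫⁻ z, colVisits z ∂(P.prod (stackLaw lam))

/-- Truncating at J in both senses keeps the function integrable even when the mean number of visits
is infinite, so the ergodic theorem still applies. -/
lemma iSup_colVisitsBefore_min (z : Config × Stacks) :
    ⨆ J : ℕ, min (colVisitsBefore J z) J = colVisits z := by
  refine le_antisymm (iSup_le fun J => (min_le_left _ _).trans (visitsBefore_le _ _ _)) ?_
  rw [colVisits, ← iSup_visitsBefore]
  refine iSup_le fun J => ?_
  refine le_of_forall_lt fun c hc => ?_
  obtain ⟨n, hn⟩ := ENNReal.exists_nat_gt (ne_top_of_lt hc)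
  refine lt_of_lt_of_le ?_ (le_iSup _ (max J n))
  rw [lt_min_iff]
  exact ⟨hc.trans_le (visitsBefore_mono _ _ (le_max_left J n)),
    hn.trans_le (by exact_mod_cast le_max_right J n)⟩

lemma tendsto_lintegral_min (P : Measure Config) (lam : ℝ) :
    Tendsto (fun J : ℕ => ∫⁻ z, min (colVisitsBefore J z) J
    ∂(P.prod (stackLaw lam))) atTop (𝓝 (meanVisits P lam)) := by
  have hmono : Monotone fun (J : ℕ) (z : Config × Stacks) => min (colVisitsBefore J z) (J : ℝ≥0∞) :=
    fun J J' h z => min_le_min (visitsBefore_mono _ _ h) (by exact_mod_cast h)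
  have hm : ∀ J : ℕ, Measurable fun z => min (colVisitsBefore J z) (J : ℝ≥0∞) := fun J =>
    (measurable_colVisitsBefore J).min measurable_const
  have := tendsto_atTop_iSup (f := fun J : ℕ => ∫⁻ z, min (colVisitsBefore J z) (J : ℝ≥0∞)
    ∂(P.prod (stackLaw lam))) fun J J' h => lintegral_mono (hmono h)
  rwa [← lintegral_iSup hm hmono, lintegral_congr iSup_colVisitsBefore_min] at this

lemma tendsto_lintegral_colVisitsBefore (P : Measure Config) (lam : ℝ) :
    Tendsto (fun J : ℕ => ∫⁻ z, colVisitsBefore J z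
    ∂(P.prod (stackLaw lam))) atTop (𝓝 (meanVisits P lam)) := by
  have hmono : Monotone colVisitsBefore := fun J J' h z => visitsBefore_mono _ _ h
  have := tendsto_atTop_iSup (f := fun J : ℕ => ∫⁻ z, colVisitsBefore J z
    ∂(P.prod (stackLaw lam))) fun J J' h => lintegral_mono (hmono h)
  rwa [← lintegral_iSup measurable_colVisitsBefore hmono,
    lintegral_congr (f := fun z => ⨆ J, colVisitsBefore J z) fun z => iSup_visitsBefore _ 0] at this

section Speed

variable {p : unitInterval} (h0 : 0 < p) (h1 : p < 1) {P : Measure Config}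
  [IsProbabilityMeasure P] (hP : IsLocalLimit p P) {lam : ℝ} (hl : 0 < lam)

include h0 h1 hP

lemma ae_biInfinite : ∀ᵐ ω ∂P, ω ∈ biInfinite :=
  (mem_ae_iff_prob_eq_one measurableSet_biInfinite).2 (limit_biInfinite h0 h1 hP)

lemma measure_zero_of_noCut (S : Set Config)
    (hS : ∀ d : ℕ, ∃ i : ℤ, S ⊆ {ω | ∀ k : ℕ, k < d → ¬ IsCut ω (i - 2 * k)}) : P S = 0 := by
  obtain ⟨q, hq0, hq1, hq⟩ := exists_limit_noCut_le h0 h1 hP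
  have hle : ∀ d : ℕ, P.real S ≤ q ^ d := by
    intro d
    obtain ⟨i, hi⟩ := hS d
    exact (measureReal_mono hi).trans (hq d i)
  have hle0 : P.real S ≤ 0 :=
    ge_of_tendsto (tendsto_pow_atTop_nhds_zero_of_lt_one hq0 hq1) (Eventually.of_forall hle)
  exact (measureReal_eq_zero_iff).1 (le_antisymm hle0 measureReal_nonneg)

lemma ae_exists_isCut_left : ∀ᵐ ω ∂P, ∃ d : ℕ, IsCut ω (-d) := by
  refine ae_iff.2 (measure_zero_of_noCut h0 h1 hP _ fun d => ⟨0, fun ω hω k _ hk => hω ⟨2 * k, ?_⟩⟩)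
  push_cast
  simpa using hk

lemma ae_exists_isCut_right : ∀ᵐ ω ∂P, ∃ d : ℕ, 0 < d ∧ IsCut ω d := by
  refine ae_iff.2 (measure_zero_of_noCut h0 h1 hP _ fun d =>
    ⟨2 * d, fun ω hω k hk hcut => hω ⟨2 * d - 2 * k, by omega, ?_⟩⟩)
  push_cast [show 2 * k ≤ 2 * d by omega]
  exact hcut

lemma ae_isGood : ∀ᵐ ω ∂P, IsGood ω := by
  filter_upwards [ae_biInfinite h0 h1 hP, ae_exists_isCut_left h0 h1 hP] with ω h1 h2
  exact ⟨h1, h2⟩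

-- Integrate over the stacks first. In column 0 the reversible measure is just `norm lam`.
include hl in
lemma meanVisits_eq :
    meanVisits P lam = ∫⁻ ω, ENNReal.ofReal (norm lam * colGreen lam ω) ∂P := by
  rw [meanVisits, lintegral_prod _ measurable_colVisits.aemeasurable]
  refine lintegral_congr_ae ?_
  filter_upwards [ae_isGood h0 h1 hP] with ω hω
  simp only [colVisits]
  rw [lintegral_visits, colGreen, Finset.mul_sum, ENNReal.ofReal_sum_of_nonneg fun j _ =>
    mul_nonneg (norm_pos lam).le (hω.green_nonneg hl _)]
  refine Finset.sum_congr rfl fun j _ => ?_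
  rw [tsum_ofReal_heat hl le_rfl hω.toInfty_entry]
  simp [revMeasure]

/-- The ergodic theorem for functions of the environment and the stacks. -/
lemma ae_tendsto_average {g : Config × Stacks → ℝ} (hg : Integrable g (P.prod (stackLaw lam)))
    (hgm : Measurable g) : ∀ᵐ z ∂(P.prod (stackLaw lam)),
      Tendsto (fun n : ℕ => (∑ i ∈ Finset.range n, g (jointShift i z)) / n) atTop
        (𝓝 (∫ z, g z ∂(P.prod (stackLaw lam)))) := by
  filter_upwards [ae_tendsto_birkhoffSum_div (ergodic_jointShift h0 h1 hP lam) hg hgm] with z hz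
  refine hz.congr fun n => ?_
  simp only [birkhoffSum, iterate_jointShift]

/-- Along almost every trajectory that escapes to the right, the speed is the inverse of the mean
number of visits to a column. -/
lemma ae_tendsto_speed (hF0 : meanVisits P lam ≠ 0) :
    ∀ᵐ z ∂(P.prod (stackLaw lam)), Tendsto (fun n => (walk z.1 z.2 (0, 0) n).1) atTop atTop →
      Tendsto (fun n : ℕ => ((walk z.1 z.2 (0, 0) n).1 : ℝ) / n) atTop
        (𝓝 (meanVisits P lam).toReal⁻¹) := by
  set ν := P.prod (stackLaw lam) with hν
  set F := meanVisits P lam with hF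
  -- the truncated numbers of visits
  have hmin_lt : ∀ (J : ℕ) z, min (colVisitsBefore J z) (J : ℝ≥0∞) < ∞ := fun J z =>
    (min_le_right _ _).trans_lt (ENNReal.natCast_lt_top J)
  have hminm : ∀ J : ℕ, Measurable fun z => min (colVisitsBefore J z) (J : ℝ≥0∞) := fun J =>
    (measurable_colVisitsBefore J).min measurable_const
  set s : ℕ → ℝ := fun J => ∫ z, (min (colVisitsBefore J z) (J : ℝ≥0∞)).toReal ∂ν with hs
  have hs_eq : ∀ J, s J = (∫⁻ z, min (colVisitsBefore J z) (J : ℝ≥0∞) ∂ν).toReal := fun J =>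
    integral_toReal (hminm J).aemeasurable (Eventually.of_forall (hmin_lt J))
  have hmin_fin : ∀ J : ℕ, ∫⁻ z, min (colVisitsBefore J z) (J : ℝ≥0∞) ∂ν ≠ ∞ := by
    intro J
    refine ne_top_of_le_ne_top (ENNReal.natCast_ne_top J) ?_
    calc _ ≤ ∫⁻ _, (J : ℝ≥0∞) ∂ν := lintegral_mono fun z => min_le_right _ _
      _ = J := by simp
  have hav : ∀ᵐ z ∂ν, ∀ J : ℕ, Tendsto (fun n : ℕ => (∑ i ∈ Finset.range n,
      (min (colVisitsBefore J (jointShift i z)) (J : ℝ≥0∞)).toReal) / n) atTop (𝓝 (s J)) :=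
    ae_all_iff.2 fun J => ae_tendsto_average h0 h1 hP
      (integrable_toReal_of_lintegral_ne_top (hminm J).aemeasurable (hmin_fin J))
      (hminm J).ennreal_toReal
  have hcut : ∀ᵐ z ∂ν, ∃ d : ℕ, 0 < d ∧ IsCut z.1 d :=
    Measure.quasiMeasurePreserving_fst.ae (ae_exists_isCut_right h0 h1 hP)
  -- The truncated means increase to F. For F = ∞ the left side is 0 by convention, in agreement
  -- with the means being unbounded.
  have hslim : ∀ c : ℝ, F.toReal⁻¹ < c → ∃ J, 0 < s J ∧ 1 / s J < c := by
    intro c hc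
    have hc0 : 0 < c := (inv_nonneg.2 ENNReal.toReal_nonneg).trans_lt hc
    have hlt : ENNReal.ofReal (1 / c) < F := by
      by_cases hFtop : F = ∞
      · rw [hFtop]; exact ENNReal.ofReal_lt_top
      · have hFpos : 0 < F.toReal := ENNReal.toReal_pos hF0 hFtop
        rw [ENNReal.ofReal_lt_iff_lt_toReal (by positivity) hFtop, one_div]
        rwa [inv_lt_comm₀ hc0 hFpos]
    obtain ⟨J, hJ⟩ := ((tendsto_lintegral_min P lam).eventually (lt_mem_nhds hlt)).exists
    have hJ' : 1 / c < s J := by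
      rw [hs_eq]
      exact (ENNReal.ofReal_lt_iff_lt_toReal (by positivity) (hmin_fin J)).1 hJ
    have hsJ : 0 < s J := (by positivity : 0 < 1 / c).trans hJ'
    exact ⟨J, hsJ, by rwa [one_div_lt hsJ hc0]⟩
  have hlower : ∀ᵐ z ∂ν, Tendsto (fun n => (walk z.1 z.2 (0, 0) n).1) atTop atTop →
      ∀ c : ℝ, c < F.toReal⁻¹ → ∀ᶠ n : ℕ in atTop, c < ((walk z.1 z.2 (0, 0) n).1 : ℝ) / n := by
    -- For infinite F only negative c are to be treated, and the position is eventually nonnegative.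
    by_cases hFtop : F = ∞
    · refine Eventually.of_forall fun z hz c hc => ?_
      rw [hFtop, ENNReal.toReal_top, inv_zero] at hc
      filter_upwards [hz.eventually_ge_atTop 0] with n hn
      have : (0 : ℝ) ≤ (walk z.1 z.2 (0, 0) n).1 := by exact_mod_cast hn
      exact hc.trans_le (by positivity)
    · have hFpos : 0 < F.toReal := ENNReal.toReal_pos hF0 hFtop
      have hmp := measurePreserving_jointShift hP lam
      have hfin : ∀ᵐ z ∂ν, ∀ i : ℕ, colVisits (jointShift i z) < ∞ := by
        refine ae_all_iff.2 fun i => ?_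
        have := (hmp.iterate i).quasiMeasurePreserving.ae (ae_lt_top measurable_colVisits hFtop)
        simpa only [iterate_jointShift] using this
      have hav1 : ∀ᵐ z ∂ν, Tendsto (fun n : ℕ => (∑ i ∈ Finset.range n,
          (colVisits (jointShift i z)).toReal) / n) atTop (𝓝 F.toReal) := by
        have := ae_tendsto_average (lam := lam) h0 h1 hP (g := fun z => (colVisits z).toReal)
          (integrable_toReal_of_lintegral_ne_top measurable_colVisits.aemeasurable hFtop)
          measurable_colVisits.ennreal_toReal
        rwa [integral_toReal measurable_colVisits.aemeasurable
          (ae_lt_top measurable_colVisits hFtop)] at this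
      have hJfin : ∀ J, ∫⁻ z, colVisitsBefore J z ∂ν ≠ ∞ := fun J =>
        ne_top_of_le_ne_top hFtop (lintegral_mono fun z => visitsBefore_le _ _ _)
      have hav2 : ∀ᵐ z ∂ν, ∀ J : ℕ, Tendsto (fun n : ℕ => (∑ i ∈ Finset.range n,
          (colVisitsBefore J (jointShift i z)).toReal) / n) atTop
          (𝓝 (∫⁻ z, colVisitsBefore J z ∂ν).toReal) := by
        refine ae_all_iff.2 fun J => ?_
        have := ae_tendsto_average (lam := lam) h0 h1 hP (g := fun z => (colVisitsBefore J z).toReal)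
          (integrable_toReal_of_lintegral_ne_top (measurable_colVisitsBefore J).aemeasurable
            (hJfin J)) (measurable_colVisitsBefore J).ennreal_toReal
        rwa [integral_toReal (measurable_colVisitsBefore J).aemeasurable
          (ae_lt_top (measurable_colVisitsBefore J) (hJfin J))] at this
      filter_upwards [hfin, hav1, hav2, hcut] with z hz1 hz2 hz3 hz4 hX c hc
      obtain ⟨d, hd0, hd⟩ := hz4
      obtain ⟨c', hc1, hc2⟩ := exists_between (max_lt hc (inv_pos.2 hFpos))
      -- As J grows, visits after an excursion of J columns become negligible, and the lower bound
      -- tends to 1 / F.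
      have hlimJ : Tendsto (fun J => (1 - (F.toReal - (∫⁻ z, colVisitsBefore J z ∂ν).toReal)) /
          F.toReal) atTop (𝓝 ((1 - (F.toReal - F.toReal)) / F.toReal)) :=
        (((((ENNReal.tendsto_toReal hFtop).comp
          (tendsto_lintegral_colVisitsBefore P lam)).const_sub _).const_sub _).div_const _)
      rw [sub_self, sub_zero, one_div] at hlimJ
      obtain ⟨J, hJ⟩ := (hlimJ.eventually (lt_mem_nhds hc2)).exists
      have hle : ∀ i : ℕ, colVisitsBefore J (jointShift i z) ≤ colVisits (jointShift i z) := fun i =>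
        visitsBefore_le _ _ _
      have hd0' : (0 : ℤ) < d := by exact_mod_cast hd0
      have := eventually_ge_of_visits (a := walk z.1 z.2 (0, 0)) (c₀ := d) (J := J)
        (φ := fun i => (colVisits (jointShift i z)).toReal)
        (ψ := fun i => (colVisitsBefore J (jointShift i z)).toReal)
        (fun i => ENNReal.toReal_nonneg)
        (fun i => ENNReal.toReal_mono (hz1 i).ne (hle i))
        (fun i hi => by
          rw [ENNReal.ofReal_toReal (hz1 i).ne]
          exact visits_eq_colVisits hd0' hd hX (by exact_mod_cast hi))
        (fun i hi => by
          rw [ENNReal.ofReal_toReal ((hle i).trans_lt (hz1 i)).ne]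
          exact visitsBefore_eq_colVisitsBefore hd0' hd hX (by exact_mod_cast hi) J)
        hz2 (hz3 J) rfl (abs_walk_succ_sub_le z.1 z.2 (0, 0)) hX hFpos
        ((le_max_right c 0).trans hc1.le) hJ
      filter_upwards [this] with n hn
      exact ((le_max_left c 0).trans_lt hc1).trans_le hn
  filter_upwards [hav, hcut, hlower] with z hz1 hz2 hz3 hX
  obtain ⟨d, hd0, hd⟩ := hz2
  have hd0' : (0 : ℤ) < d := by exact_mod_cast hd0
  refine tendsto_order.2 ⟨fun c hc => hz3 hX c hc, fun c hc => ?_⟩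
  obtain ⟨c', hc1, hc2⟩ := exists_between hc
  obtain ⟨J, hJ0, hJ⟩ := hslim c' hc1
  have := eventually_le_of_visitsBefore (a := walk z.1 z.2 (0, 0)) (c₀ := d) (J := J)
    (ψ := fun i => (min (colVisitsBefore J (jointShift i z)) (J : ℝ≥0∞)).toReal)
    (fun i => ENNReal.toReal_nonneg)
    (fun i hi => by
      rw [ENNReal.ofReal_toReal (hmin_lt J _).ne,
        visitsBefore_eq_colVisitsBefore hd0' hd hX (by exact_mod_cast hi) J]
      exact min_le_left _ _)
    (hz1 J) hX hJ0 hJ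
  filter_upwards [this] with n hn
  exact hn.trans_lt hc2

-- The origin lies in an infinite cluster, so it is joined to +∞ to the right of a cut and the walk
-- escapes. The conditioned environment is absolutely continuous with respect to P, so the almost
-- sure statement carries over.
include hl in
theorem hasSpeed (hF0 : meanVisits P lam ≠ 0) :
    HasSpeed (ProbabilityTheory.cond P originInfinite) lam (meanVisits P lam).toReal⁻¹ := by
  have hmeas : ∀ n : ℕ, Measurable fun y : ℕ → V => ((y n).1 : ℝ) / (n : ℝ) := fun n =>
    ((measurable_of_countable fun x : ℤ => (x : ℝ)).comp
      (measurable_fst.comp (measurable_pi_apply n))).div_const _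
  have hset : MeasurableSet {y : ℕ → V | Tendsto (fun n : ℕ => ((y n).1 : ℝ) / (n : ℝ)) atTop
      (𝓝 (meanVisits P lam).toReal⁻¹)} := measurableSet_tendsto _ hmeas
  refine Measure.ae_compProd_of_ae_ae (hset.preimage measurable_snd) ?_
  have hspeed := Measure.ae_ae_of_ae_prod (ae_tendsto_speed (lam := lam) h0 h1 hP hF0)
  have hac : ProbabilityTheory.cond P originInfinite ≪ P := cond_absolutelyContinuous
  filter_upwards [ae_cond_mem measurableSet_originInfinite, hac.ae_le hspeed,
    hac.ae_le (ae_isGood h0 h1 hP)] with ω hω hωs hωg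
  change ∀ᵐ y ∂(quenchedLaw lam (0, 0) ω), _
  rw [← map_walk, ae_map_iff (measurable_walk_right ω (0, 0)).aemeasurable hset]
  have hinf := toInfty_of_infinite hω.1 hωg.isCut (u := (0, 0)) (by simp) hω.2
  filter_upwards [hωs, ae_tendsto_walk hl (by simp) hinf] with ξ hξ1 hξ2
  exact hξ1 hξ2

end Speed

/-! ### Moments of the distance to the nearest cut and of the length of dead ends -/

section Moments

variable {p : unitInterval} (h0 : 0 < p) (h1 : p < 1) {P : Measure Config}
  [IsProbabilityMeasure P] (hP : IsLocalLimit p P)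

/-- A union bound: the integrand is one term of a series of indicators. No measurability of X is
needed, only of the events A n. -/
lemma lintegral_le_tsum_of_nat {X : Config → ℕ} {A : ℕ → Set Config} {w : ℕ → ℝ}
    (hA : ∀ n, MeasurableSet (A n)) (hX : ∀ᵐ ω ∂P, ω ∈ A (X ω)) {b : ℕ → ℝ} (hw : ∀ n, 0 ≤ w n)
    (hb : ∀ n, w n * P.real (A n) ≤ b n) (hsum : Summable b) :
    ∫⁻ ω, ENNReal.ofReal (w (X ω)) ∂P ≠ ∞ := by
  have hle : ∫⁻ ω, ENNReal.ofReal (w (X ω)) ∂P ≤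
      ∫⁻ ω, ∑' n, (A n).indicator (fun _ => ENNReal.ofReal (w n)) ω ∂P := by
    refine lintegral_mono_ae ?_
    filter_upwards [hX] with ω hω
    refine le_trans (le_of_eq ?_) (ENNReal.le_tsum (X ω))
    rw [Set.indicator_of_mem hω]
  refine ne_top_of_le_ne_top ?_ hle
  rw [lintegral_tsum fun n => (measurable_const.indicator (hA n)).aemeasurable]
  refine ne_top_of_le_ne_top hsum.tsum_ofReal_ne_top (ENNReal.tsum_le_tsum fun n => ?_)
  rw [lintegral_indicator_const (hA n), ← ofReal_measureReal (μ := P), ← ENNReal.ofReal_mul (hw n)]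
  exact ENNReal.ofReal_le_ofReal (hb n)

include h0 h1 hP

lemma lintegral_exp_plainLen {l : ℝ} (hl : l < criticalBias p) :
    ∫⁻ ω, ENNReal.ofReal (Real.exp (2 * l * plainLen ω)) ∂P ≠ ∞ := by
  obtain ⟨C, hC, h⟩ := exists_limit_plainRun_le h0 h1 hP
  have hx : Real.exp (2 * (l - criticalBias p)) < 1 := Real.exp_lt_one_iff.2 (by linarith)
  refine lintegral_le_tsum_of_nat (X := plainLen) (A := fun n => plainRun (-n) n)
    (w := fun n => Real.exp (2 * l * n))
    (fun n => (plainRun_dependsOn _ _).measurableSet_config) (Eventually.of_forall fun ω => ?_)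
    (fun n => (Real.exp_pos _).le)
    (fun n => (mul_le_mul_of_nonneg_left (h n) (Real.exp_pos _).le).trans (le_of_eq ?_))
    ((summable_geometric_of_lt_one (Real.exp_pos _).le hx).mul_left C)
  · intro i hi hi'
    by_contra hcon
    have h1 : (-i).toNat < plainLen ω := by omega
    refine Nat.notMem_of_lt_sInf h1 ?_
    change ¬ IsPlain ω (-((-i).toNat : ℤ))
    rwa [show -((-i).toNat : ℤ) = i by omega]
  · rw [← Real.exp_nat_mul, ← Real.exp_nat_mul, mul_left_comm, ← Real.exp_add]
    congr 2
    ring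

lemma exists_lintegral_exp_cutDist : ∃ κ : ℝ, 0 < κ ∧
    ∫⁻ ω, ENNReal.ofReal (Real.exp (κ * cutDist ω)) ∂P ≠ ∞ := by
  obtain ⟨q, hq0, hq1, h⟩ := exists_limit_noCut_le h0 h1 hP
  -- Distance n to the nearest cut rules out (n + 1) / 2 cuts at even distances, so the tail is at
  -- most q ^ ((n + 1) / 2) ≤ r ^ n. The maximum with 1 / 2 keeps r positive, so that some x with 1
  -- < x < 1 / r exists.
  set r := max (Real.sqrt q) (1 / 2) with hr
  have hr0 : 0 < r := lt_max_of_lt_right (by norm_num)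
  have hr1 : r < 1 := max_lt ((Real.sqrt_lt' one_pos).2 (by simpa using hq1)) (by norm_num)
  have hqr : q ≤ r ^ 2 := by
    calc q = Real.sqrt q ^ 2 := (Real.sq_sqrt hq0).symm
      _ ≤ r ^ 2 := pow_le_pow_left₀ (Real.sqrt_nonneg q) (le_max_left _ _) 2
  obtain ⟨x, hx1, hx2⟩ := exists_between (one_lt_inv₀ hr0 |>.2 hr1)
  have hx0 : 0 < x := one_pos.trans hx1
  have hxr : x * r < 1 := by
    have := mul_lt_mul_of_pos_right hx2 hr0
    rwa [inv_mul_cancel₀ hr0.ne'] at this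
  refine ⟨Real.log x, Real.log_pos hx1, ?_⟩
  have hm : ∀ n : ℕ, MeasurableSet {ω : Config | ∀ k : ℕ, k < (n + 1) / 2 →
      ¬ IsCut ω (0 - 2 * k)} := by
    intro n
    simp only [Set.ofPred_forall]
    exact MeasurableSet.iInter fun k => MeasurableSet.iInter fun _ => (measurableSet_isCut _).compl
  refine lintegral_le_tsum_of_nat (X := cutDist)
    (A := fun n => {ω | ∀ k : ℕ, k < (n + 1) / 2 → ¬ IsCut ω (0 - 2 * k)})
    (w := fun n => Real.exp (Real.log x * n)) hm (Eventually.of_forall fun ω k hk hcut => ?_)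
    (fun n => (Real.exp_pos _).le) (b := fun n => (x * r) ^ n) (fun n => ?_)
    (summable_geometric_of_lt_one (by positivity) hxr)
  · have h1 : 2 * k < cutDist ω := by omega
    refine Nat.notMem_of_lt_sInf h1 ?_
    change IsCut ω (-((2 * k : ℕ) : ℤ))
    push_cast
    simpa using hcut
  · have hexp : Real.exp (Real.log x * n) = x ^ n := by
      rw [mul_comm, Real.exp_nat_mul, Real.exp_log hx0]
    rw [hexp, mul_pow]
    refine mul_le_mul_of_nonneg_left ((h _ 0).trans ?_) (by positivity)
    calc q ^ ((n + 1) / 2) ≤ (r ^ 2) ^ ((n + 1) / 2) := pow_le_pow_left₀ hq0 hqr _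
      _ = r ^ (2 * ((n + 1) / 2)) := by rw [pow_mul]
      _ ≤ r ^ n := pow_le_pow_of_le_one hr0.le hr1.le (by omega)

lemma lintegral_sq_mul_exp {l : ℝ} (hl0 : 0 < l) (hl : l < criticalBias p) :
    ∫⁻ ω, ENNReal.ofReal (((cutDist ω : ℝ) + 1) ^ 2 * Real.exp (2 * l * plainLen ω)) ∂P ≠ ∞ := by
  obtain ⟨κ, hκ, hfinD⟩ := exists_lintegral_exp_cutDist h0 h1 hP
  obtain ⟨l₃, hl3, hl3c⟩ := exists_between hl
  have hl30 : 0 < l₃ := hl0.trans hl3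
  have hgap : 0 < l₃ - l := by linarith
  have hfinL := lintegral_exp_plainLen h0 h1 hP hl3c
  -- Chosen so that κ D = δ D + l δ D / (l₃ - l): if D dominates, the first exponential absorbs 2 l
  -- L; if L dominates, the second one absorbs δ D.
  set δ := κ * (l₃ - l) / l₃ with hδ
  have hδ0 : 0 < δ := by positivity
  set C := 2 / δ ^ 2 * Real.exp δ with hC
  have hC0 : 0 ≤ C := by positivity
  have hpt : ∀ ω, ((cutDist ω : ℝ) + 1) ^ 2 * Real.exp (2 * l * plainLen ω) ≤
      C * (Real.exp (κ * cutDist ω) + Real.exp (2 * l₃ * plainLen ω)) := by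
    intro ω
    set D : ℝ := (cutDist ω : ℝ) with hD
    set L : ℝ := (plainLen ω : ℝ) with hL
    have hD0 : 0 ≤ D := Nat.cast_nonneg _
    have hL0 : 0 ≤ L := Nat.cast_nonneg _
    have e1 : (D + 1) ^ 2 ≤ C * Real.exp (δ * D) := by
      have h2 := Real.quadratic_le_exp_of_nonneg (x := δ * (D + 1)) (by positivity)
      have h3 : (δ * (D + 1)) ^ 2 / 2 ≤ Real.exp (δ * (D + 1)) := by
        have : 0 ≤ δ * (D + 1) := by positivity
        linarith
      have h4 : Real.exp (δ * (D + 1)) = Real.exp δ * Real.exp (δ * D) := by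
        rw [← Real.exp_add]; congr 1; ring
      rw [h4] at h3
      have h5 : (D + 1) ^ 2 = 2 / δ ^ 2 * ((δ * (D + 1)) ^ 2 / 2) := by
        field_simp
      rw [h5, hC, mul_assoc]
      exact mul_le_mul_of_nonneg_left h3 (by positivity)
    have e2 : Real.exp (δ * D) * Real.exp (2 * l * L) ≤
        Real.exp (κ * D) + Real.exp (2 * l₃ * L) := by
      rw [← Real.exp_add]
      rcases le_total (δ * D) (2 * (l₃ - l) * L) with h | h
      · have : Real.exp (δ * D + 2 * l * L) ≤ Real.exp (2 * l₃ * L) :=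
          Real.exp_le_exp.2 (by linarith)
        linarith [Real.exp_pos (κ * D)]
      · have h2 : κ * D = δ * D + l * (δ * D / (l₃ - l)) := by
          rw [hδ]
          field_simp
          ring
        have h3 : 2 * L ≤ δ * D / (l₃ - l) := by
          rw [le_div_iff₀ hgap]
          linarith
        have : Real.exp (δ * D + 2 * l * L) ≤ Real.exp (κ * D) :=
          Real.exp_le_exp.2 (by rw [h2]; nlinarith)
        linarith [Real.exp_pos (2 * l₃ * L)]
    calc _ ≤ C * Real.exp (δ * D) * Real.exp (2 * l * L) :=
          mul_le_mul_of_nonneg_right e1 (Real.exp_pos _).le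
      _ = C * (Real.exp (δ * D) * Real.exp (2 * l * L)) := by ring
      _ ≤ _ := mul_le_mul_of_nonneg_left e2 hC0
  have hmD : Measurable fun ω => ENNReal.ofReal (Real.exp (κ * cutDist ω)) :=
    (measurable_of_countable fun n : ℕ => ENNReal.ofReal (Real.exp (κ * n))).comp measurable_cutDist
  refine ne_top_of_le_ne_top ?_ (lintegral_mono fun ω => ENNReal.ofReal_le_ofReal (hpt ω))
  have hsplit : ∀ ω, ENNReal.ofReal (C * (Real.exp (κ * cutDist ω) +
      Real.exp (2 * l₃ * plainLen ω))) = ENNReal.ofReal C * (ENNReal.ofReal (Real.exp (κ * cutDist ω)) +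
      ENNReal.ofReal (Real.exp (2 * l₃ * plainLen ω))) := by
    intro ω
    rw [ENNReal.ofReal_mul hC0, ENNReal.ofReal_add (Real.exp_pos _).le (Real.exp_pos _).le]
  simp only [hsplit]
  rw [lintegral_const_mul' _ _ ENNReal.ofReal_ne_top, lintegral_add_left hmD]
  exact ENNReal.mul_ne_top ENNReal.ofReal_ne_top (ENNReal.add_ne_top.2 ⟨hfinD, hfinL⟩)

/-! ### The mean number of visits as a function of the bias -/

/-- The traps of different lengths are disjoint, and one of length n contributes at least exp(2λn)
with probability of order at least exp(-2λ_c n). -/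
lemma exists_le_meanVisits : ∃ c : ℝ, 0 < c ∧ ∀ lam : ℝ, 0 < lam →
    ∑' n : ℕ, ENNReal.ofReal (c * Real.exp (2 * (lam - criticalBias p)) ^ n) ≤
      meanVisits P lam := by
  obtain ⟨c, hc, h⟩ := exists_le_limit_trapEvent h0 h1 hP
  refine ⟨c, hc, fun lam hl => ?_⟩
  have hm : ∀ n, MeasurableSet (trapEvent n) := fun n => (trapEvent_dependsOn n).measurableSet_config
  rw [meanVisits_eq h0 h1 hP hl]
  calc ∑' n : ℕ, ENNReal.ofReal (c * Real.exp (2 * (lam - criticalBias p)) ^ n)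
      ≤ ∑' n : ℕ, ∫⁻ ω, (trapEvent n).indicator
          (fun _ => ENNReal.ofReal (Real.exp (2 * lam * n))) ω ∂P := by
        refine ENNReal.tsum_le_tsum fun n => ?_
        rw [lintegral_indicator_const (hm n), ← ofReal_measureReal (μ := P),
          ← ENNReal.ofReal_mul (Real.exp_pos _).le]
        refine ENNReal.ofReal_le_ofReal ?_
        refine le_trans (le_of_eq ?_) (mul_le_mul_of_nonneg_left (h n) (Real.exp_pos _).le)
        rw [← Real.exp_nat_mul, ← Real.exp_nat_mul, mul_left_comm (Real.exp _) c,
          ← Real.exp_add]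
        congr 2
        ring
    _ = ∫⁻ ω, ∑' n : ℕ, (trapEvent n).indicator
          (fun _ => ENNReal.ofReal (Real.exp (2 * lam * n))) ω ∂P :=
        (lintegral_tsum fun n => (measurable_const.indicator (hm n)).aemeasurable).symm
    _ ≤ ∫⁻ ω, ENNReal.ofReal (norm lam * colGreen lam ω) ∂P := by
        refine lintegral_mono_ae ?_
        filter_upwards [ae_isGood h0 h1 hP] with ω hω
        rw [tsum_eq_single (cutDist ω)]
        · by_cases hmem : ω ∈ trapEvent (cutDist ω)
          · rw [Set.indicator_of_mem hmem]
            refine ENNReal.ofReal_le_ofReal ?_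
            have := le_colGreen_of_trapEvent hl hω hmem
            rw [div_le_iff₀ (norm_pos lam)] at this
            linarith
          · rw [Set.indicator_of_notMem hmem]
            exact zero_le
        · intro n hn
          exact Set.indicator_of_notMem (fun hmem => hn (cutDist_of_trapEvent hmem).symm) _

lemma meanVisits_ne_zero {lam : ℝ} (hl : 0 < lam) : meanVisits P lam ≠ 0 := by
  obtain ⟨c, hc, h⟩ := exists_le_meanVisits h0 h1 hP
  have h2 := (ENNReal.le_tsum 0).trans (h lam hl)
  rw [pow_zero, mul_one] at h2
  exact ((ENNReal.ofReal_pos.2 hc).trans_le h2).ne'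

lemma meanVisits_eq_top {lam : ℝ} (hl : 0 < lam) (hlc : criticalBias p ≤ lam) :
    meanVisits P lam = ∞ := by
  obtain ⟨c, hc, h⟩ := exists_le_meanVisits h0 h1 hP
  refine top_le_iff.1 (le_trans ?_ (h lam hl))
  calc (∞ : ℝ≥0∞) = ∑' _ : ℕ, ENNReal.ofReal c :=
        (ENNReal.tsum_const_eq_top_of_ne_zero (ENNReal.ofReal_pos.2 hc).ne').symm
    _ ≤ _ := by
        refine ENNReal.tsum_le_tsum fun n => ENNReal.ofReal_le_ofReal ?_
        refine le_mul_of_one_le_right hc.le (one_le_pow₀ ?_)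
        exact Real.one_le_exp (by linarith)

lemma meanVisits_ne_top {lam : ℝ} (hl : 0 < lam) (hlc : lam < criticalBias p) :
    meanVisits P lam ≠ ∞ := by
  rw [meanVisits_eq h0 h1 hP hl]
  have hR := resBound_pos hl
  have hN := norm_pos lam
  refine ne_top_of_le_ne_top (b := ENNReal.ofReal (norm lam * (2 * resBound lam)) *
    ∫⁻ ω, ENNReal.ofReal (Real.exp (2 * lam * plainLen ω)) ∂P)
    (ENNReal.mul_ne_top ENNReal.ofReal_ne_top (lintegral_exp_plainLen h0 h1 hP hlc)) ?_
  rw [← lintegral_const_mul' _ _ ENNReal.ofReal_ne_top]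
  refine lintegral_mono_ae ?_
  filter_upwards [ae_isGood h0 h1 hP] with ω hω
  rw [← ENNReal.ofReal_mul (by positivity)]
  refine ENNReal.ofReal_le_ofReal ?_
  calc norm lam * colGreen lam ω ≤ norm lam * (2 * (resBound lam * Real.exp (2 * lam * plainLen ω))) :=
        mul_le_mul_of_nonneg_left (hω.colGreen_le hl) hN.le
    _ = _ := by ring

/-- The speed near the critical bias. -/
lemma exists_inv_meanVisits_le : ∃ c : ℝ, 0 < c ∧ ∀ lam : ℝ, 0 < lam →
    (meanVisits P lam).toReal⁻¹ ≤ |1 - Real.exp (2 * (lam - criticalBias p))| / c := by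
  obtain ⟨c, hc, h⟩ := exists_le_meanVisits h0 h1 hP
  refine ⟨c, hc, fun lam hl => ?_⟩
  rcases le_or_gt (criticalBias p) lam with hlc | hlc
  · rw [meanVisits_eq_top h0 h1 hP hl hlc, ENNReal.toReal_top, inv_zero]
    positivity
  · have hx : Real.exp (2 * (lam - criticalBias p)) < 1 := Real.exp_lt_one_iff.2 (by linarith)
    have hx0 := Real.exp_pos (2 * (lam - criticalBias p))
    set x := Real.exp (2 * (lam - criticalBias p))
    have h2 := h lam hl
    rw [← ENNReal.ofReal_tsum_of_nonneg (fun n => by positivity)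
      ((summable_geometric_of_lt_one hx0.le hx).mul_left c), tsum_mul_left,
      tsum_geometric_of_lt_one hx0.le hx] at h2
    have h3 := ENNReal.toReal_mono (meanVisits_ne_top h0 h1 hP hl hlc) h2
    have hx1 : 0 < 1 - x := by linarith
    rw [ENNReal.toReal_ofReal (by positivity)] at h3
    rw [abs_of_pos hx1]
    calc _ ≤ (c * (1 - x)⁻¹)⁻¹ := inv_anti₀ (by positivity) h3
      _ = _ := by rw [mul_inv, inv_inv, div_eq_inv_mul]

/-- Measurability comes through the walk: almost surely the potential is the expected number of
visits divided by a constant. -/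
lemma aemeasurable_colGreen {lam : ℝ} (hl : 0 < lam) : AEMeasurable (colGreen lam) P := by
  have hm : Measurable fun ω => (∫⁻ ξ, colVisits (ω, ξ) ∂(stackLaw lam)).toReal / norm lam :=
    (measurable_colVisits.lintegral_prod_right').ennreal_toReal.div_const _
  refine ⟨_, hm, ?_⟩
  filter_upwards [ae_isGood h0 h1 hP] with ω hω
  have hN := norm_pos lam
  have : ∫⁻ ξ, colVisits (ω, ξ) ∂(stackLaw lam) = ENNReal.ofReal (norm lam * colGreen lam ω) := by
    simp only [colVisits]
    rw [lintegral_visits, colGreen, Finset.mul_sum, ENNReal.ofReal_sum_of_nonneg fun j _ =>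
      mul_nonneg hN.le (hω.green_nonneg hl _)]
    refine Finset.sum_congr rfl fun j _ => ?_
    rw [tsum_ofReal_heat hl le_rfl hω.toInfty_entry]
    simp [revMeasure]
  rw [this, ENNReal.toReal_ofReal (mul_nonneg hN.le (hω.colGreen_nonneg hl)),
    mul_div_cancel_left₀ _ hN.ne']

lemma toReal_meanVisits {lam : ℝ} (hl : 0 < lam) :
    (meanVisits P lam).toReal = norm lam * ∫ ω, colGreen lam ω ∂P := by
  rw [meanVisits_eq h0 h1 hP hl, ← integral_const_mul, integral_eq_lintegral_of_nonneg_ae]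
  · filter_upwards [ae_isGood h0 h1 hP] with ω hω
    exact mul_nonneg (norm_pos lam).le (hω.colGreen_nonneg hl)
  · exact ((aemeasurable_colGreen h0 h1 hP hl).const_mul _).aestronglyMeasurable

lemma integrable_colGreen {lam : ℝ} (hl : 0 < lam) (hlc : lam < criticalBias p) :
    Integrable (colGreen lam) P := by
  refine ⟨(aemeasurable_colGreen h0 h1 hP hl).aestronglyMeasurable, ?_⟩
  rw [hasFiniteIntegral_iff_norm]
  have hN := norm_pos lam
  have hfin := meanVisits_ne_top h0 h1 hP hl hlc
  rw [meanVisits_eq h0 h1 hP hl] at hfin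
  simp only [ENNReal.ofReal_mul hN.le] at hfin
  rw [lintegral_const_mul' _ _ ENNReal.ofReal_ne_top] at hfin
  have h2 : ∫⁻ ω, ENNReal.ofReal ‖colGreen lam ω‖ ∂P = ∫⁻ ω, ENNReal.ofReal (colGreen lam ω) ∂P := by
    refine lintegral_congr_ae ?_
    filter_upwards [ae_isGood h0 h1 hP] with ω hω
    rw [Real.norm_of_nonneg (hω.colGreen_nonneg hl)]
  rw [h2, lt_top_iff_ne_top]
  intro htop
  rw [htop, ENNReal.mul_top (ENNReal.ofReal_pos.2 hN).ne'] at hfin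
  exact hfin rfl

/-- The mean potential is locally Lipschitz continuous below the critical bias. -/
lemma exists_lipschitz {a b : ℝ} (ha : 0 < a) (hab : a ≤ b) (hb : b < criticalBias p) :
    ∃ K : ℝ, ∀ l l' : ℝ, a ≤ l → l ≤ l' → l' ≤ b →
      |∫ ω, colGreen l' ω ∂P - ∫ ω, colGreen l ω ∂P| ≤ K * (l' - l) := by
  have hb0 : 0 < b := ha.trans_le hab
  set R := 2 * Real.exp b / (1 - Real.exp (-(2 * a))) with hR
  have ha1 := exp_neg_two_mul_lt_one ha
  have hR0 : 0 ≤ R := div_nonneg (by positivity) (by linarith)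
  set S := ∑' n : ℕ, (2 * (n : ℝ) + 1) * (Real.exp b * Real.exp (-(2 * a)) ^ n) with hS
  have hS0 : 0 ≤ S := tsum_nonneg fun n => by positivity
  -- A Lipschitz constant for fixed environment that serves all biases between a and b. It is
  -- integrable because b lies below the critical bias.
  set W : Config → ℝ := fun ω =>
    6 * (2 * R + S) * (((cutDist ω : ℝ) + 1) ^ 2 * Real.exp (2 * b * plainLen ω)) with hW
  have hW0 : ∀ ω, 0 ≤ W ω := fun ω => by positivity
  have hWfin : ∫⁻ ω, ENNReal.ofReal (W ω) ∂P ≠ ∞ := by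
    simp only [hW, ENNReal.ofReal_mul (show 0 ≤ 6 * (2 * R + S) by positivity)]
    rw [lintegral_const_mul' _ _ ENNReal.ofReal_ne_top]
    exact ENNReal.mul_ne_top ENNReal.ofReal_ne_top (lintegral_sq_mul_exp h0 h1 hP hb0 hb)
  refine ⟨(∫⁻ ω, ENNReal.ofReal (W ω) ∂P).toReal, fun l l' hl hll hl' => ?_⟩
  have hl0 : 0 < l := ha.trans_le hl
  have hl'0 : 0 < l' := hl0.trans_le hll
  have hΔ : 0 ≤ l' - l := by linarith
  have hpt : ∀ᵐ ω ∂P, |colGreen l' ω - colGreen l ω| ≤ (l' - l) * W ω := by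
    filter_upwards [ae_isGood h0 h1 hP] with ω hω
    refine (hω.abs_colGreen_sub_le hl0 hll).trans (mul_le_mul_of_nonneg_left ?_ hΔ)
    have e1 : resBound l' ≤ R := by
      unfold resBound
      rw [hR]
      have : Real.exp (-(2 * l')) ≤ Real.exp (-(2 * a)) := Real.exp_le_exp.2 (by linarith)
      exact div_le_div₀ (by positivity) (by gcongr) (by linarith) (by linarith)
    have e2 : Real.exp (2 * l' * plainLen ω) ≤ Real.exp (2 * b * plainLen ω) := by
      gcongr
    have e3 : ∑' n : ℕ, (2 * (n : ℝ) + 1) * (Real.exp l' * Real.exp (-(2 * l)) ^ n) ≤ S := by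
      refine (summable_columnBound hl0 l').tsum_le_tsum (fun n => ?_) (summable_columnBound ha b)
      gcongr
    have e4 : (1 : ℝ) ≤ ((cutDist ω : ℝ) + 1) ^ 2 * Real.exp (2 * b * plainLen ω) := by
      have h2 : (1 : ℝ) ≤ ((cutDist ω : ℝ) + 1) ^ 2 :=
        one_le_pow₀ (by linarith [Nat.cast_nonneg (α := ℝ) (cutDist ω)])
      have h3 : 1 ≤ Real.exp (2 * b * plainLen ω) := Real.one_le_exp (by positivity)
      nlinarith
    have hRl := (resBound_pos hl'0).le
    have e5 : (2 * (cutDist ω : ℝ) + 1) * (resBound l' * Real.exp (2 * l' * plainLen ω)) *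
        (cutDist ω + 1) ≤ 2 * R * (((cutDist ω : ℝ) + 1) ^ 2 * Real.exp (2 * b * plainLen ω)) := by
      have h2 : resBound l' * Real.exp (2 * l' * plainLen ω) ≤ R * Real.exp (2 * b * plainLen ω) :=
        mul_le_mul e1 e2 (Real.exp_pos _).le hR0
      calc _ ≤ (2 * ((cutDist ω : ℝ) + 1)) * (R * Real.exp (2 * b * plainLen ω)) *
            (cutDist ω + 1) := by
            gcongr
            linarith
        _ = _ := by ring
    have e6 : S ≤ S * (((cutDist ω : ℝ) + 1) ^ 2 * Real.exp (2 * b * plainLen ω)) :=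
      le_mul_of_one_le_right hS0 e4
    simp only [hW]
    calc _ ≤ 6 * (2 * R * (((cutDist ω : ℝ) + 1) ^ 2 * Real.exp (2 * b * plainLen ω)) +
          S * (((cutDist ω : ℝ) + 1) ^ 2 * Real.exp (2 * b * plainLen ω))) := by linarith
      _ = _ := by ring
  rw [← integral_sub (integrable_colGreen h0 h1 hP hl'0 (hl'.trans_lt hb))
    (integrable_colGreen h0 h1 hP hl0 (hll.trans_lt (hl'.trans_lt hb))), ← Real.norm_eq_abs]
  refine (norm_integral_le_lintegral_norm _).trans ?_
  have hle : ∫⁻ ω, ENNReal.ofReal ‖colGreen l' ω - colGreen l ω‖ ∂P ≤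
      ENNReal.ofReal (l' - l) * ∫⁻ ω, ENNReal.ofReal (W ω) ∂P := by
    rw [← lintegral_const_mul' _ _ ENNReal.ofReal_ne_top]
    refine lintegral_mono_ae ?_
    filter_upwards [hpt] with ω hω
    rw [← ENNReal.ofReal_mul hΔ]
    exact ENNReal.ofReal_le_ofReal hω
  refine (ENNReal.toReal_mono (ENNReal.mul_ne_top ENNReal.ofReal_ne_top hWfin) hle).trans ?_
  rw [ENNReal.toReal_mul, ENNReal.toReal_ofReal hΔ, mul_comm]

open Asymptotics in
/-- The speed is locally Lipschitz continuous below the critical bias. -/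
lemma isBigO_speed {lam : ℝ} (hl : 0 < lam) (hlc : lam < criticalBias p) :
    (fun l => (meanVisits P l).toReal⁻¹ - (meanVisits P lam).toReal⁻¹) =O[𝓝 lam]
      fun l => l - lam := by
  set Γ : ℝ → ℝ := fun l => ∫ ω, colGreen l ω ∂P with hΓ
  obtain ⟨b, hb1, hb2⟩ := exists_between hlc
  obtain ⟨K, hK⟩ := exists_lipschitz h0 h1 hP (a := lam / 2) (by positivity)
    (show lam / 2 ≤ b by linarith) hb2
  have hnear : ∀ᶠ l in 𝓝 lam, lam / 2 < l ∧ l < b := Ioo_mem_nhds (by linarith) hb1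
  have hΓO : (fun l => Γ l - Γ lam) =O[𝓝 lam] fun l => l - lam := by
    refine IsBigO.of_bound K ?_
    filter_upwards [hnear] with l hl'
    rw [Real.norm_eq_abs, Real.norm_eq_abs]
    rcases le_total lam l with h | h
    · rw [abs_of_nonneg (sub_nonneg.2 h)]
      exact hK lam l (by linarith) h hl'.2.le
    · rw [abs_sub_comm, abs_of_nonpos (sub_nonpos.2 h), neg_sub]
      exact hK l lam hl'.1.le h hb1.le
  have hnormd : DifferentiableAt ℝ norm lam := by
    unfold norm
    fun_prop
  have hnormO : (fun l => norm l - norm lam) =O[𝓝 lam] fun l => l - lam := hnormd.isBigO_sub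
  have hnorm1 : norm =O[𝓝 lam] fun _ => (1 : ℝ) := hnormd.continuousAt.isBigO_one ℝ
  set G : ℝ → ℝ := fun l => (meanVisits P l).toReal with hG
  have hGO : (fun l => G l - G lam) =O[𝓝 lam] fun l => l - lam := by
    have h2 : (fun l => norm l * (Γ l - Γ lam) + (norm l - norm lam) * Γ lam) =O[𝓝 lam]
        fun l => l - lam := by
      refine IsBigO.add ?_ ?_
      · simpa using hnorm1.mul hΓO
      · simpa using hnormO.mul (isBigO_refl (fun _ => (Γ lam)) (𝓝 lam) |>.trans
          (isBigO_const_const (Γ lam) (one_ne_zero (α := ℝ)) _))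
    refine h2.congr' ?_ EventuallyEq.rfl
    filter_upwards [hnear] with l hl'
    simp only [hG]
    rw [toReal_meanVisits h0 h1 hP hl, toReal_meanVisits h0 h1 hP (by linarith)]
    ring
  have hGpos : ∀ l, 0 < l → l < criticalBias p → 0 < G l := fun l hl hlc =>
    ENNReal.toReal_pos (meanVisits_ne_zero h0 h1 hP hl) (meanVisits_ne_top h0 h1 hP hl hlc)
  have hGt : Tendsto G (𝓝 lam) (𝓝 (G lam)) := by
    have h2 : Tendsto (fun l => l - lam) (𝓝 lam) (𝓝 0) := by
      have : Tendsto (fun l : ℝ => l - lam) (𝓝 lam) (𝓝 (lam - lam)) := tendsto_id.sub_const lam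
      rwa [sub_self] at this
    have h3 := hGO.trans_tendsto h2
    have h4 := h3.add_const (G lam)
    simpa using h4
  have hGlam := hGpos lam hl hlc
  have hinv : (fun l => -((G l)⁻¹ * (G lam)⁻¹)) =O[𝓝 lam] fun _ => (1 : ℝ) :=
    (((hGt.inv₀ hGlam.ne').mul_const _).neg).isBigO_one ℝ
  have h5 := hinv.mul hGO
  simp only [one_mul] at h5
  refine h5.congr' ?_ EventuallyEq.rfl
  filter_upwards [hnear] with l hl'
  have h6 := hGpos l (by linarith) (by linarith)
  change -((G l)⁻¹ * (G lam)⁻¹) * (G l - G lam) = (G l)⁻¹ - (G lam)⁻¹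
  field_simp
  ring

end Moments

/-! ### Positivity of the origin event, and the theorem -/

lemma originInfinite_of_trapEvent {ω : Config} (hω : ω ∈ biInfinite) (h : ω ∈ trapEvent 0) :
    ω ∈ originInfinite := by
  refine ⟨hω, fun hfin => ?_⟩
  have hcut : IsCut ω 0 := by simpa using h.1.1.1
  have hinf := toInfty_of_isCut hω hcut
  obtain ⟨w, hw, hr⟩ := hinf (∑ w ∈ hfin.toFinset, (w.1.natAbs : ℤ) + 1)
  have hmem : w ∈ cluster ω (0, 0) := hr.mono (rightGraph_le ω 0)
  have := Finset.single_le_sum (f := fun w : V => (w.1.natAbs : ℤ)) (fun _ _ => by positivity)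
    (hfin.mem_toFinset.2 hmem)
  omega

end LadderWalk

open LadderWalk in
theorem theorem2p4 (p : unitInterval) (hp0 : 0 < p) (hp1 : p < 1) :
    ∃ Pstar : Measure LadderWalk.Config,
      -- `Pstar` is the percolation law conditioned on a bi-infinite open path
      IsProbabilityMeasure Pstar ∧
      LadderWalk.IsConditionedLaw p Pstar ∧
      Pstar LadderWalk.biInfinite = 1 ∧
      0 < Pstar LadderWalk.originInfinite ∧
      ∃ v : ℝ → ℝ,
        -- `v` is the speed of the walk, and `criticalBias p` is its critical value
        (∀ lam : ℝ, 0 < lam →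
          LadderWalk.HasSpeed
            (ProbabilityTheory.cond Pstar LadderWalk.originInfinite) lam (v lam)) ∧
        0 < LadderWalk.criticalBias p ∧
        (∀ lam : ℝ, 0 < lam → lam < LadderWalk.criticalBias p → 0 < v lam) ∧
        (∀ lam : ℝ, LadderWalk.criticalBias p ≤ lam → v lam = 0) ∧
        -- regularity of the speed
        ContinuousOn v (Set.Ioi 0) ∧
        ∀ lamStar : ℝ, 0 < lamStar → lamStar < LadderWalk.criticalBias p →
          ∀ r : ℝ, 1 < r → r < min (LadderWalk.criticalBias p / lamStar) 2 →
            Tendsto (fun lam : ℝ => (v lam - v lamStar) / |lam - lamStar| ^ (r - 1))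
              (𝓝[≠] lamStar) (𝓝 0) := by
  obtain ⟨P, hprob, hcond, hP⟩ := exists_conditionedLaw hp0 hp1
  have hP : IsLocalLimit p P := hP
  have hcrit : 0 < criticalBias p := criticalBias_pos hp0 hp1
  -- An infinite mean gives speed 0 automatically, since `ENNReal.toReal` sends ∞ to 0 and the
  -- inverse of 0 is 0.
  refine ⟨P, hprob, hcond, limit_biInfinite hp0 hp1 hP, ?_, fun lam => (meanVisits P lam).toReal⁻¹,
    fun lam hl => hasSpeed hp0 hp1 hP hl (meanVisits_ne_zero hp0 hp1 hP hl), hcrit, ?_, ?_, ?_, ?_⟩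
  · obtain ⟨c, hc, h⟩ := exists_le_limit_trapEvent hp0 hp1 hP
    have h2 : 0 < P.real (trapEvent 0) := by
      have := h 0
      rw [pow_zero, mul_one] at this
      exact hc.trans_le this
    refine lt_of_lt_of_le (ENNReal.toReal_pos_iff.1 h2).1 (measure_mono_ae ?_)
    filter_upwards [ae_biInfinite hp0 hp1 hP] with ω hω h3
    exact originInfinite_of_trapEvent hω h3
  · intro lam hl hlc
    exact inv_pos.2 (ENNReal.toReal_pos (meanVisits_ne_zero hp0 hp1 hP hl)
      (meanVisits_ne_top hp0 hp1 hP hl hlc))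
  · intro lam hlc
    simp only
    rw [meanVisits_eq_top hp0 hp1 hP (hcrit.trans_le hlc) hlc, ENNReal.toReal_top, inv_zero]
  · intro lam hl
    have hl : 0 < lam := hl
    refine ContinuousAt.continuousWithinAt ?_
    rcases lt_trichotomy lam (criticalBias p) with hlc | hlc | hlc
    · have h2 : Tendsto (fun l => l - lam) (𝓝 lam) (𝓝 0) := by
        have : Tendsto (fun l : ℝ => l - lam) (𝓝 lam) (𝓝 (lam - lam)) := tendsto_id.sub_const lam
        rwa [sub_self] at this
      have h3 := ((isBigO_speed hp0 hp1 hP hl hlc).trans_tendsto h2).add_const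
        (meanVisits P lam).toReal⁻¹
      simpa [ContinuousAt] using h3
    -- At the critical bias the speed is squeezed between 0 and the reciprocal of the geometric
    -- series coming from the traps.
    · obtain ⟨c, hc, h⟩ := exists_inv_meanVisits_le hp0 hp1 hP
      rw [ContinuousAt, meanVisits_eq_top hp0 hp1 hP hl hlc.ge, ENNReal.toReal_top, inv_zero]
      have h2 : Tendsto (fun l => |1 - Real.exp (2 * (l - criticalBias p))| / c) (𝓝 lam) (𝓝 0) := by
        have hcont : Continuous fun l => |1 - Real.exp (2 * (l - criticalBias p))| / c := by
          fun_prop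
        have := hcont.tendsto lam
        rw [hlc] at this
        rw [hlc]
        simpa using this
      refine tendsto_of_tendsto_of_tendsto_of_le_of_le' tendsto_const_nhds h2 ?_ ?_
      · exact Eventually.of_forall fun l => inv_nonneg.2 ENNReal.toReal_nonneg
      · filter_upwards [lt_mem_nhds hl] with l hl'
        exact h l hl'
    · refine ContinuousAt.congr (f := fun _ => (0 : ℝ)) continuousAt_const ?_
      filter_upwards [lt_mem_nhds hlc] with l hl'
      rw [meanVisits_eq_top hp0 hp1 hP (hcrit.trans hl') hl'.le, ENNReal.toReal_top, inv_zero]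
  · intro lamStar hl hlc r hr1 hr
    have hr2 : r < 2 := hr.trans_le (min_le_right _ _)
    obtain ⟨K, hK⟩ := (isBigO_speed hp0 hp1 hP hl hlc).bound
    -- The Lipschitz bound divided by the power r - 1 leaves the exponent 2 - r > 0.
    have hlim : Tendsto (fun lam : ℝ => K * |lam - lamStar| ^ (2 - r)) (𝓝[≠] lamStar) (𝓝 0) := by
      have hcont : ContinuousAt (fun lam : ℝ => K * |lam - lamStar| ^ (2 - r)) lamStar := by
        refine continuousAt_const.mul (ContinuousAt.rpow_const ?_ (Or.inr (by linarith)))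
        fun_prop
      have := hcont.tendsto.mono_left (nhdsWithin_le_nhds (s := {lamStar}ᶜ))
      simpa [Real.zero_rpow (show 2 - r ≠ 0 by linarith)] using this
    refine squeeze_zero_norm' ?_ hlim
    filter_upwards [hK.filter_mono nhdsWithin_le_nhds, self_mem_nhdsWithin] with lam hlam hne
    have habs : 0 < |lam - lamStar| := abs_pos.2 (sub_ne_zero.2 hne)
    rw [norm_div, Real.norm_of_nonneg (Real.rpow_nonneg habs.le _),
      div_le_iff₀ (Real.rpow_pos_of_pos habs _), mul_assoc, ← Real.rpow_add habs,
      show 2 - r + (r - 1) = 1 by ring, Real.rpow_one]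
    exact hlam

end
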